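/- Logarithms are to base $2$ and $[N]=\{1,\dots,N\}$. A randomized strong-stuck-at code of length $N$ with $t$ random bits and $\ell$ clean bits consists of finite sets $\mathcal M_i\subseteq\{0,1\}^*$ $(i\in[N])$ of messages, an encoder $E$ and a decoder $D$. The encoder receives a cover vector $v\in\{0,1\}^N$, a set $\mathcal F\subseteq[N]$ of frozen positions with $|\mathcal F|=i\ge 1$, a message $m\in\mathcal M_i$ and a string $r\in\{0,1\}^t$ of random bits; it either declares failure or outputs a vector $w\in\{0,1\}^N$ and a string $u\in\{0,1\}^\ell$, where $u$ reaches the decoder without error. The decoder $D:\{0,1\}^N\times\{0,1\}^\ell\to\{0,1\}^*$ knows neither $\mathcal F$ nor $|\mathcal F|$. It is required that, whenever the encoder does not fail, $w_j=v_j$ for all $j\in\mathcal F$ and $D(w,u)=m$. The code is $\varepsilon$-gapped if $\frac1N\log|\mathcal M_{\rho N}|\ge 1-\rho-\varepsilon$ for every $\rho\in(0,1-\varepsilon)$ such that $\rho N$ is an integer. Theorem. There are absolute constants $K,a,b$ and two programs $P_E,P_D$ for a random access machine (with logarithmic cost) such that for every $\varepsilon>0$ there is $N(\varepsilon)$ such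 that for every $N>N(\varepsilon)$ there is a randomized $\varepsilon$-gapped strong-stuck-at code of length $N$, each of whose message sets $\mathcal M_i$ is the set of all binary strings of some fixed length, with the following properties. (1) The encoder uses $t\le K\frac1\varepsilon\log N$ random bits, and for all $v$, all $\mathcal F$ with $|\mathcal F|\ge1$ and all $m\in\mathcal M_{|\mathcal F|}$ it succeeds (does not declare failure) with probability at least $1-K/\log N$ over uniform $r\in\{0,1\}^t$. (2) The encoder transmits $\ell\le K\frac1\varepsilon\log N$ bits to the decoder without error. (3) Given $N$ and $\lceil 1/\varepsilon\rceil$ as additional inputs, $P_E$ computes $E$ and $P_D$ computes $D$, each in time at most $K\,N\,(\log N)^a\,(1/\varepsilon)^b$ on all inputs. -/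

import Mathlib

namespace StuckAt

/-! ### Machine model: a random access machine under the logarithmic cost criterion -/

/-- Number of bits needed to write down `n` (plus one, so that it is positive). -/
def len (n : ℕ) : ℕ := Nat.size n + 1

/-- Contents of the memory: registers `reg x` and arrays `arr k`, all holding natural numbers. -/
structure State where
  reg : ℕ → ℕ
  arr : ℕ → ℕ → ℕ

/-- Primitive operations on natural numbers; `sub` is truncated, `lt` and `eq` return `0` or `1`. -/
inductive Op where
  | add | sub | mul | div | mod | lt | eq

def Op.apply : Op → ℕ → ℕ → ℕ
  | .add, x, y => x + y
  | .sub, x, y => x - y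
  | .mul, x, y => x * y
  | .div, x, y => x / y
  | .mod, x, y => x % y
  | .lt, x, y => if x < y then 1 else 0
  | .eq, x, y => if x = y then 1 else 0

/-- Expressions; `read k e` is the entry with index `e` of the array `k`. -/
inductive Expr where
  | const (n : ℕ)
  | reg (x : ℕ)
  | read (k : ℕ) (e : Expr)
  | op (o : Op) (e₁ e₂ : Expr)

def Expr.val (s : State) : Expr → ℕ
  | .const n => n
  | .reg x => s.reg x
  | .read k e => s.arr k (e.val s)
  | .op o e₁ e₂ => o.apply (e₁.val s) (e₂.val s)

/-- Cost of evaluating an expression: the total bit length of all operands and addresses. -/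
def Expr.cost (s : State) : Expr → ℕ
  | .const n => len n
  | .reg x => len (s.reg x)
  | .read k e => e.cost s + len (e.val s) + len (s.arr k (e.val s))
  | .op _ e₁ e₂ => e₁.cost s + e₂.cost s + len (e₁.val s) + len (e₂.val s)

/-- Programs. -/
inductive Cmd where
  | skip
  | assign (x : ℕ) (e : Expr)
  | store (k : ℕ) (i e : Expr)
  | seq (p q : Cmd)
  | cond (e : Expr) (p q : Cmd)
  | loop (e : Expr) (p : Cmd)

def State.setReg (s : State) (x n : ℕ) : State :=
  { s with reg := Function.update s.reg x n }

def State.setArr (s : State) (k i n : ℕ) : State :=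
  { s with arr := Function.update s.arr k (Function.update (s.arr k) i n) }

/-- `Run p s s' τ`: started in state `s`, the program `p` halts in state `s'` after time `τ`. -/
inductive Run : Cmd → State → State → ℕ → Prop where
  | skip (s : State) : Run .skip s s 1
  | assign (s : State) (x : ℕ) (e : Expr) :
      Run (.assign x e) s (s.setReg x (e.val s)) (1 + e.cost s + len (e.val s))
  | store (s : State) (k : ℕ) (i e : Expr) :
      Run (.store k i e) s (s.setArr k (i.val s) (e.val s))
        (1 + i.cost s + e.cost s + len (i.val s) + len (e.val s))
  | seq {p q : Cmd} {s s' s'' : State} {τ τ' : ℕ} :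
      Run p s s' τ → Run q s' s'' τ' → Run (.seq p q) s s'' (τ + τ')
  | cond_true {e : Expr} {p q : Cmd} {s s' : State} {τ : ℕ} :
      e.val s ≠ 0 → Run p s s' τ → Run (.cond e p q) s s' (1 + e.cost s + τ)
  | cond_false {e : Expr} {p q : Cmd} {s s' : State} {τ : ℕ} :
      e.val s = 0 → Run q s s' τ → Run (.cond e p q) s s' (1 + e.cost s + τ)
  | loop_true {e : Expr} {p : Cmd} {s s' s'' : State} {τ τ' : ℕ} :
      e.val s ≠ 0 → Run p s s' τ → Run (.loop e p) s' s'' τ' →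
        Run (.loop e p) s s'' (1 + e.cost s + τ + τ')
  | loop_false {e : Expr} {p : Cmd} {s : State} :
      e.val s = 0 → Run (.loop e p) s s (1 + e.cost s)

/-! ### Codes -/

/-- A randomized strong-stuck-at code of length `N`, whose encoder uses `t` random bits and sends
`l` bits to the decoder over an errorless side channel. The message sets `msg i` (for `i` frozen
positions, `1 ≤ i ≤ N`) consist of binary strings. The encoder gets the cover vector `v`, the
frozen set `F`, a message of `msg F.card` and the random bits; it either declares failure (`none`)
or returns a vector together with the side information. The decoder knows neither `F` nor its
size. Whenever the encoder does not fail, its output is consistent and is decoded correctly. -/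
structure RandomizedCode (N t l : ℕ) where
  msg : ℕ → Finset (List Bool)
  enc : (Fin N → Bool) → Finset (Fin N) → List Bool → (Fin t → Bool) →
    Option ((Fin N → Bool) × (Fin l → Bool))
  dec : (Fin N → Bool) → (Fin l → Bool) → List Bool
  consistent : ∀ v F m r w u, 1 ≤ F.card → m ∈ msg F.card →
    enc v F m r = some (w, u) → ∀ j ∈ F, w j = v j
  decodable : ∀ v F m r w u, 1 ≤ F.card → m ∈ msg F.card →
    enc v F m r = some (w, u) → dec w u = m

namespace RandomizedCode

variable {N t l : ℕ}

/-- The rate with `i` frozen positions, i.e. at defect fraction `i / N`. -/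
noncomputable def rate (C : RandomizedCode N t l) (i : ℕ) : ℝ :=
  Real.logb 2 ((C.msg i).card : ℝ) / (N : ℝ)

/-- The rate is at least `1 - ρ - ε` at every defect fraction `ρ = i / N` in `(0, 1 - ε)`. -/
def IsGapped (C : RandomizedCode N t l) (ε : ℝ) : Prop :=
  ∀ i : ℕ, 1 ≤ i → i ≤ N → (i : ℝ) / (N : ℝ) < 1 - ε →
    1 - (i : ℝ) / (N : ℝ) - ε ≤ C.rate i

/-- The probability, over `t` uniform random bits, that the encoder does not fail. -/
noncomputable def successProb (C : RandomizedCode N t l) (v : Fin N → Bool) (F : Finset (Fin N))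
    (m : List Bool) : ℝ :=
  ((Finset.univ.filter fun r : Fin t → Bool => (C.enc v F m r).isSome).card : ℝ) / 2 ^ t

end RandomizedCode

/-! ### Programs that compute the encoder and the decoder -/

/-- The array holding the bits of a string, followed by zeros. -/
def bits (x : List Bool) (j : ℕ) : ℕ := (x.getD j false).toNat

/-- Input of the encoding program: the numbers `N`, `c` and the length of the message in the
registers `0, 1, 2`; the cover vector, the indicator vector of the frozen set, the message and the
random bits in the arrays `0, 1, 2, 3`; everything else is `0`. -/
def encInput {N t : ℕ} (c : ℕ) (v : Fin N → Bool) (F : Finset (Fin N)) (m : List Bool)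
    (r : Fin t → Bool) : State where
  reg x := if x = 0 then N else if x = 1 then c else if x = 2 then m.length else 0
  arr k := if k = 0 then bits (List.ofFn v)
    else if k = 1 then bits (List.ofFn fun j => decide (j ∈ F))
    else if k = 2 then bits m
    else if k = 3 then bits (List.ofFn r)
    else fun _ => 0

/-- Input of the decoding program: the numbers `N`, `c` and the length of the side information in
the registers `0, 1, 2`; the stored vector and the side information in the arrays `0, 1`. -/
def decInput {N l : ℕ} (c : ℕ) (w : Fin N → Bool) (u : Fin l → Bool) : State where
  reg x := if x = 0 then N else if x = 1 then c else if x = 2 then l else 0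
  arr k := if k = 0 then bits (List.ofFn w)
    else if k = 1 then bits (List.ofFn u)
    else fun _ => 0

/-- Output of the encoding program: register `0` is `0` for failure; for success it is `1`, register
`1` is the length of the side information, and the arrays `0, 1` start with the vector and the
side information. -/
def IsEncOutput {N l : ℕ} (s : State) : Option ((Fin N → Bool) × (Fin l → Bool)) → Prop
  | none => s.reg 0 = 0
  | some (w, u) => s.reg 0 = 1 ∧ s.reg 1 = l ∧
      (∀ j : Fin N, s.arr 0 j = (w j).toNat) ∧ (∀ j : Fin l, s.arr 1 j = (u j).toNat)

/-- Output of the decoding program: the length of the message in register `0`, its bits in the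
array `0`. -/
def IsDecOutput (s : State) (m : List Bool) : Prop :=
  s.reg 0 = m.length ∧ ∀ j, j < m.length → s.arr 0 j = bits m j

/-- The program `P`, given the parameter `c`, computes the encoder of `C` in time at most `T`, for
all admissible inputs and all values of the random bits. -/
def EncodesInTime {N t l : ℕ} (P : Cmd) (c : ℕ) (C : RandomizedCode N t l) (T : ℝ) : Prop :=
  ∀ (v : Fin N → Bool) (F : Finset (Fin N)) (m : List Bool) (r : Fin t → Bool),
    1 ≤ F.card → m ∈ C.msg F.card →
      ∃ (s : State) (τ : ℕ), Run P (encInput c v F m r) s τ ∧ (τ : ℝ) ≤ T ∧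
        IsEncOutput s (C.enc v F m r)

/-- The program `P`, given the parameter `c`, computes the decoder of `C` in time at most `T`, on
all pairs of a vector and a side information. -/
def DecodesInTime {N t l : ℕ} (P : Cmd) (c : ℕ) (C : RandomizedCode N t l) (T : ℝ) : Prop :=
  ∀ (w : Fin N → Bool) (u : Fin l → Bool),
    ∃ (s : State) (τ : ℕ), Run P (decInput c w u) s τ ∧ (τ : ℝ) ≤ T ∧
      IsDecOutput s (C.dec w u)

end StuckAt

namespace StuckAt

/-! ### Outline

The positions are cut into blocks of length `B = O(log N / ε)`. The random bits `r` define the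
matrix with entries `r (i + x)`, which all blocks share. In a block with `f` free positions the
encoder solves, by Gaussian elimination on the free positions, for a prescribed syndrome of up to
`f - O(log N)` bits; its first bits are a header that names the previous block in use and the length
of its syndrome, the others carry the message. The side information consists of `r` and the last
header. A union bound shows that all these linear systems are solvable for most `r`. -/

open Finset

-- If the decoder knows a binary matrix H, a message can be sent as the syndrome H w. The encoder
-- changes w on the free positions only, and it reaches every syndrome once the rows of H are
-- independent on these positions. With f free positions, a random H with f - L rows fails with
-- probability at most 2^(-L), so few free positions are wasted. Two obstacles remain: elimination
-- on N columns is too slow, and the decoder does not know f.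
--
-- Cutting into M = ⌊N/B⌋ blocks of length B = 8cn, with c = ⌈1/ε⌉ and n = `Nat.size N`, removes the
-- first obstacle: elimination takes O(B³) steps per block, hence O(N B²) in all. The blocks share
-- one matrix with entries r(a + x), given by 2B random bits. Its entries are dependent, but this
-- does no harm. If i is the last index with nonzero coefficient in a combination of the rows, its
-- vanishing in column x determines r(i + x) from earlier bits, so it vanishes on f given columns
-- with probability at most 2^(-f) (`card_orthogonal_le`). With L = 2n we have 2^L > N², and a union
-- bound over combinations and blocks leaves failure probability at most 1/N (`successful_seeds`).
--
-- Chaining removes the second obstacle. The first L syndrome bits of a used block tell which used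
-- block precedes it and how long the syndrome there is; the last such header is sent with the seed.
-- The encoder moves forward and stores the message from its end, so that the decoder, moving
-- backward, finds it in the right order (`decList_chain`, `encLoop_spec`, `decLoop_spec`). A block
-- loses at most 2L free positions, L for the header and L for the failure probability; by the
-- choice of B these losses and the N % B unused positions each amount to at most εN/2 (`capacity`,
-- `Admissible.gap_le`).
--
-- The programs are verified with the triples `Wp`, which also bound the time. All memory contents
-- stay below 2^L, so every elementary step costs O(log N). For ε ≥ 1 the gap condition is void and
-- a code with only the empty message suffices.

local infixr:60 " ;; " => Cmd.seq
local notation "R" => Expr.reg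

/-! ### Reasoning about programs -/

instance : Add Expr := ⟨Expr.op .add⟩
instance : Sub Expr := ⟨Expr.op .sub⟩
instance : Mul Expr := ⟨Expr.op .mul⟩
instance : Div Expr := ⟨Expr.op .div⟩
instance : Mod Expr := ⟨Expr.op .mod⟩
instance (n : ℕ) : OfNat Expr n := ⟨Expr.const n⟩

@[simp] theorem Expr.val_add (s : State) (a b : Expr) : (a + b).val s = a.val s + b.val s := rfl
@[simp] theorem Expr.val_sub (s : State) (a b : Expr) : (a - b).val s = a.val s - b.val s := rfl
@[simp] theorem Expr.val_mul (s : State) (a b : Expr) : (a * b).val s = a.val s * b.val s := rfl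
@[simp] theorem Expr.val_div (s : State) (a b : Expr) : (a / b).val s = a.val s / b.val s := rfl
@[simp] theorem Expr.val_mod (s : State) (a b : Expr) : (a % b).val s = a.val s % b.val s := rfl
@[simp] theorem Expr.val_zero (s : State) : (0 : Expr).val s = 0 := rfl
@[simp] theorem Expr.val_one (s : State) : (1 : Expr).val s = 1 := rfl
@[simp] theorem Expr.val_two (s : State) : (2 : Expr).val s = 2 := rfl
@[simp] theorem Expr.val_eight (s : State) : (8 : Expr).val s = 8 := rfl
@[simp] theorem Expr.val_reg (s : State) (x : ℕ) : (Expr.reg x).val s = s.reg x := rfl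
@[simp] theorem Expr.val_read (s : State) (k : ℕ) (e : Expr) :
    (Expr.read k e).val s = s.arr k (e.val s) := rfl
@[simp] theorem Expr.val_lt (s : State) (a b : Expr) :
    (Expr.op .lt a b).val s = if a.val s < b.val s then 1 else 0 := rfl
theorem Expr.val_lt_le (s : State) (a b : Expr) : (Expr.op .lt a b).val s ≤ 1 := by
  rw [Expr.val_lt]
  split_ifs <;> omega
@[simp] theorem Expr.val_eq (s : State) (a b : Expr) :
    (Expr.op .eq a b).val s = if a.val s = b.val s then 1 else 0 := rfl

@[simp] theorem State.reg_setReg (s : State) (x n y : ℕ) :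
    (s.setReg x n).reg y = if y = x then n else s.reg y := by
  simp [State.setReg, Function.update_apply]
@[simp] theorem State.arr_setReg (s : State) (x n : ℕ) : (s.setReg x n).arr = s.arr := rfl
@[simp] theorem State.reg_setArr (s : State) (k i n : ℕ) : (s.setArr k i n).reg = s.reg := rfl
@[simp] theorem State.arr_setArr (s : State) (k i n k' : ℕ) :
    (s.setArr k i n).arr k' = if k' = k then Function.update (s.arr k) i n else s.arr k' := by
  simp [State.setArr, Function.update_apply]

/-! ### Bounded memory and the cost of expressions -/

/-- All values in the memory are at most `V`. -/
def Bdd (V : ℕ) (s : State) : Prop := (∀ x, s.reg x ≤ V) ∧ ∀ k i, s.arr k i ≤ V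

theorem Bdd.setReg {V : ℕ} {s : State} (h : Bdd V s) {x n : ℕ} (hn : n ≤ V) :
    Bdd V (s.setReg x n) := by
  refine ⟨fun y => ?_, h.2⟩
  rw [State.reg_setReg]
  split_ifs
  exacts [hn, h.1 y]

theorem Bdd.setArr {V : ℕ} {s : State} (h : Bdd V s) {k i n : ℕ} (hn : n ≤ V) :
    Bdd V (s.setArr k i n) := by
  refine ⟨h.1, fun k' i' => ?_⟩
  rw [State.arr_setArr]
  split_ifs
  · rw [Function.update_apply]
    split_ifs
    exacts [hn, h.2 k i']
  · exact h.2 k' i'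

/-- Number of nodes of an expression. -/
def Expr.size : Expr → ℕ
  | .const _ => 1
  | .reg _ => 1
  | .read _ e => e.size + 1
  | .op _ a b => a.size + b.size + 1

/-- All constants in the expression are at most `20`. -/
def Expr.small : Expr → Bool
  | .const n => decide (n ≤ 20)
  | .reg _ => true
  | .read _ e => e.small
  | .op _ a b => a.small && b.small

/-- Expressions with at most `20` nodes and small constants. -/
def Expr.ok (e : Expr) : Bool := decide (e.size ≤ 20) && e.small

theorem Expr.one_le_size (e : Expr) : 1 ≤ e.size := by cases e <;> simp [Expr.size]

/-- No operation exceeds the sum or the product of the two bounds, and the spare factor `V` from the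
node itself absorbs the sum. Bit lengths of all intermediate values are therefore linear in `len V`.
-/
theorem Expr.val_le_pow {V : ℕ} (hV : 20 ≤ V) {s : State} (hs : Bdd V s) (e : Expr)
    (he : e.small) : e.val s ≤ V ^ e.size := by
  induction e with
  | const n =>
    have : n ≤ 20 := by simpa [Expr.small] using he
    simpa [Expr.val, Expr.size] using this.trans hV
  | reg x => simpa [Expr.size] using hs.1 x
  | read k e ih =>
    refine (hs.2 k _).trans ?_
    exact Nat.le_self_pow (by simp [Expr.size]) V
  | op o a b iha ihb =>
    simp only [Expr.small, Bool.and_eq_true] at he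
    have h1 := iha he.1
    have h2 := ihb he.2
    have hA : 1 ≤ V ^ a.size := Nat.one_le_pow _ _ (by omega)
    have hB : 1 ≤ V ^ b.size := Nat.one_le_pow _ _ (by omega)
    have hmul : V ^ a.size * V ^ b.size * 2 ≤ V ^ (a.size + b.size + 1) := by
      rw [pow_succ, pow_add]
      exact Nat.mul_le_mul_left _ (by omega)
    have hA' : V ^ a.size ≤ V ^ a.size * V ^ b.size := Nat.le_mul_of_pos_right _ hB
    have hB' : V ^ b.size ≤ V ^ a.size * V ^ b.size := Nat.le_mul_of_pos_left _ hA
    simp only [Expr.val, Expr.size]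
    cases o <;> simp only [Op.apply]
    · omega
    · omega
    · have := Nat.mul_le_mul h1 h2; omega
    · have := Nat.div_le_self (a.val s) (b.val s); omega
    · have := Nat.mod_le (a.val s) (b.val s); omega
    · split_ifs <;> omega
    · split_ifs <;> omega

theorem len_le_len {m n : ℕ} (h : m ≤ n) : len m ≤ len n :=
  Nat.add_le_add_right (Nat.size_le_size h) 1

theorem one_le_len (n : ℕ) : 1 ≤ len n := by simp [len]

theorem len_pow_le (V k : ℕ) (hk : 1 ≤ k) : len (V ^ k) ≤ k * len V := by
  have h : Nat.size (V ^ k) ≤ k * Nat.size V := by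
    rw [Nat.size_le, mul_comm, pow_mul]
    exact Nat.pow_lt_pow_left (Nat.lt_size_self V) (by omega)
  simp only [len, mul_add]
  omega

theorem Expr.len_val_le {V : ℕ} (hV : 20 ≤ V) {s : State} (hs : Bdd V s) (e : Expr)
    (he : e.small) : len (e.val s) ≤ e.size * len V :=
  (len_le_len (e.val_le_pow hV hs he)).trans (len_pow_le _ _ e.one_le_size)

theorem Expr.cost_le {V : ℕ} (hV : 20 ≤ V) {s : State} (hs : Bdd V s) (e : Expr)
    (he : e.small) : e.cost s ≤ 2 * e.size ^ 2 * len V := by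
  induction e with
  | const n =>
    have : n ≤ 20 := by simpa [Expr.small] using he
    have := len_le_len (this.trans hV)
    simp only [Expr.cost, Expr.size]
    omega
  | reg x =>
    have := len_le_len (hs.1 x)
    simp only [Expr.cost, Expr.size]
    omega
  | read k e ih =>
    have h1 := ih he
    have h2 := e.len_val_le hV hs he
    have h3 := len_le_len (hs.2 k (e.val s))
    simp only [Expr.cost, Expr.size]
    nlinarith [e.one_le_size, Nat.zero_le (e.size * len V)]
  | op o a b iha ihb =>
    simp only [Expr.small, Bool.and_eq_true] at he
    have h1 := iha he.1
    have h2 := ihb he.2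
    have h3 := a.len_val_le hV hs he.1
    have h4 := b.len_val_le hV hs he.2
    simp only [Expr.cost, Expr.size]
    nlinarith [Nat.zero_le (a.size * len V), Nat.zero_le (b.size * len V),
      Nat.zero_le (a.size * b.size * len V)]

/-- Here 800 is 2 · 20². The dearest elementary command, a store, evaluates two expressions and pays
for their values: 1 + 1640 · `len V`, which explains the constant in `unit`. -/
theorem Expr.ok_cost_le {V : ℕ} (hV : 20 ≤ V) {s : State} (hs : Bdd V s) {e : Expr}
    (he : e.ok) : e.cost s ≤ 800 * len V ∧ len (e.val s) ≤ 20 * len V := by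
  simp only [Expr.ok, Bool.and_eq_true, decide_eq_true_eq] at he
  refine ⟨(e.cost_le hV hs he.2).trans (Nat.mul_le_mul_right _ ?_),
    (e.len_val_le hV hs he.2).trans (Nat.mul_le_mul_right _ he.1)⟩
  nlinarith [he.1]

/-- A bound for the cost of one elementary step when all values are at most `V`. -/
def unit (V : ℕ) : ℕ := 1700 * len V

/-! ### Frame conditions -/

/-- Registers that the program may write to. -/
def Cmd.wregs : Cmd → List ℕ
  | .skip => []
  | .assign x _ => [x]
  | .store _ _ _ => []
  | .seq p q => p.wregs ++ q.wregs
  | .cond _ p q => p.wregs ++ q.wregs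
  | .loop _ p => p.wregs

/-- Arrays that the program may write to. -/
def Cmd.warrs : Cmd → List ℕ
  | .skip => []
  | .assign _ _ => []
  | .store k _ _ => [k]
  | .seq p q => p.warrs ++ q.warrs
  | .cond _ p q => p.warrs ++ q.warrs
  | .loop _ p => p.warrs

/-- The states agree on everything that `p` does not write to. -/
def Same (p : Cmd) (s s' : State) : Prop :=
  (∀ x, x ∉ p.wregs → s'.reg x = s.reg x) ∧ ∀ k, k ∉ p.warrs → s'.arr k = s.arr k

theorem Same.refl (p : Cmd) (s : State) : Same p s s := ⟨fun _ _ => rfl, fun _ _ => rfl⟩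

theorem Same.trans {p : Cmd} {s s' s'' : State} (h : Same p s s') (h' : Same p s' s'') :
    Same p s s'' :=
  ⟨fun x hx => (h'.1 x hx).trans (h.1 x hx), fun k hk => (h'.2 k hk).trans (h.2 k hk)⟩

theorem Same.mono {p q : Cmd} {s s' : State} (h : Same p s s')
    (h1 : ∀ x, x ∈ p.wregs → x ∈ q.wregs) (h2 : ∀ x, x ∈ p.warrs → x ∈ q.warrs) :
    Same q s s' :=
  ⟨fun x hx => h.1 x fun h => hx (h1 x h), fun x hx => h.2 x fun h => hx (h2 x h)⟩

/-- The written registers and arrays are computed from the syntax, so for the concrete programs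
below the frame conditions are settled by `decide`. -/
theorem Run.same {p : Cmd} {s s' : State} {τ : ℕ} (h : Run p s s' τ) : Same p s s' := by
  induction h with
  | skip s => exact Same.refl _ _
  | assign s x e =>
    refine ⟨fun y hy => ?_, fun _ _ => rfl⟩
    rw [State.reg_setReg, if_neg]
    simpa [Cmd.wregs] using hy
  | store s k i e =>
    refine ⟨fun _ _ => rfl, fun y hy => ?_⟩
    rw [State.arr_setArr, if_neg]
    simpa [Cmd.warrs] using hy
  | seq _ _ ih1 ih2 =>
    exact (ih1.mono (by simp +contextual [Cmd.wregs]) (by simp +contextual [Cmd.warrs])).trans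
      (ih2.mono (by simp +contextual [Cmd.wregs]) (by simp +contextual [Cmd.warrs]))
  | cond_true _ _ ih =>
    exact ih.mono (by simp +contextual [Cmd.wregs]) (by simp +contextual [Cmd.warrs])
  | cond_false _ _ ih =>
    exact ih.mono (by simp +contextual [Cmd.wregs]) (by simp +contextual [Cmd.warrs])
  | loop_true _ _ _ ih1 ih2 => exact (ih1.mono (by simp [Cmd.wregs]) (by simp [Cmd.warrs])).trans ih2
  | loop_false _ => exact Same.refl _ _

/-! ### Total correctness with time bounds -/

/-- Started in `s`, the program `p` halts after at most `T` elementary steps on values of size at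
most `V`, in a state with property `Q`. -/
def Wp (V : ℕ) (p : Cmd) (T : ℕ) (s : State) (Q : State → Prop) : Prop :=
  ∃ s' τ, Run p s s' τ ∧ τ ≤ T * unit V ∧ Bdd V s' ∧ Q s'

section

variable {V : ℕ} {s : State} {Q : State → Prop}

theorem Wp.weaken {p : Cmd} {T T' : ℕ} {Q' : State → Prop} (h : Wp V p T s Q) (hT : T ≤ T')
    (hQ : ∀ s', Bdd V s' → Same p s s' → Q s' → Q' s') : Wp V p T' s Q' := by
  obtain ⟨s', τ, hr, hτ, hb, hq⟩ := h
  exact ⟨s', τ, hr, hτ.trans (Nat.mul_le_mul_right _ hT), hb, hQ s' hb hr.same hq⟩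

theorem Wp.time {p : Cmd} {T T' : ℕ} (h : Wp V p T s Q) (hT : T ≤ T') : Wp V p T' s Q :=
  h.weaken hT fun _ _ _ h => h

theorem Wp.seq {p q : Cmd} {T T' : ℕ} {Q' : State → Prop} (h : Wp V p T s Q)
    (h' : ∀ s', Bdd V s' → Same p s s' → Q s' → Wp V q T' s' Q') :
    Wp V (p ;; q) (T + T') s Q' := by
  obtain ⟨s', τ, hr, hτ, hb, hq⟩ := h
  obtain ⟨s'', τ', hr', hτ', hb', hq'⟩ := h' s' hb hr.same hq
  exact ⟨s'', _, .seq hr hr', by rw [Nat.add_mul]; omega, hb', hq'⟩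

theorem Wp.skip (hb : Bdd V s) (h : Q s) : Wp V .skip 1 s Q :=
  ⟨s, 1, .skip s, by have := one_le_len V; simp only [unit]; omega, hb, h⟩

theorem Wp.assign {x : ℕ} {e : Expr} (hV : 20 ≤ V) (hb : Bdd V s) (he : e.ok)
    (hv : e.val s ≤ V) (h : Q (s.setReg x (e.val s))) : Wp V (.assign x e) 1 s Q := by
  refine ⟨_, _, .assign s x e, ?_, hb.setReg hv, h⟩
  have h1 := Expr.ok_cost_le hV hb he
  have := one_le_len V
  simp only [unit]
  omega

theorem Wp.store {k : ℕ} {i e : Expr} (hV : 20 ≤ V) (hb : Bdd V s) (hi : i.ok) (he : e.ok)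
    (hv : e.val s ≤ V) (h : Q (s.setArr k (i.val s) (e.val s))) : Wp V (.store k i e) 1 s Q := by
  refine ⟨_, _, .store s k i e, ?_, hb.setArr hv, h⟩
  have h1 := Expr.ok_cost_le hV hb he
  have h2 := Expr.ok_cost_le hV hb hi
  have := one_le_len V
  simp only [unit]
  omega

theorem Wp.assign_seq {x : ℕ} {e : Expr} {q : Cmd} {T : ℕ} (hV : 20 ≤ V) (hb : Bdd V s)
    (he : e.ok) (hv : e.val s ≤ V)
    (h : Bdd V (s.setReg x (e.val s)) → Wp V q T (s.setReg x (e.val s)) Q) :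
    Wp V (.assign x e ;; q) (1 + T) s Q :=
  Wp.seq (Q := fun s' => s' = s.setReg x (e.val s)) (Wp.assign hV hb he hv rfl)
    (fun _ hb' _ h' => by subst h'; exact h hb')

theorem Wp.store_seq {k : ℕ} {i e : Expr} {q : Cmd} {T : ℕ} (hV : 20 ≤ V) (hb : Bdd V s)
    (hi : i.ok) (he : e.ok) (hv : e.val s ≤ V)
    (h : Bdd V (s.setArr k (i.val s) (e.val s)) → Wp V q T (s.setArr k (i.val s) (e.val s)) Q) :
    Wp V (.store k i e ;; q) (1 + T) s Q :=
  Wp.seq (Q := fun s' => s' = s.setArr k (i.val s) (e.val s)) (Wp.store hV hb hi he hv rfl)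
    (fun _ hb' _ h' => by subst h'; exact h hb')

theorem Wp.cond {e : Expr} {p q : Cmd} {T : ℕ} (hV : 20 ≤ V) (hb : Bdd V s) (he : e.ok)
    (h1 : e.val s ≠ 0 → Wp V p T s Q) (h2 : e.val s = 0 → Wp V q T s Q) :
    Wp V (.cond e p q) (1 + T) s Q := by
  have h := Expr.ok_cost_le hV hb he
  have hl := one_le_len V
  have hu : 1 + e.cost s ≤ unit V := by simp only [unit]; omega
  by_cases hz : e.val s = 0
  · obtain ⟨s', τ, hr, hτ, hb', hq⟩ := h2 hz
    exact ⟨s', _, .cond_false hz hr, by rw [Nat.add_mul]; omega, hb', hq⟩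
  · obtain ⟨s', τ, hr, hτ, hb', hq⟩ := h1 hz
    exact ⟨s', _, .cond_true hz hr, by rw [Nat.add_mul]; omega, hb', hq⟩

/-- A loop that runs `n` times and keeps an invariant. -/
theorem Wp.loop {e : Expr} {p : Cmd} (n T : ℕ) (Inv : ℕ → State → Prop) (hV : 20 ≤ V)
    (he : e.ok) (hb : Bdd V s) (h0 : Inv 0 s)
    (hstep : ∀ i, i < n → ∀ s', Bdd V s' → Inv i s' →
      e.val s' ≠ 0 ∧ Wp V p T s' (Inv (i + 1)))
    (hend : ∀ s', Inv n s' → e.val s' = 0) :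
    Wp V (.loop e p) (n * (T + 1) + 1) s (Inv n) := by
  -- Induction on the number `m` of rounds still to come, since the recursive call of a loop starts
  -- from a later state.
  suffices H : ∀ m i, i + m = n → ∀ s', Bdd V s' → Inv i s' →
      Wp V (.loop e p) (m * (T + 1) + 1) s' (Inv n) from H n 0 (by omega) s hb h0
  intro m
  induction m with
  | zero =>
    intro i hi s' hb' hinv
    obtain rfl : i = n := by omega
    have h := Expr.ok_cost_le hV hb' he
    have hl := one_le_len V
    exact ⟨s', _, .loop_false (hend s' hinv), by simp only [unit]; omega, hb', hinv⟩
  | succ m ih =>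
    intro i hi s' hb' hinv
    have h := Expr.ok_cost_le hV hb' he
    have hl := one_le_len V
    obtain ⟨hne, s1, τ1, hr1, hτ1, hb1, hi1⟩ := hstep i (by omega) s' hb' hinv
    obtain ⟨s2, τ2, hr2, hτ2, hb2, hi2⟩ := ih (i + 1) (by omega) s1 hb1 hi1
    refine ⟨s2, _, .loop_true hne hr1 hr2, ?_, hb2, hi2⟩
    have hu : 1 + e.cost s' ≤ unit V := by simp only [unit]; omega
    calc 1 + e.cost s' + τ1 + τ2 ≤ unit V + T * unit V + (m * (T + 1) + 1) * unit V := by omega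
      _ = ((m + 1) * (T + 1) + 1) * unit V := by ring

/-- `for x = 0, 1, …, reg b - 1 do p`. -/
def Cmd.for (x b : ℕ) (p : Cmd) : Cmd :=
  .assign x 0 ;; .loop (.op .lt (.reg x) (.reg b)) (p ;; .assign x (.reg x + 1))

/-- The body is followed by the increment, so it has to establish the invariant for the state in
which the counter has already been advanced. `Same` compares with the state before the loop, which
lets the body recover all constants in one step. Test and increment account for the 2 in `T + 2`. -/
theorem Wp.for {x b : ℕ} {p : Cmd} (n T : ℕ) (Inv : ℕ → State → Prop) (hV : 20 ≤ V)
    (hb : Bdd V s) (hn : s.reg b = n) (hx : x ∉ p.wregs) (hbp : b ∉ p.wregs) (hxb : b ≠ x)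
    (h0 : Inv 0 (s.setReg x 0))
    (hstep : ∀ i, i < n → ∀ s', Bdd V s' → Same (.for x b p) s s' → s'.reg x = i → Inv i s' →
      Wp V p T s' (fun s'' => Inv (i + 1) (s''.setReg x (i + 1)))) :
    Wp V (.for x b p) (n * (T + 2) + 2) s (Inv n) := by
  have hw : x ∈ (Cmd.for x b p).wregs := by simp [Cmd.for, Cmd.wregs]
  have hb' : b ∉ (Cmd.for x b p).wregs := by simp [Cmd.for, Cmd.wregs, hxb, hbp]
  have hnV : n ≤ V := hn ▸ hb.1 b
  have hset : ∀ s' v, Same (.for x b p) s' (s'.setReg x v) := fun s' v =>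
    ⟨fun y hy => by
      rw [State.reg_setReg, if_neg]
      rintro rfl
      exact hy hw, fun _ _ => rfl⟩
  refine Wp.time (T := 1 + (n * (T + 1 + 1) + 1)) ?_ (by ring_nf; omega)
  refine Wp.assign_seq hV hb rfl (by simp) fun hb1 => ?_
  refine (Wp.loop n (T + 1) (fun i s' => Same (.for x b p) s s' ∧ s'.reg x = i ∧ Inv i s')
    hV rfl hb1 ⟨hset _ _, by simp, h0⟩ ?_ ?_).weaken le_rfl fun s' _ _ h => h.2.2
  · rintro i hi s' hbs ⟨hsame, hxi, hinv⟩
    refine ⟨?_, ?_⟩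
    · simp only [Expr.val_lt, Expr.val_reg, hxi, hsame.1 b hb', hn, if_pos hi]
      decide
    · refine (hstep i hi s' hbs hsame hxi hinv).seq fun s'' hb'' hsame' hinv' => ?_
      have hxi' : s''.reg x = i := by rw [hsame'.1 x hx, hxi]
      refine Wp.assign hV hb'' rfl (by simp [hxi']; omega) ?_
      simp only [Expr.val_add, Expr.val_reg, hxi', Expr.val_one]
      refine ⟨(hsame.trans (hsame'.mono ?_ ?_)).trans (hset _ _), by simp, hinv'⟩
      · simp +contextual [Cmd.for, Cmd.wregs]
      · simp +contextual [Cmd.for, Cmd.warrs]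
  · rintro s' ⟨hsame, hxi, -⟩
    simp [hxi, hsame.1 b hb', hn]

end

/-! ### Gauss–Jordan elimination over the field with two elements

Matrices are functions `ℕ → ℕ → ℕ` with values `0` and `1`; a `k × B` system has its right-hand
side in column `B`. -/

/-- Clear column `p` outside row `i` by adding row `i` to the other rows. -/
def elimStep (k : ℕ) (A : ℕ → ℕ → ℕ) (i p : ℕ) : ℕ → ℕ → ℕ := fun a x =>
  if a < k then (A a x + (if a = i then 0 else A a p) * A i x) % 2 else A a x

/-- The residual of row `a` of the system at `w`. -/
def residual (B : ℕ) (A : ℕ → ℕ → ℕ) (w : ℕ → ℕ) (a : ℕ) : ℕ :=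
  A a B + ∑ x ∈ range B, A a x * w x

/-- In characteristic two the residual is the difference of the two sides of equation `a`. -/
def Solves (k B : ℕ) (A : ℕ → ℕ → ℕ) (w : ℕ → ℕ) : Prop :=
  ∀ a, a < k → (residual B A w a : ZMod 2) = 0

/-- The rows are linearly independent when restricted to the free columns. -/
def FullRank (k B : ℕ) (free : ℕ → Prop) (A : ℕ → ℕ → ℕ) : Prop :=
  ∀ y : ℕ → ZMod 2, (∀ x, x < B → free x → ∑ a ∈ range k, y a * (A a x : ZMod 2) = 0) →
    ∀ a, a < k → y a = 0

def IsBits (f : ℕ → ℕ) : Prop := ∀ i, f i ≤ 1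

theorem cast_elimStep {k : ℕ} {A : ℕ → ℕ → ℕ} {i p a x : ℕ} (ha : a < k) :
    (elimStep k A i p a x : ZMod 2) = A a x + ((if a = i then 0 else A a p : ℕ) : ZMod 2) * A i x := by
  rw [elimStep, if_pos ha, ZMod.natCast_mod]
  push_cast
  rfl

theorem elimStep_bits {k : ℕ} {A : ℕ → ℕ → ℕ} {i p : ℕ} (hA : ∀ a, IsBits (A a)) (a : ℕ) :
    IsBits (elimStep k A i p a) := by
  intro x
  rw [elimStep]
  split_ifs
  · omega
  · omega
  · exact hA a x

theorem cast_residual (B : ℕ) (A : ℕ → ℕ → ℕ) (w : ℕ → ℕ) (a : ℕ) :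
    (residual B A w a : ZMod 2) = A a B + ∑ x ∈ range B, (A a x : ZMod 2) * w x := by
  simp [residual]

/-- Residuals undergo the same row operation as the rows. Row `i` is kept, so its residual vanishes,
and then the other residuals are unchanged too. -/
theorem Solves.of_elimStep {k B : ℕ} {A : ℕ → ℕ → ℕ} {i p : ℕ} {w : ℕ → ℕ} (hi : i < k)
    (h : Solves k B (elimStep k A i p) w) : Solves k B A w := by
  have key : ∀ a, a < k → (residual B (elimStep k A i p) w a : ZMod 2) =
      residual B A w a + ((if a = i then 0 else A a p : ℕ) : ZMod 2) * residual B A w i := by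
    intro a ha
    simp only [cast_residual, cast_elimStep ha, add_mul, sum_add_distrib, mul_add, mul_sum,
      mul_assoc]
    ring
  have hi0 : (residual B A w i : ZMod 2) = 0 := by
    have := h i hi
    rw [key i hi] at this
    simpa using this
  intro a ha
  have := h a ha
  rw [key a ha, hi0] at this
  simpa using this

/-- A dependency `y` between the new rows is one between the old rows after adding `c` to its
coefficient at `i`. So `y` vanishes off `i`, which forces `c = 0` because `g i = 0`, and then `y i =
0`. -/
theorem FullRank.elimStep {k B : ℕ} {free : ℕ → Prop} {A : ℕ → ℕ → ℕ} {i p : ℕ} (hi : i < k)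
    (h : FullRank k B free A) : FullRank k B free (elimStep k A i p) := by
  intro y hy
  set g : ℕ → ZMod 2 := fun a => ((if a = i then 0 else A a p : ℕ) : ZMod 2) with hg
  set c := ∑ a ∈ range k, y a * g a with hc
  have h0 := h (fun a => y a + if a = i then c else 0) fun x hx hf => by
    refine Eq.trans ?_ (hy x hx hf)
    have h1 : ∀ a ∈ range k, y a * (StuckAt.elimStep k A i p a x : ZMod 2) =
        y a * A a x + y a * g a * A i x := fun a ha => by
      rw [cast_elimStep (mem_range.1 ha)]; ring
    rw [sum_congr rfl h1, sum_add_distrib, ← sum_mul, ← hc]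
    simp only [add_mul, sum_add_distrib, ite_mul, zero_mul]
    rw [sum_ite_eq' (range k) i, if_pos (mem_range.2 hi)]
  have hne : ∀ a, a < k → a ≠ i → y a = 0 := fun a ha hai => by
    have := h0 a ha
    simpa [hai] using this
  have hc0 : c = 0 := sum_eq_zero fun a ha => by
    by_cases hai : a = i
    · simp [hg, hai]
    · rw [hne a (mem_range.1 ha) hai, zero_mul]
  intro a ha
  have := h0 a ha
  simpa [hc0] using this

/-- A row that vanishes on the free columns is by itself a dependency. -/
theorem FullRank.exists_pivot {k B : ℕ} {free : ℕ → Prop} {A : ℕ → ℕ → ℕ} {i : ℕ} (hi : i < k)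
    (h : FullRank k B free A) : ∃ x, x < B ∧ free x ∧ A i x ≠ 0 := by
  by_contra! hcon
  have := h (fun a => if a = i then 1 else 0) (fun x hx hf => by
    simp [hcon x hx hf]) i hi
  simp at this

theorem FullRank.congr {k B : ℕ} {free : ℕ → Prop} {A A' : ℕ → ℕ → ℕ}
    (h : FullRank k B free A) (hA : ∀ a x, a < k → x < B → A' a x = A a x) :
    FullRank k B free A' := fun y hy => h y fun x hx hf => by
  refine Eq.trans ?_ (hy x hx hf)
  exact sum_congr rfl fun a ha => by rw [hA a x (mem_range.1 ha) hx]

theorem FullRank.mono {k k' B : ℕ} {free : ℕ → Prop} {A : ℕ → ℕ → ℕ}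
    (h : FullRank k B free A) (hk : k' ≤ k) : FullRank k' B free A := by
  intro y hy a ha
  have := h (fun a => if a < k' then y a else 0) (fun x hx hf => by
    refine Eq.trans ?_ (hy x hx hf)
    rw [← sum_subset (range_subset_range.2 hk)]
    · exact sum_congr rfl fun a ha => by rw [if_pos (mem_range.1 ha)]
    · intro a _ ha'
      rw [if_neg (by simpa using ha'), zero_mul]) a (by omega)
  simpa [ha] using this

theorem elimStep_of_pivot {k : ℕ} {A : ℕ → ℕ → ℕ} {i p a : ℕ} (hA : ∀ a, IsBits (A a))
    (hp : A i p = 1) (hi : i < k) (ha : a < k) :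
    elimStep k A i p a p = if a = i then 1 else 0 := by
  rw [elimStep, if_pos ha, hp]
  have := hA a p
  split_ifs with h
  · subst h; rw [hp]
  · omega

/-- This protects the earlier pivot columns, in which the new pivot row has a zero. -/
theorem elimStep_of_zero {k : ℕ} {A : ℕ → ℕ → ℕ} {i p a x : ℕ} (hA : ∀ a, IsBits (A a))
    (hx : A i x = 0) : elimStep k A i p a x = A a x := by
  have := hA a x
  rw [elimStep, hx, mul_zero, add_zero, Nat.mod_eq_of_lt (by omega), ite_self]

/-- Flipping a position that is the pivot of a unit column changes one residual only; this is what
makes back substitution unnecessary. -/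
theorem cast_residual_update {B : ℕ} {A : ℕ → ℕ → ℕ} {w w' : ℕ → ℕ} {a p s : ℕ} (hp : p < B)
    (hw : ∀ x, x < B → w' x = if x = p then (w p + s) % 2 else w x) :
    (residual B A w' a : ZMod 2) = residual B A w a + A a p * s := by
  rw [cast_residual, cast_residual]
  have : ∀ x ∈ range B, (A a x : ZMod 2) * w' x = A a x * w x +
      if x = p then (A a p * s : ZMod 2) else 0 := by
    intro x hx
    rw [hw x (mem_range.1 hx)]
    split_ifs with h
    · subst h
      rw [ZMod.natCast_mod]
      push_cast
      ring
    · ring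
  rw [sum_congr rfl this, sum_add_distrib, sum_ite_eq' (range B) p, if_pos (mem_range.2 hp)]
  ring

/-! ### Elimination on the machine -/

/-- The first `W` columns of the matrix `A` are stored row by row in array `4`. -/
def Mat (W : ℕ) (s : State) (A : ℕ → ℕ → ℕ) : Prop :=
  ∀ a x, x < W → s.arr 4 (a * W + x) = A a x

theorem index_inj {W a x a' x' : ℕ} (hx : x < W) (hx' : x' < W)
    (h : a * W + x = a' * W + x') : a = a' ∧ x = x' := by
  have h1 : (a * W + x) / W = a := by
    rw [mul_comm, Nat.mul_add_div (by omega), Nat.div_eq_of_lt hx, add_zero]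
  have h2 : (a' * W + x') / W = a' := by
    rw [mul_comm, Nat.mul_add_div (by omega), Nat.div_eq_of_lt hx', add_zero]
  have h3 : a = a' := by rw [← h1, h, h2]
  subst h3
  exact ⟨rfl, by omega⟩

theorem Mat.congr {W : ℕ} {s s' : State} {A A' : ℕ → ℕ → ℕ} (h : Mat W s A)
    (hs : s'.arr 4 = s.arr 4) (hA : ∀ a x, x < W → A a x = A' a x) : Mat W s' A' :=
  fun a x hx => by rw [hs, h a x hx, hA a x hx]

theorem Mat.store {W : ℕ} {s : State} {A : ℕ → ℕ → ℕ} (h : Mat W s A) {a x v : ℕ} (hx : x < W) :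
    Mat W (s.setArr 4 (a * W + x) v) (fun a' x' => if a' = a ∧ x' = x then v else A a' x') := by
  intro a' x' hx'
  simp only [State.arr_setArr, if_true, Function.update_apply]
  by_cases hax : a' = a ∧ x' = x
  · rw [if_pos hax, if_pos (by rw [hax.1, hax.2])]
  · rw [if_neg hax, if_neg fun h => hax (index_inj hx' hx h), h a' x' hx']

/-- Add `reg 19` times row `reg 15` to row `reg 18`. -/
def rowAdd : Cmd :=
  .for 12 22 (.store 4 (R 18 * R 22 + R 12)
    ((.read 4 (R 18 * R 22 + R 12) + R 19 * .read 4 (R 15 * R 22 + R 12)) % 2))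

theorem rowAdd_spec {V W a i g : ℕ} {s : State} {A : ℕ → ℕ → ℕ} (hV : 20 ≤ V) (hb : Bdd V s)
    (hM : Mat W s A) (hW : s.reg 22 = W) (h18 : s.reg 18 = a)
    (h15 : s.reg 15 = i) (h19 : s.reg 19 = g) :
    Wp V rowAdd (W * 3 + 2) s
      (Mat W · fun a' x => if a' = a then (A a x + g * A i x) % 2 else A a' x) := by
  refine (Wp.for W 1 (fun y s' => Mat W s' fun a' x =>
      if a' = a ∧ x < y then (A a x + g * A i x) % 2 else A a' x) hV hb hW (by decide) (by decide)
      (by decide) (hM.congr rfl (by simp)) ?_).weaken le_rfl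
      fun s' _ _ h => h.congr rfl fun a' x hx => by simp [hx]
  intro y hy s' hb' hs h12 hinv
  have e22 : s'.reg 22 = W := (hs.1 22 (by decide)).trans hW
  have e18 : s'.reg 18 = a := (hs.1 18 (by decide)).trans h18
  have e15 : s'.reg 15 = i := (hs.1 15 (by decide)).trans h15
  have e19 : s'.reg 19 = g := (hs.1 19 (by decide)).trans h19
  refine Wp.store hV hb' (by decide) (by decide) ?_ ?_
  · simp only [Expr.val_mod, Expr.val_two]
    have := Nat.mod_lt ((Expr.read 4 (R 18 * R 22 + R 12) +
      R 19 * Expr.read 4 (R 15 * R 22 + R 12)).val s') two_pos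
    omega
  · simp only [Expr.val_mod, Expr.val_two, Expr.val_add, Expr.val_mul, Expr.val_reg,
      Expr.val_read, e22, e18, e15, e19, h12, hinv a y hy, hinv i y hy, lt_irrefl, and_false,
      if_false]
    refine (hinv.store hy).congr rfl fun a' x hx => ?_
    by_cases ha : a' = a
    · subst ha
      rcases lt_trichotomy x y with h | h | h
      · simp [h, h.ne, h.trans (Nat.lt_succ_self y)]
      · simp [h]
      · simp [h.ne', h.not_gt, show ¬ x < y + 1 by omega]
    · simp [ha]

/-- Clear column `reg 17` outside row `reg 15`. -/
def colClear : Cmd :=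
  .for 18 14 (.assign 19 (.read 4 (R 18 * R 22 + R 17) * (1 - .op .eq (R 18) (R 15))) ;; rowAdd)

theorem colClear_spec {V W k i p : ℕ} {s : State} {A : ℕ → ℕ → ℕ} (hV : 20 ≤ V) (hb : Bdd V s)
    (hA : ∀ a, IsBits (A a)) (hM : Mat W s A) (hW : s.reg 22 = W) (h14 : s.reg 14 = k)
    (h15 : s.reg 15 = i) (h17 : s.reg 17 = p) (hp : p < W) :
    Wp V colClear (k * (W * 3 + 5) + 2) s (Mat W · (elimStep k A i p)) := by
  refine (Wp.for k (1 + (W * 3 + 2)) (fun y s' => Mat W s' (elimStep y A i p)) hV hb h14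
      (by decide) (by decide) (by decide) (hM.congr rfl (by simp [elimStep])) ?_).time
      (by ring_nf; omega)
  intro y hy s' hb' hs h18 hinv
  have e22 : s'.reg 22 = W := (hs.1 22 (by decide)).trans hW
  have e17 : s'.reg 17 = p := (hs.1 17 (by decide)).trans h17
  have e15 : s'.reg 15 = i := (hs.1 15 (by decide)).trans h15
  have hEy : ∀ x, elimStep y A i p y x = A y x := fun x => by simp [elimStep]
  have hEi : ∀ x, elimStep y A i p i x = A i x := fun x => by
    have := hA i x
    simp only [elimStep, if_true, zero_mul, add_zero]
    split_ifs <;> omega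
  have hv : (Expr.read 4 (R 18 * R 22 + R 17) * (1 - .op .eq (R 18) (R 15))).val s' =
      if y = i then 0 else A y p := by
    simp only [Expr.val_mul, Expr.val_read, Expr.val_add, Expr.val_reg, Expr.val_sub,
      Expr.val_eq, Expr.val_one, e22, e17, e15, h18, hinv y p hp, hEy]
    split_ifs <;> simp
  refine Wp.assign_seq hV hb' (by decide) ?_ fun hb'' => ?_
  · rw [hv]
    have := hA y p
    split_ifs <;> omega
  · rw [hv]
    rw [hv] at hb''
    refine (rowAdd_spec hV hb'' (hinv.congr rfl fun _ _ _ => rfl) (a := y) (i := i)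
      (by simpa using e22) (by simpa using h18) (by simpa using e15)
      (by simp; rfl)).weaken le_rfl fun s'' _ _ h => h.congr rfl fun a x hx => ?_
    simp only [hEy, hEi]
    by_cases ha : a = y
    · subst ha
      simp [elimStep]
    · simp only [if_neg ha, elimStep]
      by_cases h' : a < y
      · simp [h', h'.trans (Nat.lt_succ_self y)]
      · simp [h', show ¬ a < y + 1 by omega]

/-- Search for a free column with entry `1` in row `reg 15`. -/
def pivotSearch : Cmd :=
  .assign 17 (R 5) ;;
  .for 12 5 (.assign 19 (.read 4 (R 15 * R 22 + R 12) * (1 - .read 1 (R 10 + R 12))) ;;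
    .assign 17 (R 19 * R 12 + (1 - R 19) * R 17))

/-- The value `B`, the index of the right-hand side, means that no pivot was found. The last
assignment of the program is a conditional without a branch: `reg 19` is a bit that selects between
the new column and the old value, so the last suitable column wins. -/
theorem pivotSearch_spec {V B i base : ℕ} {s : State} {A : ℕ → ℕ → ℕ} {F : ℕ → ℕ} (hV : 20 ≤ V)
    (hb : Bdd V s) (hA : ∀ a, IsBits (A a)) (hM : Mat (B + 1) s A) (h5 : s.reg 5 = B)
    (hW : s.reg 22 = B + 1) (h15 : s.reg 15 = i) (h10 : s.reg 10 = base) (hF : s.arr 1 = F)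
    (hF1 : IsBits F) :
    Wp V pivotSearch (B * 4 + 3) s fun s' =>
      (s'.reg 17 = B ∧ ∀ x, x < B → F (base + x) = 0 → A i x = 0) ∨
      (s'.reg 17 < B ∧ F (base + s'.reg 17) = 0 ∧ A i (s'.reg 17) = 1) := by
  refine Wp.time (T := 1 + (B * (1 + 1 + 2) + 2)) ?_ (by ring_nf; omega)
  refine Wp.assign_seq hV hb (by decide) (hb.1 5) fun hb1 => ?_
  refine (Wp.for B (1 + 1) (fun y s' =>
      (s'.reg 17 = B ∧ ∀ x, x < y → F (base + x) = 0 → A i x = 0) ∨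
      (s'.reg 17 < B ∧ F (base + s'.reg 17) = 0 ∧ A i (s'.reg 17) = 1)) hV hb1 (by simpa using h5)
      (by decide) (by decide) (by decide) (by simp [h5]) ?_).weaken le_rfl
      fun _ _ _ h => h
  intro y hy s' hb' hs h12 hinv
  have e22 : s'.reg 22 = B + 1 := (hs.1 22 (by decide)).trans (by simpa using hW)
  have e15 : s'.reg 15 = i := (hs.1 15 (by decide)).trans (by simpa using h15)
  have e10 : s'.reg 10 = base := (hs.1 10 (by decide)).trans (by simpa using h10)
  have e1 : s'.arr 1 = F := (hs.2 1 (by decide)).trans (by simpa using hF)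
  have e4 : s'.arr 4 (i * (B + 1) + y) = A i y := by
    rw [hs.2 4 (by decide)]; exact hM i y (by omega)
  have hbV : B ≤ V := h5 ▸ hb.1 5
  have hv : (Expr.read 4 (R 15 * R 22 + R 12) * (1 - .read 1 (R 10 + R 12))).val s' =
      A i y * (1 - F (base + y)) := by
    simp [e22, e15, e10, e1, h12, e4]
  have h1 := hA i y
  have h2 := hF1 (base + y)
  refine Wp.assign_seq hV hb' (by decide) ?_ fun hb'' => ?_
  · rw [hv]
    calc A i y * (1 - F (base + y)) ≤ 1 * 1 := Nat.mul_le_mul h1 (by omega)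
      _ ≤ V := by omega
  · rw [hv]
    rw [hv] at hb''
    have h17 := hb'.1 17
    have hcase : (A i y = 1 ∧ F (base + y) = 0) ∨ A i y * (1 - F (base + y)) = 0 := by
      rcases Nat.le_one_iff_eq_zero_or_eq_one.1 h1 with h1 | h1 <;>
      rcases Nat.le_one_iff_eq_zero_or_eq_one.1 h2 with h2 | h2 <;> simp [h1, h2]
    refine Wp.assign hV hb'' (by decide) ?_ ?_
    · rcases hcase with h | h
      · simp [h, h12]; omega
      · simp [h, h17]
    · rcases hcase with h | h
      · right
        simp [h, h12, hy]
      · simp only [Expr.val_add, Expr.val_mul, Expr.val_reg, State.reg_setReg, Expr.val_sub,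
          Expr.val_one, h]
        simp only [if_true, zero_mul, zero_add, tsub_zero, one_mul]
        simp only [show (17 = 12) = False by decide, show (17 = 19) = False by decide, if_false]
        rcases hinv with hinv | hinv
        · refine .inl ⟨hinv.1, fun x hx hFx => ?_⟩
          rcases Nat.lt_succ_iff_lt_or_eq.1 hx with hx | rfl
          · exact hinv.2 x hx hFx
          · simpa [hFx] using h
        · exact .inr hinv

/-- Eliminate with a pivot in row `reg 15`; `reg 9` becomes `0` if there is no pivot. -/
def pivotRow : Cmd :=
  pivotSearch ;; .store 6 (R 15) (R 17) ;; .assign 9 (R 9 * .op .lt (R 17) (R 5)) ;; colClear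

/-- Without a pivot the program clears the column `p = B` of the right-hand side. This is still a
row operation, so the elimination can go on, and only the flag `reg 9` remembers the failure. -/
theorem pivotRow_spec {V B k i base : ℕ} {s : State} {A : ℕ → ℕ → ℕ} {F : ℕ → ℕ} (hV : 20 ≤ V)
    (hb : Bdd V s) (hA : ∀ a, IsBits (A a)) (hM : Mat (B + 1) s A) (h5 : s.reg 5 = B)
    (hW : s.reg 22 = B + 1) (h14 : s.reg 14 = k) (h15 : s.reg 15 = i) (h10 : s.reg 10 = base)
    (hF : s.arr 1 = F) (hF1 : IsBits F) :
    Wp V pivotRow (B * 4 + 5 + (k * (B * 3 + 8) + 2)) s fun s' => ∃ p,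
      Mat (B + 1) s' (elimStep k A i p) ∧ s'.arr 6 = Function.update (s.arr 6) i p ∧
      ((s'.reg 9 = 0 ∧ ∀ x, x < B → F (base + x) = 0 → A i x = 0) ∨
       (s'.reg 9 = s.reg 9 ∧ p < B ∧ F (base + p) = 0 ∧ A i p = 1)) := by
  refine Wp.time (T := (B * 4 + 3) + (1 + (1 + (k * ((B + 1) * 3 + 5) + 2)))) ?_ (by ring_nf; omega)
  refine (pivotSearch_spec hV hb hA hM h5 hW h15 h10 hF hF1).seq fun s1 hb1 hs1 h1 => ?_
  have e9 : s1.reg 9 = s.reg 9 := hs1.1 9 (by decide)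
  have e15 : s1.reg 15 = i := (hs1.1 15 (by decide)).trans h15
  have e5 : s1.reg 5 = B := (hs1.1 5 (by decide)).trans h5
  have e22 : s1.reg 22 = B + 1 := (hs1.1 22 (by decide)).trans hW
  have e14 : s1.reg 14 = k := (hs1.1 14 (by decide)).trans h14
  refine Wp.store_seq hV hb1 (by decide) (by decide) (hb1.1 17) fun hb2 => ?_
  have h9V : s.reg 9 ≤ V := hb.1 9
  refine Wp.assign_seq hV hb2 (by decide) ?_ fun hb3 => ?_
  · calc s1.reg 9 * _ ≤ s1.reg 9 * 1 := Nat.mul_le_mul_left _ (Expr.val_lt_le _ _ _)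
      _ ≤ V := by omega
  refine (colClear_spec hV hb3 hA (hM.congr ?_ fun _ _ _ => rfl) (p := s1.reg 17)
    (by simpa using e22) (by simpa using e14) (by simpa using e15) (by simp) ?_).weaken le_rfl
    fun s' _ hs' h' => ⟨s1.reg 17, h', ?_, ?_⟩
  · simpa using hs1.2 4 (by decide)
  · omega
  · rw [hs'.2 6 (by decide)]
    simp [e15, hs1.2 6 (by decide)]
  · rw [hs'.1 9 (by decide)]
    simp only [State.reg_setReg, if_true, Expr.val_mul, Expr.val_reg, Expr.val_lt,
      State.reg_setArr, e9, e5]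
    rcases h1 with ⟨h1, h2⟩ | ⟨h1, h2⟩
    · exact .inl ⟨by simp [h1], h2⟩
    · exact .inr ⟨by simp [h1], h1, h2⟩

/-- Gauss–Jordan elimination. -/
def elim : Cmd := .for 15 14 pivotRow

/-- Solutions carry over unconditionally, since only row operations are made. Full rank survives
them and yields a pivot in every row, so the flag can drop only when the rows are dependent on the
free columns. -/
theorem elim_spec {V B k base : ℕ} {s : State} {A : ℕ → ℕ → ℕ} {F : ℕ → ℕ} (hV : 20 ≤ V)
    (hb : Bdd V s) (hA : ∀ a, IsBits (A a)) (hM : Mat (B + 1) s A) (h5 : s.reg 5 = B)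
    (hW : s.reg 22 = B + 1) (h14 : s.reg 14 = k) (h10 : s.reg 10 = base)
    (hF : s.arr 1 = F) (hF1 : IsBits F) (h9 : s.reg 9 ≤ 1) :
    Wp V elim (k * (B * 4 + 9 + k * (B * 3 + 8)) + 2) s fun s' => ∃ A' : ℕ → ℕ → ℕ,
      (∀ a, IsBits (A' a)) ∧ Mat (B + 1) s' A' ∧ (∀ w, Solves k B A' w → Solves k B A w) ∧
      s'.reg 9 ≤ s.reg 9 ∧
      (s'.reg 9 = 1 → ∀ i, i < k → s'.arr 6 i < B ∧ F (base + s'.arr 6 i) = 0 ∧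
        ∀ a, a < k → A' a (s'.arr 6 i) = if a = i then 1 else 0) ∧
      (FullRank k B (fun x => F (base + x) = 0) A → s'.reg 9 = s.reg 9) := by
  refine ((Wp.for k (B * 4 + 5 + (k * (B * 3 + 8) + 2)) (fun i s' => ∃ A' : ℕ → ℕ → ℕ,
      (∀ a, IsBits (A' a)) ∧ Mat (B + 1) s' A' ∧ (∀ w, Solves k B A' w → Solves k B A w) ∧
      s'.reg 9 ≤ s.reg 9 ∧
      (s'.reg 9 = 1 → ∀ i', i' < i → s'.arr 6 i' < B ∧ F (base + s'.arr 6 i') = 0 ∧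
        ∀ a, a < k → A' a (s'.arr 6 i') = if a = i' then 1 else 0) ∧
      (FullRank k B (fun x => F (base + x) = 0) A → s'.reg 9 = s.reg 9 ∧
        FullRank k B (fun x => F (base + x) = 0) A')) hV hb h14 (by decide) (by decide)
      (by decide) ?_ ?_).time (by ring_nf; omega)).weaken le_rfl ?_
  · exact ⟨A, hA, hM.congr rfl fun _ _ _ => rfl, fun _ h => h, by simp, by simp,
      fun h => ⟨by simp, h⟩⟩
  · rintro i hi s1 hb1 hs1 h15 ⟨A1, hA1, hM1, hsol, hok, hpiv, hfull⟩
    refine (pivotRow_spec hV hb1 hA1 hM1 ((hs1.1 5 (by decide)).trans h5)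
      ((hs1.1 22 (by decide)).trans hW) ((hs1.1 14 (by decide)).trans h14) h15
      ((hs1.1 10 (by decide)).trans h10) ((hs1.2 1 (by decide)).trans hF) hF1).weaken le_rfl ?_
    rintro s2 hb2 hs2 ⟨p, hM2, h6, h2⟩
    refine ⟨elimStep k A1 i p, elimStep_bits hA1, hM2.congr rfl fun _ _ _ => rfl,
      fun w hw => hsol w (hw.of_elimStep hi), ?_, ?_, ?_⟩
    · simp only [State.reg_setReg, show (9 = 15) = False by decide, if_false]
      rcases h2 with h2 | h2 <;> omega
    · simp only [State.reg_setReg, show (9 = 15) = False by decide, if_false, State.arr_setReg]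
      intro h1 i' hi'
      rcases h2 with h2 | ⟨h2, h3, h4, h5⟩
      · omega
      rw [h6, Function.update_apply]
      split_ifs with hii
      · subst hii
        exact ⟨h3, h4, fun a ha => elimStep_of_pivot hA1 h5 hi ha⟩
      · obtain ⟨q1, q2, q3⟩ := hpiv (h2 ▸ h1) i' (by omega)
        refine ⟨q1, q2, fun a ha => ?_⟩
        -- Row `i` has a zero in the pivot column of the earlier row `i'`, so that column remains a
        -- unit vector.
        rw [elimStep_of_zero hA1 (by rw [q3 i hi, if_neg (Ne.symm hii)]), q3 a ha]
    · intro hf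
      obtain ⟨f1, f2⟩ := hfull hf
      refine ⟨?_, f2.elimStep hi⟩
      simp only [State.reg_setReg, show (9 = 15) = False by decide, if_false]
      rcases h2 with ⟨-, h2⟩ | h2
      · obtain ⟨x, hx, hFx, hne⟩ := f2.exists_pivot hi
        exact absurd (h2 x hx hFx) hne
      · rw [h2.1, f1]
  · rintro s' - - ⟨A', h1, h2, h3, h4, h5, h6⟩
    exact ⟨A', h1, h2, h3, h4, h5, fun h => (h6 h).1⟩

/-- Make the vector in array `0` satisfy the reduced system by changing the pivot positions. -/
def applySolution : Cmd :=
  .for 15 14 (.assign 20 (.read 4 (R 15 * R 22 + R 5)) ;;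
    .for 12 5 (.assign 20 (R 20 + .read 4 (R 15 * R 22 + R 12) * .read 0 (R 10 + R 12))) ;;
    .store 0 (R 10 + .read 6 (R 15)) ((.read 0 (R 10 + .read 6 (R 15)) + R 20) % 2))

/-- Adding the residual of row `i` to the vector at the pivot of row `i` satisfies this row and, the
pivot column being a unit vector, disturbs no other. `ok` stands for the success of the elimination:
the program runs in any case, but after a failure the vector is only known to consist of bits. -/
theorem applySolution_spec {V B k base : ℕ} {s : State} {A : ℕ → ℕ → ℕ} {free : ℕ → Prop}
    {ok : Prop} (hV : 20 ≤ V) (hb : Bdd V s) (hA : ∀ a, IsBits (A a)) (hM : Mat (B + 1) s A)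
    (h5 : s.reg 5 = B) (hW : s.reg 22 = B + 1) (h14 : s.reg 14 = k) (h10 : s.reg 10 = base)
    (hw : IsBits (s.arr 0))
    (hp : ok → ∀ i, i < k → s.arr 6 i < B ∧ free (base + s.arr 6 i) ∧
        ∀ a, a < k → A a (s.arr 6 i) = if a = i then 1 else 0) :
    Wp V applySolution (k * (B * 3 + 6) + 2) s fun s' => IsBits (s'.arr 0) ∧
      (ok → Solves k B A (fun x => s'.arr 0 (base + x)) ∧
        ∀ y, s'.arr 0 y ≠ s.arr 0 y → base ≤ y ∧ y < base + B ∧ free y) := by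
  refine (Wp.for k (1 + ((B * 3 + 2) + 1)) (fun i s' => IsBits (s'.arr 0) ∧
      (ok → (∀ a, a < i → (residual B A (fun x => s'.arr 0 (base + x)) a : ZMod 2) = 0) ∧
        ∀ y, s'.arr 0 y ≠ s.arr 0 y → base ≤ y ∧ y < base + B ∧ free y)) hV hb h14 (by decide)
        (by decide) (by decide) ⟨hw, by simp⟩ ?_).time (by ring_nf; omega)
  rintro i hi s1 hb1 hs1 h15 ⟨hw1, hinv⟩
  have e5 : s1.reg 5 = B := (hs1.1 5 (by decide)).trans h5
  have e22 : s1.reg 22 = B + 1 := (hs1.1 22 (by decide)).trans hW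
  have e10 : s1.reg 10 = base := (hs1.1 10 (by decide)).trans h10
  have e4 : s1.arr 4 = s.arr 4 := hs1.2 4 (by decide)
  have hbV : B + 1 ≤ V := hW ▸ hb.1 22
  refine Wp.assign_seq hV hb1 (by decide) (hb1.2 _ _) fun hb2 => ?_
  refine (Wp.for B 1 (fun y s' => s'.reg 20 =
      A i B + ∑ x ∈ range y, A i x * s1.arr 0 (base + x)) hV hb2 (by simpa using e5) (by decide)
      (by decide) (by decide) ?_ ?_).seq ?_
  · simp only [State.reg_setReg, show (20 = 12) = False by decide, if_false, if_true,
      Expr.val_read, Expr.val_add, Expr.val_mul, Expr.val_reg, h15, e22, e5, e4]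
    simpa using hM i B (by omega)
  · intro y hy s3 hb3 hs3 h12 h20
    have hv : (R 20 + .read 4 (R 15 * R 22 + R 12) * .read 0 (R 10 + R 12)).val s3 =
        A i B + ∑ x ∈ range (y + 1), A i x * s1.arr 0 (base + x) := by
      have r4 : s3.arr 4 = s.arr 4 := (hs3.2 4 (by decide)).trans e4
      have r0 : s3.arr 0 = s1.arr 0 := hs3.2 0 (by decide)
      have r15 : s3.reg 15 = i := (hs3.1 15 (by decide)).trans (by simpa using h15)
      have r22 : s3.reg 22 = B + 1 := (hs3.1 22 (by decide)).trans (by simpa using e22)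
      have r10 : s3.reg 10 = base := (hs3.1 10 (by decide)).trans (by simpa using e10)
      simp only [Expr.val_read, Expr.val_add, Expr.val_mul, Expr.val_reg, h20, r4, r0, r15, r22,
        r10, h12, hM i y (by omega)]
      rw [sum_range_succ, add_assoc]
    refine Wp.assign hV hb3 (by decide) ?_ (by simpa using hv)
    rw [hv]
    have : ∑ x ∈ range (y + 1), A i x * s1.arr 0 (base + x) ≤ ∑ x ∈ range (y + 1), 1 :=
      sum_le_sum fun x _ => by
        calc A i x * s1.arr 0 (base + x) ≤ 1 * 1 := Nat.mul_le_mul (hA i x) (hw1 _)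
          _ = 1 := rfl
    have h1 := hA i B
    simp at this
    omega
  · intro s4 hb4 hs4 h20
    have h20' : s4.reg 20 = residual B A (fun x => s1.arr 0 (base + x)) i := h20
    have r0 : s4.arr 0 = s1.arr 0 := hs4.2 0 (by decide)
    have r6 : s4.arr 6 = s.arr 6 := (hs4.2 6 (by decide)).trans (by
      rw [State.arr_setReg]; exact hs1.2 6 (by decide))
    have r15 : s4.reg 15 = i := (hs4.1 15 (by decide)).trans (by simpa using h15)
    have r10 : s4.reg 10 = base := (hs4.1 10 (by decide)).trans (by simpa using e10)
    have hmod : ∀ z, z % 2 ≤ 1 := fun z => by omega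
    refine Wp.store hV hb4 (by decide) (by decide) ?_ ⟨?_, ?_⟩
    · simp only [Expr.val_mod, Expr.val_two]
      exact (hmod _).trans (by omega)
    · intro y
      simp only [State.arr_setReg, State.arr_setArr, if_true, Function.update_apply, Expr.val_mod,
        Expr.val_two, r0]
      split_ifs
      · exact hmod _
      · exact hw1 y
    · intro hok
      obtain ⟨i1, i2⟩ := hinv hok
      obtain ⟨p1, p2, p3⟩ := hp hok i hi
      simp only [State.arr_setReg, State.arr_setArr, if_true, Expr.val_mod,
        Expr.val_two, Expr.val_add, Expr.val_reg, Expr.val_read, r0, r6, r15, r10, h20']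
      constructor
      · intro a ha
        have hupd := cast_residual_update (A := A) (a := a) (B := B)
          (w := fun x => s1.arr 0 (base + x))
          (w' := fun x => Function.update (s1.arr 0) (base + s.arr 6 i)
            ((s1.arr 0 (base + s.arr 6 i) +
              residual B A (fun x => s1.arr 0 (base + x)) i) % 2) (base + x)) p1
          (s := residual B A (fun x => s1.arr 0 (base + x)) i) (fun x _ => by
            simp [Function.update_apply])
        rw [hupd, p3 a (by omega)]
        rcases Nat.lt_succ_iff_lt_or_eq.1 ha with ha | rfl
        · rw [i1 a ha, if_neg ha.ne]
          simp
        -- The residual of the current row is added to itself and cancels modulo 2.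
        · rw [if_pos rfl, Nat.cast_one, one_mul]
          exact CharTwo.add_self_eq_zero _
      · intro y hy
        rw [Function.update_apply] at hy
        split_ifs at hy with hy'
        · subst hy'
          exact ⟨by omega, by omega, p2⟩
        · exact i2 y hy

/-! ### The chain of blocks -/

/-- Bit `i` of the syndrome of the block of `w` that starts at `base`. -/
def synd (B : ℕ) (r w : ℕ → ℕ) (base i : ℕ) : ℕ := (∑ x ∈ range B, r (i + x) * w (base + x)) % 2

/-- The decoded message, read off the blocks `j, j - 1, …, 1`: the header `q` names the next block
that is in use and the length of its syndrome, whose first `L` bits are the header for the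
following blocks. -/
def decList (B L : ℕ) (r w : ℕ → ℕ) : ℕ → ℕ → List ℕ
  | 0, _ => []
  | j + 1, q =>
    if q / (B + 1) = j + 1 then
      (List.range (q % (B + 1) - L)).map (fun e => synd B r w (j * B) (L + e)) ++
        decList B L r w j (∑ i ∈ range (min (q % (B + 1)) L), 2 ^ i * synd B r w (j * B) i)
    else decList B L r w j q

theorem synd_congr {B : ℕ} {r w w' : ℕ → ℕ} {base i : ℕ}
    (h : ∀ x, x < B → w' (base + x) = w (base + x)) : synd B r w' base i = synd B r w base i := by
  unfold synd
  rw [sum_congr rfl fun x hx => by rw [h x (mem_range.1 hx)]]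

/-- What is stored in the first `j` blocks survives when the encoder writes to later ones. -/
theorem decList_congr {B L : ℕ} {r w w' : ℕ → ℕ} (j : ℕ) (q : ℕ)
    (h : ∀ x, x < j * B → w' x = w x) : decList B L r w' j q = decList B L r w j q := by
  induction j generalizing q with
  | zero => rfl
  | succ j ih =>
    have hs : ∀ i, synd B r w' (j * B) i = synd B r w (j * B) i := fun i =>
      synd_congr fun x hx => h _ (by rw [Nat.succ_mul]; omega)
    have hd := fun q => ih q fun x hx => h x (by rw [Nat.succ_mul]; omega)
    simp only [decList, hs, hd]

theorem sum_bits (q L : ℕ) : ∑ i ∈ range L, 2 ^ i * (q / 2 ^ i % 2) = q % 2 ^ L := by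
  induction L with
  | zero => simp [Nat.mod_one]
  | succ L ih => rw [sum_range_succ, ih, Nat.mod_pow_succ]

/-- The syndrome that a block has to get: first the bits of `q`, then bits of the message. -/
def target (L q : ℕ) (m : ℕ → ℕ) (rem a : ℕ) : ℕ :=
  if a < L then q / 2 ^ a % 2 else m (rem + (a - L))

theorem synd_eq_target {k B base : ℕ} {A : ℕ → ℕ → ℕ} {r w : ℕ → ℕ} {tg : ℕ → ℕ}
    (hA : ∀ a, a < k → (∀ x, x < B → A a x = r (a + x)) ∧ A a B = tg a) (ht : IsBits tg)
    (h : Solves k B A fun x => w (base + x)) {a : ℕ} (ha : a < k) :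
    synd B r w base a = tg a := by
  have h1 := h a ha
  obtain ⟨hr, hB⟩ := hA a ha
  unfold residual at h1
  rw [hB, sum_congr rfl fun x hx => by rw [hr x (mem_range.1 hx)], ZMod.natCast_eq_zero_iff] at h1
  change 2 ∣ tg a + ∑ x ∈ range B, r (a + x) * w (base + x) at h1
  have := ht a
  unfold synd
  omega

/-! ### The blocks of the encoder -/

/-- What the encoder keeps in memory during its work. -/
structure EncCtx (B L : ℕ) (F m r : ℕ → ℕ) (s : State) : Prop where
  h5 : s.reg 5 = B
  h21 : s.reg 21 = L
  h22 : s.reg 22 = B + 1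
  hF : s.arr 1 = F
  hm : s.arr 2 = m
  hr : s.arr 3 = r

theorem EncCtx.of_same {B L : ℕ} {F m r : ℕ → ℕ} {s s' : State} {p : Cmd}
    (h : EncCtx B L F m r s) (hs : Same p s s')
    (hp : (5 ∉ p.wregs ∧ 21 ∉ p.wregs ∧ 22 ∉ p.wregs) ∧
      1 ∉ p.warrs ∧ 2 ∉ p.warrs ∧ 3 ∉ p.warrs) : EncCtx B L F m r s' where
  h5 := (hs.1 _ hp.1.1).trans h.h5
  h21 := (hs.1 _ hp.1.2.1).trans h.h21
  h22 := (hs.1 _ hp.1.2.2).trans h.h22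
  hF := (hs.2 _ hp.2.1).trans h.hF
  hm := (hs.2 _ hp.2.2.1).trans h.hm
  hr := (hs.2 _ hp.2.2.2).trans h.hr

theorem EncCtx.setReg {B L : ℕ} {F m r : ℕ → ℕ} {s : State} (h : EncCtx B L F m r s) {x n : ℕ}
    (hx : x ≠ 5 ∧ x ≠ 21 ∧ x ≠ 22) : EncCtx B L F m r (s.setReg x n) := by
  refine ⟨?_, ?_, ?_, h.hF, h.hm, h.hr⟩ <;> rw [State.reg_setReg, if_neg (by omega)]
  exacts [h.h5, h.h21, h.h22]

/-- Write down the linear system of a block with `reg 14` equations. -/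
def fill : Cmd :=
  .assign 16 (R 8) ;;
  .for 15 14 (
    .for 12 5 (.store 4 (R 15 * R 22 + R 12) (.read 3 (R 15 + R 12))) ;;
    .store 4 (R 15 * R 22 + R 5)
      (R 16 % 2 + (1 - .op .lt (R 15) (R 21)) * .read 2 (R 2 + (R 15 - R 21))) ;;
    .assign 16 (R 16 / 2))

theorem fill_spec {V B L k q rem : ℕ} {F m r : ℕ → ℕ} {s : State} (hV : 20 ≤ V) (hb : Bdd V s)
    (hc : EncCtx B L F m r s) (h14 : s.reg 14 = k) (h8 : s.reg 8 = q) (h2 : s.reg 2 = rem)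
    (h4 : IsBits (s.arr 4)) (hm : IsBits m) (hr : IsBits r) (hq : q < 2 ^ L) :
    Wp V fill (k * (B * 3 + 6) + 3) s fun s' => ∃ A : ℕ → ℕ → ℕ, (∀ a, IsBits (A a)) ∧
      Mat (B + 1) s' A ∧
      ∀ a, a < k → (∀ x, x < B → A a x = r (a + x)) ∧ A a B = target L q m rem a := by
  -- The first `y` rows are new; the others still show what earlier blocks left in array `4`, which
  -- therefore has to consist of bits.
  set A₀ : ℕ → ℕ → ℕ → ℕ := fun y a x =>
    if a < y then (if x < B then r (a + x) else target L q m rem a) else s.arr 4 (a * (B + 1) + x)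
    with hA₀
  have htg : IsBits (target L q m rem) := fun a => by
    unfold target
    split_ifs
    · omega
    · exact hm _
  have hbits : ∀ y a, IsBits (A₀ y a) := fun y a x => by
    simp only [hA₀]
    split_ifs
    exacts [hr _, htg _, h4 _]
  refine Wp.time (T := 1 + (k * ((B * (1 + 2) + 2) + (1 + 1) + 2) + 2)) ?_ (by ring_nf; omega)
  refine Wp.assign_seq hV hb (by decide) (hb.1 8) fun hb1 => ?_
  refine (Wp.for k ((B * (1 + 2) + 2) + (1 + 1)) (fun y s' => s'.reg 16 = q / 2 ^ y ∧
    Mat (B + 1) s' (A₀ y)) hV hb1 (by simpa using h14) (by decide) (by decide) (by decide)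
    ⟨by simp [h8], fun a x hx => by simp [hA₀]⟩ ?_).weaken le_rfl ?_
  · rintro y hy s1 hb1 hs1 h15 ⟨h16, hM⟩
    have hc1 : EncCtx B L F m r s1 :=
      (hc.setReg (x := 16) (by decide)).of_same hs1 (by decide)
    have h2' : s1.reg 2 = rem := (hs1.1 2 (by decide)).trans (by simpa using h2)
    refine (Wp.for B 1 (fun z s' => Mat (B + 1) s' fun a x =>
      if a = y ∧ x < z then r (y + x) else A₀ y a x) hV hb1 hc1.h5 (by decide) (by decide)
      (by decide) (hM.congr rfl (by simp)) ?_).seq ?_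
    · intro z hz s2 hb2 hs2 h12 hM2
      have hc2 := hc1.of_same hs2 (by decide)
      have e15 : s2.reg 15 = y := (hs2.1 15 (by decide)).trans h15
      refine Wp.store hV hb2 (by decide) (by decide) (hb2.2 _ _) ?_
      simp only [Expr.val_add, Expr.val_mul, Expr.val_reg, Expr.val_read, e15, h12, hc2.h22, hc2.hr]
      refine (hM2.store (by omega)).congr rfl fun a x hx => ?_
      by_cases ha : a = y
      · subst ha
        rcases lt_trichotomy x z with h | h | h
        · simp [h, h.ne, h.trans (Nat.lt_succ_self z)]
        · simp [h]
        · simp [h.ne', h.not_gt, show ¬ x < z + 1 by omega]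
      · simp [ha]
    · intro s3 hb3 hs3 hM3
      have hc3 := hc1.of_same hs3 (by decide)
      have e15 : s3.reg 15 = y := (hs3.1 15 (by decide)).trans h15
      have e16 : s3.reg 16 = q / 2 ^ y := (hs3.1 16 (by decide)).trans h16
      have e2 : s3.reg 2 = rem := (hs3.1 2 (by decide)).trans h2'
      have hv : (R 16 % 2 + (1 - .op .lt (R 15) (R 21)) * .read 2 (R 2 + (R 15 - R 21))).val s3 =
          target L q m rem y := by
        simp only [Expr.val_add, Expr.val_mul, Expr.val_reg, Expr.val_read, Expr.val_mod,
          Expr.val_two, Expr.val_one, Expr.val_sub, Expr.val_lt, e15, e16, e2, hc3.h21, hc3.hm,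
          target]
        split_ifs with h
        · simp
        -- From row `L` on the header `q < 2 ^ L` is used up, so the sum computed by the program is
        -- the message bit alone.
        · have : q / 2 ^ y = 0 :=
            Nat.div_eq_of_lt (hq.trans_le (Nat.pow_le_pow_right two_pos (by omega)))
          simp [this]
      have hv' := htg y
      refine Wp.store_seq hV hb3 (by decide) (by decide) (by rw [hv]; omega) fun hb4 => ?_
      refine Wp.assign hV hb4 (by decide) ?_ ⟨?_, ?_⟩
      · exact (Nat.div_le_self _ _).trans (hb4.1 16)
      · simp only [State.reg_setReg, if_true, Expr.val_div, Expr.val_two, Expr.val_reg,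
          State.reg_setArr, e16, show (16 = 15) = False by decide, if_false]
        rw [Nat.div_div_eq_div_mul, pow_succ]
      · rw [hv]
        simp only [Expr.val_add, Expr.val_mul, Expr.val_reg, e15, hc3.h22, hc3.h5]
        refine (hM3.store (Nat.lt_succ_self B)).congr rfl fun a x hx => ?_
        simp only [hA₀]
        by_cases ha : a = y
        · subst ha
          by_cases hxB : x = B
          · simp [hxB]
          · simp [hxB, show x < B by omega]
        · by_cases hay : a < y
          · simp [ha, hay, hay.trans (Nat.lt_succ_self y)]
          · simp [ha, hay, show ¬ a < y + 1 by omega]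
  · rintro s' - - ⟨-, hM⟩
    exact ⟨A₀ k, hbits k, hM, fun a ha => by simp +contextual [hA₀, ha]⟩

/-- Number of free positions of a block. -/
def freeCount (F : ℕ → ℕ) (base B : ℕ) : ℕ := ∑ x ∈ range B, (1 - F (base + x))

theorem freeCount_le (F : ℕ → ℕ) (base B : ℕ) : freeCount F base B ≤ B := by
  calc freeCount F base B ≤ ∑ x ∈ range B, 1 := sum_le_sum fun x _ => by omega
    _ = B := by simp

def countFree : Cmd :=
  .assign 11 0 ;; .for 12 5 (.assign 11 (R 11 + (1 - .read 1 (R 10 + R 12))))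

theorem countFree_spec {V B L base : ℕ} {F m r : ℕ → ℕ} {s : State} (hV : 20 ≤ V) (hb : Bdd V s)
    (hc : EncCtx B L F m r s) (h10 : s.reg 10 = base) :
    Wp V countFree (B * 3 + 3) s fun s' => s'.reg 11 = freeCount F base B := by
  refine Wp.time (T := 1 + (B * (1 + 2) + 2)) ?_ (by ring_nf; omega)
  refine Wp.assign_seq hV hb (by decide) (by simp) fun hb1 => ?_
  refine (Wp.for B 1 (fun y s' => s'.reg 11 = freeCount F base y) hV hb1
    (by simpa using hc.h5) (by decide) (by decide) (by decide) (by simp [freeCount]) ?_).weaken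
      le_rfl fun _ _ _ h => h
  intro y hy s1 hb1 hs1 h12 h11
  have hc1 := (hc.setReg (x := 11) (by decide)).of_same hs1 (by decide)
  have e10 : s1.reg 10 = base := (hs1.1 10 (by decide)).trans (by simpa using h10)
  have hv : (R 11 + (1 - .read 1 (R 10 + R 12))).val s1 = freeCount F base (y + 1) := by
    simp [h11, hc1.hF, e10, h12, freeCount, sum_range_succ]
  have hBV : B ≤ V := hc.h5 ▸ hb.1 5
  refine Wp.assign hV hb1 (by decide) ?_ (by simpa using hv)
  rw [hv]
  exact (freeCount_le _ _ _).trans (by omega)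

/-- Use the block number `reg 7`, which has `reg 11` free positions. -/
def useBlock : Cmd :=
  .assign 13 (R 11 - 2 * R 21) ;;
  .cond (.op .lt (R 2) (R 13)) (.assign 13 (R 2)) .skip ;;
  .assign 14 (R 13 + R 21) ;;
  .assign 2 (R 2 - R 13) ;;
  fill ;; elim ;; applySolution ;;
  .assign 8 ((R 7 + 1) * R 22 + R 14)

/-- Every full set of rows that the encoder may use in the block is linearly independent on the
free positions. -/
def GoodBlock (B L : ℕ) (F r : ℕ → ℕ) (base : ℕ) : Prop :=
  2 * L ≤ freeCount F base B →
    FullRank (freeCount F base B - L) B (fun x => F (base + x) = 0) fun a x => r (a + x)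

/-- The effect of the encoder on the block number `j`. -/
def BlockPost (B L : ℕ) (F m r : ℕ → ℕ) (j : ℕ) (s s' : State) : Prop :=
  s'.reg 2 = s.reg 2 - (freeCount F (j * B) B - 2 * L) ∧ s'.reg 9 ≤ s.reg 9 ∧
  IsBits (s'.arr 0) ∧ IsBits (s'.arr 4) ∧ s'.reg 8 / (B + 1) ≤ j + 1 ∧ s'.reg 8 < 2 ^ L ∧
  (s'.reg 9 = 1 →
    (∀ y, s'.arr 0 y ≠ s.arr 0 y → j * B ≤ y ∧ y < j * B + B ∧ F y = 0) ∧
    decList B L r (s'.arr 0) (j + 1) (s'.reg 8) =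
      (List.range (s.reg 2 - s'.reg 2)).map (fun e => m (s'.reg 2 + e)) ++
        decList B L r (s'.arr 0) j (s.reg 8)) ∧
  (GoodBlock B L F r (j * B) → s'.reg 9 = s.reg 9)

/-- The header is a two-digit number in base `B + 1` with digits `j + 1` and `k ≤ B`. Block numbers
start at 1, so the header 0 names no block and ends the chain. -/
theorem decList_chain {B L k q j : ℕ} {m r w : ℕ → ℕ} {rem : ℕ} (hq : q < 2 ^ L) (hk : k ≤ B)
    (hLk : L ≤ k) (hs : ∀ a, a < k → synd B r w (j * B) a = target L q m rem a) :
    decList B L r w (j + 1) ((j + 1) * (B + 1) + k) =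
      (List.range (k - L)).map (fun e => m (rem + e)) ++ decList B L r w j q := by
  have h1 : ((j + 1) * (B + 1) + k) / (B + 1) = j + 1 := by
    rw [mul_comm, Nat.mul_add_div (by omega), Nat.div_eq_of_lt (by omega), add_zero]
  have h2 : ((j + 1) * (B + 1) + k) % (B + 1) = k := by
    rw [mul_comm, Nat.mul_add_mod, Nat.mod_eq_of_lt (by omega)]
  rw [decList, if_pos h1, h2, min_eq_right hLk]
  congr 1
  · refine List.map_congr_left fun e he => ?_
    rw [List.mem_range] at he
    rw [hs _ (by omega), target, if_neg (by omega)]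
    congr 2
    omega
  · congr 1
    rw [sum_congr rfl fun i hi => by
      rw [hs i (by have := mem_range.1 hi; omega), target, if_pos (mem_range.1 hi)]]
    rw [sum_bits, Nat.mod_eq_of_lt hq]

/-- The block takes the last `d` of the message bits not yet stored, where `d` is at most `f - 2 *
L`. Together with the header this makes at most `f - L` equations, so `GoodBlock` guarantees a
solution. -/
theorem useBlock_spec {V B L j : ℕ} {F m r : ℕ → ℕ} {s : State} (hV : 20 ≤ V) (hb : Bdd V s)
    (hc : EncCtx B L F m r s) (h7 : s.reg 7 = j) (h10 : s.reg 10 = j * B)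
    (h11 : s.reg 11 = freeCount F (j * B) B) (hf : 2 * L ≤ freeCount F (j * B) B)
    (hF : IsBits F) (hm : IsBits m) (hr : IsBits r)
    (h9 : s.reg 9 ≤ 1) (h0 : IsBits (s.arr 0)) (h4 : IsBits (s.arr 4))
    (hq : s.reg 8 < 2 ^ L) (hj : (j + 2) * (B + 1) ≤ 2 ^ L) (hLV : 2 ^ L ≤ V) :
    Wp V useBlock (15 + B * (B * 10 + 21 + B * (B * 3 + 8))) s (BlockPost B L F m r j s) := by
  set f := freeCount F (j * B) B with hf'
  set rem := s.reg 2 with hrem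
  set d := min (f - 2 * L) rem with hd
  set k := d + L with hk
  have hfB : f ≤ B := freeCount_le _ _ _
  have hkB : k ≤ B := by omega
  have hBV : B + 1 ≤ V := hc.h22 ▸ hb.1 22
  have hremV : rem ≤ V := hb.1 2
  refine Wp.time (T := 1 + ((1 + 1) + (1 + (1 + ((k * (B * 3 + 6) + 3) +
    ((k * (B * 4 + 9 + k * (B * 3 + 8)) + 2) + ((k * (B * 3 + 6) + 2) + 1))))))) ?_ ?_
  swap
  · have h1 : k * (B * 4 + 9 + k * (B * 3 + 8)) ≤ B * (B * 4 + 9 + B * (B * 3 + 8)) := by gcongr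
    have h2 : k * (B * 3 + 6) ≤ B * (B * 3 + 6) := by gcongr
    have h3 : B * (B * 10 + 21 + B * (B * 3 + 8)) =
      B * (B * 4 + 9 + B * (B * 3 + 8)) + 2 * (B * (B * 3 + 6)) := by ring
    omega
  have hv13 : (R 11 - 2 * R 21).val s = f - 2 * L := by simp [h11, hc.h21]
  refine Wp.assign_seq hV hb (by decide) (by rw [hv13]; omega) fun hb1 => ?_
  rw [hv13] at hb1 ⊢
  refine (Wp.cond (Q := fun s' => s'.reg 13 = d) hV hb1 (by decide) (fun hlt => ?_)
    (fun hge => ?_)).seq fun s2 hb2 hs2 h13 => ?_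
  · refine Wp.assign hV hb1 (by decide) (hb1.1 2) ?_
    have : rem < f - 2 * L := by
      by_contra hcon
      exact hlt (by simpa using hcon)
    simp only [State.reg_setReg, if_true, Expr.val_reg, show (2 = 13) = False by decide, if_false]
    omega
  · refine Wp.skip hb1 ?_
    have : ¬ rem < f - 2 * L := by
      intro hcon
      rw [Expr.val_lt, if_pos (by simpa using hcon)] at hge
      exact one_ne_zero hge
    simp only [State.reg_setReg, if_true]
    omega
  have hc2 := (hc.setReg (x := 13) (n := f - 2 * L) (by decide)).of_same hs2 (by decide)
  have hv14 : (R 13 + R 21).val s2 = k := by simp [h13, hc2.h21, hk]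
  refine Wp.assign_seq hV hb2 (by decide) (by rw [hv14]; omega) fun hb3 => ?_
  rw [hv14] at hb3 ⊢
  have e2 : s2.reg 2 = rem := (hs2.1 2 (by decide)).trans (by simp [hrem])
  have hv2 : (R 2 - R 13).val (s2.setReg 14 k) = rem - d := by simp [h13, e2]
  refine Wp.assign_seq hV hb3 (by decide) (by rw [hv2]; omega) fun hb4 => ?_
  rw [hv2] at hb4 ⊢
  have hc4 := (hc2.setReg (x := 14) (n := k) (by decide)).setReg (x := 2) (n := rem - d) (by decide)
  set s4 := (s2.setReg 14 k).setReg 2 (rem - d) with hs4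
  have k2 : s4.reg 2 = rem - d := by simp [hs4]
  have k14 : s4.reg 14 = k := by simp [hs4]
  have k7 : s4.reg 7 = j := by
    have := (hs2.1 7 (by decide)); simp [hs4, this, h7]
  have k8 : s4.reg 8 = s.reg 8 := by
    have := (hs2.1 8 (by decide)); simp [hs4, this]
  have k9 : s4.reg 9 = s.reg 9 := by
    have := (hs2.1 9 (by decide)); simp [hs4, this]
  have k10 : s4.reg 10 = j * B := by
    have := (hs2.1 10 (by decide)); simp [hs4, this, h10]
  have ka0 : s4.arr 0 = s.arr 0 := by
    have := (hs2.2 0 (by decide)); simp [hs4, this]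
  have ka4 : s4.arr 4 = s.arr 4 := by
    have := (hs2.2 4 (by decide)); simp [hs4, this]
  refine (fill_spec hV hb4 hc4 k14 k8 k2 (ka4 ▸ h4) hm hr hq).seq ?_
  rintro s5 hb5 hs5 ⟨A, hA, hM, hrow⟩
  have hc5 := hc4.of_same hs5 (by decide)
  refine (elim_spec hV hb5 hA hM hc5.h5 hc5.h22 ((hs5.1 14 (by decide)).trans k14)
    ((hs5.1 10 (by decide)).trans k10) hc5.hF hF
    (by rw [hs5.1 9 (by decide), k9]; exact h9)).seq ?_
  rintro s6 hb6 hs6 ⟨A', hA', hM', hsol, hok, hpiv, hfull⟩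
  have hc6 := hc5.of_same hs6 (by decide)
  have l9 : s5.reg 9 = s.reg 9 := (hs5.1 9 (by decide)).trans k9
  have l0 : s6.arr 0 = s.arr 0 := (hs6.2 0 (by decide)).trans ((hs5.2 0 (by decide)).trans ka0)
  refine (applySolution_spec (free := fun y => F y = 0) hV hb6 hA' hM' hc6.h5 hc6.h22
    ((hs6.1 14 (by decide)).trans ((hs5.1 14 (by decide)).trans k14))
    ((hs6.1 10 (by decide)).trans ((hs5.1 10 (by decide)).trans k10)) (l0 ▸ h0) hpiv).seq ?_
  rintro s7 hb7 hs7 ⟨n0, hn⟩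
  have hc7 := hc6.of_same hs7 (by decide)
  have m9 : s7.reg 9 = s6.reg 9 := hs7.1 9 (by decide)
  have m2 : s7.reg 2 = rem - d := (hs7.1 2 (by decide)).trans
    ((hs6.1 2 (by decide)).trans ((hs5.1 2 (by decide)).trans k2))
  have m7 : s7.reg 7 = j := (hs7.1 7 (by decide)).trans
    ((hs6.1 7 (by decide)).trans ((hs5.1 7 (by decide)).trans k7))
  have m14 : s7.reg 14 = k := (hs7.1 14 (by decide)).trans
    ((hs6.1 14 (by decide)).trans ((hs5.1 14 (by decide)).trans k14))
  have n4 : IsBits (s7.arr 4) := by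
    rw [hs7.2 4 (by decide)]
    intro e
    rw [← Nat.div_add_mod' e (B + 1), hM' _ _ (Nat.mod_lt _ (by omega))]
    exact hA' _ _
  have hv8 : ((R 7 + 1) * R 22 + R 14).val s7 = (j + 1) * (B + 1) + k := by
    simp [m7, m14, hc7.h22]
  -- The new header fits into the `L` bits reserved for it in the next used block or in the side
  -- information.
  have hqlt : (j + 1) * (B + 1) + k < 2 ^ L := by
    have : (j + 2) * (B + 1) = (j + 1) * (B + 1) + (B + 1) := by ring
    omega
  have hdiv : ((j + 1) * (B + 1) + k) / (B + 1) = j + 1 := by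
    rw [mul_comm, Nat.mul_add_div (by omega), Nat.div_eq_of_lt (by omega), add_zero]
  refine Wp.assign hV hb7 (by decide) (by rw [hv8]; omega) ?_
  rw [hv8]
  have hremd : rem - d = rem - (f - 2 * L) := by omega
  refine ⟨by rw [State.reg_setReg, if_neg (by decide), m2, hremd], by simp [m9]; omega, n0, n4, by simp [hdiv],
    by simpa using hqlt, ?_, ?_⟩
  · simp only [State.reg_setReg, State.arr_setReg, show (9 = 8) = False by decide,
      show (2 = 8) = False by decide, if_false, if_true, m9, m2]
    intro h1
    obtain ⟨n1, n2⟩ := hn h1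
    refine ⟨fun y hy => n2 y (by rwa [l0]), ?_⟩
    rw [decList_chain hq hkB (by omega) fun a ha =>
      synd_eq_target hrow (fun a => ?_) (hsol _ n1) ha]
    · congr 3
      omega
    · unfold target
      split_ifs
      · omega
      · exact hm _
  · intro hg
    simp only [State.reg_setReg, show (9 = 8) = False by decide, if_false, m9]
    rw [hfull ?_, l9]
    refine ((hg hf).mono (k' := k) (by omega)).congr fun a x ha hx => (hrow a ha).1 x hx

/-- The work of the encoder on block number `reg 7`. -/
def encBlock : Cmd :=
  .assign 10 (R 7 * R 5) ;; countFree ;; .cond (.op .lt (R 11) (2 * R 21)) .skip useBlock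

/-- A block with fewer than `2 * L` free positions is left alone. The current header names a block
with number at most `j`, so the decoder will see that block `j + 1` is not in use. -/
theorem encBlock_spec {V B L j : ℕ} {F m r : ℕ → ℕ} {s : State} (hV : 20 ≤ V) (hb : Bdd V s)
    (hc : EncCtx B L F m r s) (h7 : s.reg 7 = j)
    (hF : IsBits F) (hm : IsBits m) (hr : IsBits r)
    (h9 : s.reg 9 ≤ 1) (h0 : IsBits (s.arr 0)) (h4 : IsBits (s.arr 4))
    (hq : s.reg 8 < 2 ^ L) (hqj : s.reg 8 / (B + 1) ≤ j)
    (hj : (j + 2) * (B + 1) ≤ 2 ^ L) (hLV : 2 ^ L ≤ V) :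
    Wp V encBlock (20 + B * (B * 10 + 24 + B * (B * 3 + 8))) s (BlockPost B L F m r j s) := by
  refine Wp.time (T := 1 + ((B * 3 + 3) + (1 + (15 + B * (B * 10 + 21 + B * (B * 3 + 8)))))) ?_
    (by ring_nf; omega)
  have hv10 : (R 7 * R 5).val s = j * B := by simp [h7, hc.h5]
  refine Wp.assign_seq hV hb (by decide) ?_ fun hb1 => ?_
  · rw [hv10]
    refine le_trans ?_ (hj.trans hLV)
    gcongr <;> omega
  rw [hv10] at hb1 ⊢
  have hc1 := hc.setReg (x := 10) (n := j * B) (by decide)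
  refine (countFree_spec (base := j * B) hV hb1 hc1 (by simp)).seq fun s2 hb2 hs2 h11 => ?_
  have hc2 := hc1.of_same hs2 (by decide)
  have hreg : ∀ x, x ≠ 10 → x ∉ countFree.wregs → s2.reg x = s.reg x := fun x hx hx' => by
    rw [hs2.1 x hx', State.reg_setReg, if_neg hx]
  have harr : ∀ x, x ∉ countFree.warrs → s2.arr x = s.arr x := fun x hx' => by
    rw [hs2.2 x hx', State.arr_setReg]
  have e2 := hreg 2 (by decide) (by decide)
  have e8 := hreg 8 (by decide) (by decide)
  have e9 := hreg 9 (by decide) (by decide)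
  have a0 := harr 0 (by decide)
  have a4 := harr 4 (by decide)
  refine Wp.cond hV hb2 (by decide) (fun hlt => ?_) (fun hge => ?_)
  · have hlt' : freeCount F (j * B) B < 2 * L := by
      by_contra hcon
      refine hlt ?_
      rw [Expr.val_lt, if_neg]
      simpa [h11, hc2.h21] using hcon
    refine (Wp.skip hb2 ?_).time (by omega)
    refine ⟨by rw [e2]; omega, e9.le, a0 ▸ h0, a4 ▸ h4, by rw [e8]; omega, e8 ▸ hq,
      fun _ => ⟨fun y hy => absurd (by rw [a0]) hy, ?_⟩, fun _ => e9⟩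
    rw [decList, if_neg (by rw [e8]; omega), e2, e8]
    simp
  · have hge' : 2 * L ≤ freeCount F (j * B) B := by
      by_contra! hcon
      rw [Expr.val_lt, if_pos (by simpa [h11, hc2.h21] using hcon)] at hge
      exact one_ne_zero hge
    have := useBlock_spec (j := j) hV hb2 hc2 ((hreg 7 (by decide) (by decide)).trans h7)
      ((hs2.1 10 (by decide)).trans (by simp)) h11 hge' hF hm hr (e9 ▸ h9) (a0 ▸ h0) (a4 ▸ h4)
      (e8 ▸ hq) hj hLV
    refine this.weaken le_rfl fun s' _ _ h => ?_
    simpa only [BlockPost, e2, e8, e9, a0, a4] using h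

/-- The loop of the encoder over the blocks. -/
def encLoop : Cmd := .for 7 6 encBlock

/-- At every moment the chain of blocks decodes to the tail of the message that begins at `reg 2`.
The capacity hypothesis makes `reg 2` zero after the last block. -/
theorem encLoop_spec {V B L M : ℕ} {F m r : ℕ → ℕ} {s : State} (hV : 20 ≤ V) (hb : Bdd V s)
    (hc : EncCtx B L F m r s) (h6 : s.reg 6 = M) (hF : IsBits F) (hm : IsBits m) (hr : IsBits r)
    (h9 : s.reg 9 = 1) (h0 : IsBits (s.arr 0)) (h4 : IsBits (s.arr 4)) (h8 : s.reg 8 = 0)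
    (hM : (M + 1) * (B + 1) ≤ 2 ^ L) (hLV : 2 ^ L ≤ V)
    (hcap : s.reg 2 ≤ ∑ j ∈ range M, (freeCount F (j * B) B - 2 * L)) :
    Wp V encLoop (M * (22 + B * (B * 10 + 24 + B * (B * 3 + 8))) + 2) s fun s' =>
      s'.reg 9 ≤ 1 ∧ IsBits (s'.arr 0) ∧ s'.reg 8 < 2 ^ L ∧
      (s'.reg 9 = 1 → (∀ y, s'.arr 0 y ≠ s.arr 0 y → F y = 0) ∧
        decList B L r (s'.arr 0) M (s'.reg 8) = (List.range (s.reg 2)).map m) ∧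
      ((∀ j, j < M → GoodBlock B L F r (j * B)) → s'.reg 9 = 1) := by
  refine ((Wp.for M (20 + B * (B * 10 + 24 + B * (B * 3 + 8))) (fun j s' =>
      s'.reg 2 = s.reg 2 - ∑ j ∈ range j, (freeCount F (j * B) B - 2 * L) ∧ s'.reg 9 ≤ 1 ∧
      IsBits (s'.arr 0) ∧ IsBits (s'.arr 4) ∧ s'.reg 8 / (B + 1) ≤ j ∧ s'.reg 8 < 2 ^ L ∧
      (s'.reg 9 = 1 → (∀ y, s'.arr 0 y ≠ s.arr 0 y → F y = 0) ∧
        decList B L r (s'.arr 0) j (s'.reg 8) =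
          (List.range (s.reg 2 - s'.reg 2)).map (fun e => m (s'.reg 2 + e))) ∧
      ((∀ j, j < M → GoodBlock B L F r (j * B)) → s'.reg 9 = 1)) hV hb h6 (by decide) (by decide)
      (by decide) ?_ ?_).time (by ring_nf; omega)).weaken le_rfl ?_
  · refine ⟨by simp, by simp [h9], by simpa using h0, by simpa using h4, by simp [h8],
      by simp [h8], fun _ => ⟨by simp, by simp [decList]⟩, fun _ => by simp [h9]⟩
  · rintro j hj s1 hb1 hs1 h7 ⟨i2, i9, i0, i4, i8, i8', iok, ig⟩
    have hc1 := hc.of_same hs1 (by decide)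
    refine (encBlock_spec hV hb1 hc1 h7 hF hm hr i9 i0 i4 i8' i8 (le_trans ?_ hM) hLV).weaken
      le_rfl ?_
    · exact Nat.mul_le_mul_right _ (by omega)
    rintro s2 hb2 hs2 ⟨p2, p9, p0, p4, p8, p8', pok, pg⟩
    simp only [State.reg_setReg, State.arr_setReg, show (2 = 7) = False by decide,
      show (9 = 7) = False by decide, show (8 = 7) = False by decide, if_false]
    refine ⟨?_, p9.trans i9, p0, p4, p8, p8', ?_, ?_⟩
    · rw [p2, i2, sum_range_succ, Nat.sub_sub]
    · intro h1
      obtain ⟨pa, pb⟩ := pok h1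
      obtain ⟨ia, ib⟩ := iok (by omega)
      refine ⟨fun y hy => ?_, ?_⟩
      · by_cases hy' : s2.arr 0 y = s1.arr 0 y
        · exact ia y (hy' ▸ hy)
        · exact (pa y hy').2.2
      -- Block `j` was changed only from position `j * B` on; its message bits come in front of
      -- those stored earlier.
      · rw [pb, decList_congr (w := s1.arr 0), ib]
        · have hle : s2.reg 2 ≤ s1.reg 2 := by omega
          have hle' : s1.reg 2 ≤ s.reg 2 := by omega
          obtain ⟨u, hu⟩ := Nat.exists_eq_add_of_le hle
          obtain ⟨v, hv⟩ := Nat.exists_eq_add_of_le hle'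
          rw [show s1.reg 2 - s2.reg 2 = u by omega, show s.reg 2 - s1.reg 2 = v by omega,
            show s.reg 2 - s2.reg 2 = u + v by omega, hu, List.range_add, List.map_append,
            List.map_map]
          congr 1
          refine List.map_congr_left fun e _ => ?_
          simp [add_assoc]
        · intro x hx
          by_contra hne
          have := (pa x hne).1
          omega
    · intro hg
      rw [pg (hg j hj), ig hg]
  · rintro s' - - ⟨i2, i9, i0, i4, i8, i8', iok, ig⟩
    have hz : s'.reg 2 = 0 := by omega
    refine ⟨i9, i0, i8', fun h => ⟨(iok h).1, ?_⟩, ig⟩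
    rw [(iok h).2, hz]
    simp

/-! ### The complete encoder -/

/-- Compute the parameters of the code: the number of bits of `reg 0`, the length `reg 21` of a
header, the length `reg 5` of a block, and the number `reg 6` of blocks. -/
def params : Cmd :=
  .assign 3 0 ;; .assign 4 1 ;;
  .loop (.op .lt (R 4) (R 0 + 1)) (.assign 4 (R 4 * 2) ;; .assign 3 (R 3 + 1)) ;;
  .assign 21 (2 * R 3) ;; .assign 5 (8 * R 1 * R 3) ;; .assign 6 (R 0 / R 5) ;;
  .assign 22 (R 5 + 1) ;; .assign 23 (2 * R 5)

theorem params_spec {V N c n : ℕ} {s : State} (hV : 20 ≤ V) (hb : Bdd V s) (h0 : s.reg 0 = N)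
    (h1 : s.reg 1 = c) (hn : n = Nat.size N) (hnV : 2 ^ n ≤ V) (hBV : 16 * c * n + 2 * n + 1 ≤ V) :
    Wp V params (n * 3 + 8) s fun s' => s'.reg 21 = 2 * n ∧ s'.reg 5 = 8 * c * n ∧
      s'.reg 6 = N / (8 * c * n) ∧ s'.reg 22 = 8 * c * n + 1 ∧ s'.reg 23 = 2 * (8 * c * n) := by
  have hn' : n < 2 ^ n := Nat.lt_two_pow_self
  have hc16 : 16 * c * n = 2 * (8 * c * n) := by ring
  refine Wp.time (T := 1 + (1 + ((n * ((1 + 1) + 1) + 1) + (1 + (1 + (1 + (1 + 1))))))) ?_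
    (by ring_nf; omega)
  refine Wp.assign_seq hV hb (by decide) (by simp) fun hb1 => ?_
  refine Wp.assign_seq hV hb1 (by decide) (by simp; omega) fun hb2 => ?_
  -- The loop doubles `reg 4` as long as it is at most `N`, hence exactly `Nat.size N` times.
  refine (Wp.loop n (1 + 1) (fun i s' => s'.reg 3 = i ∧ s'.reg 4 = 2 ^ i ∧ s'.reg 0 = N) hV
    (by decide) hb2 (by simp [h0]) ?_ ?_).seq ?_
  · rintro i hi s1 hb1 ⟨h3, h4, h0⟩
    have h2i : 2 ^ i ≤ N := Nat.lt_size.1 (hn ▸ hi)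
    have hpow : 2 ^ (i + 1) ≤ 2 ^ n := Nat.pow_le_pow_right two_pos hi
    refine ⟨by simp [h4, h0, Nat.lt_succ_of_le h2i], ?_⟩
    have hv : (R 4 * 2).val s1 = 2 ^ (i + 1) := by simp [h4, pow_succ]
    refine Wp.assign_seq hV hb1 (by decide) (by rw [hv]; omega) fun hb2 => ?_
    refine Wp.assign hV hb2 (by decide) (by simp [h3]; omega) ?_
    rw [hv]
    simp [h3, h0]
  · rintro s1 ⟨h3, h4, h0⟩
    have : N < 2 ^ n := hn ▸ Nat.lt_size_self N
    rw [Expr.val_lt, if_neg]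
    simp only [Expr.val_reg, Expr.val_add, Expr.val_one, h4, h0]
    omega
  · rintro s3 hb3 hs3 ⟨k3, k4, k0⟩
    have k1 : s3.reg 1 = c := (hs3.1 1 (by decide)).trans (by simpa using h1)
    have v1 : (2 * R 3).val s3 = 2 * n := by simp [k3]
    refine Wp.assign_seq hV hb3 (by decide) (by rw [v1]; omega) fun hb4 => ?_
    rw [v1] at hb4 ⊢
    have v2 : (8 * R 1 * R 3).val (s3.setReg 21 (2 * n)) = 8 * c * n := by simp [k3, k1]
    refine Wp.assign_seq hV hb4 (by decide) (by rw [v2]; omega) fun hb5 => ?_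
    rw [v2] at hb5 ⊢
    have v3 : (R 0 / R 5).val ((s3.setReg 21 (2 * n)).setReg 5 (8 * c * n)) =
      N / (8 * c * n) := by simp [k0]
    have : N ≤ V := h0 ▸ hb.1 0
    refine Wp.assign_seq hV hb5 (by decide) (by rw [v3]; exact (Nat.div_le_self _ _).trans this)
      fun hb6 => ?_
    rw [v3] at hb6 ⊢
    refine Wp.assign_seq hV hb6 (by decide) (by simp; omega) fun hb7 => ?_
    refine Wp.assign hV hb7 (by decide) (by simp; omega) ?_
    simp

/-- The encoder. -/
def encMain : Cmd :=
  params ;; .assign 9 1 ;; encLoop ;;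
  .for 12 23 (.store 1 (R 12) (.read 3 (R 12))) ;;
  .assign 16 (R 8) ;;
  .for 12 21 (.store 1 (R 23 + R 12) (R 16 % 2) ;; .assign 16 (R 16 / 2)) ;;
  .assign 1 (R 23 + R 21) ;; .assign 0 (R 9)

theorem encMain_spec {V N c n B L M : ℕ} {F m r : ℕ → ℕ} {s : State} (hV : 20 ≤ V) (hb : Bdd V s)
    (h0 : s.reg 0 = N) (h1 : s.reg 1 = c) (h8 : s.reg 8 = 0) (hn : n = Nat.size N)
    (hB : B = 8 * c * n) (hL : L = 2 * n) (hM : M = N / B) (hBV : 2 * B + L + 1 ≤ V)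
    (hMB : (M + 1) * (B + 1) ≤ 2 ^ L) (hLV : 2 ^ L ≤ V) (h0b : IsBits (s.arr 0))
    (h4b : IsBits (s.arr 4)) (h1F : s.arr 1 = F) (h2m : s.arr 2 = m) (h3r : s.arr 3 = r)
    (hF : IsBits F) (hm : IsBits m) (hr : IsBits r)
    (hcap : s.reg 2 ≤ ∑ j ∈ range M, (freeCount F (j * B) B - 2 * L)) :
    Wp V encMain (M * (22 + B * (B * 10 + 24 + B * (B * 3 + 8))) + B * 6 + n * 11 + 18) s fun s' =>
      s'.reg 0 ≤ 1 ∧ s'.reg 1 = 2 * B + L ∧ IsBits (s'.arr 0) ∧ ∃ q, q < 2 ^ L ∧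
      (∀ x, x < 2 * B → s'.arr 1 x = r x) ∧ (∀ i, i < L → s'.arr 1 (2 * B + i) = q / 2 ^ i % 2) ∧
      (s'.reg 0 = 1 → (∀ y, s'.arr 0 y ≠ s.arr 0 y → F y = 0) ∧
        decList B L r (s'.arr 0) M q = (List.range (s.reg 2)).map m) ∧
      ((∀ j, j < M → GoodBlock B L F r (j * B)) → s'.reg 0 = 1) := by
  refine Wp.time (T := (n * 3 + 8) + (1 + ((M * (22 + B * (B * 10 + 24 + B * (B * 3 + 8))) + 2) +
    (((2 * B) * (1 + 2) + 2) + (1 + ((L * ((1 + 1) + 2) + 2) + (1 + 1))))))) ?_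
    (by rw [hL]; ring_nf; omega)
  have hmod : ∀ z, z % 2 ≤ 1 := fun z => by omega
  have hnV : 2 ^ n ≤ V := (Nat.pow_le_pow_right two_pos (by omega)).trans hLV
  refine (params_spec hV hb h0 h1 hn hnV (by rw [hB, hL] at hBV; linarith)).seq ?_
  rintro s1 hb1 hs1 ⟨k21, k5, k6, k22, k23⟩
  rw [← hL] at k21
  rw [← hB] at k5 k6 k22 k23
  rw [← hM] at k6
  refine Wp.assign_seq hV hb1 (by decide) (by simp; omega) fun hb2 => ?_
  have e2 : s1.reg 2 = s.reg 2 := hs1.1 2 (by decide)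
  have e8 : s1.reg 8 = 0 := (hs1.1 8 (by decide)).trans h8
  have a0 : s1.arr 0 = s.arr 0 := hs1.2 0 (by decide)
  have a4 : s1.arr 4 = s.arr 4 := hs1.2 4 (by decide)
  have hc1 : EncCtx B L F m r s1 := ⟨k5, k21, k22, (hs1.2 1 (by decide)).trans h1F,
    (hs1.2 2 (by decide)).trans h2m, (hs1.2 3 (by decide)).trans h3r⟩
  have hc2 := hc1.setReg (x := 9) (n := (1 : Expr).val s1) (by decide)
  refine (encLoop_spec hV hb2 hc2 (by simpa using k6) hF hm hr (by simp) (by simpa [a0] using h0b)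
    (by simpa [a4] using h4b) (by simpa using e8) hMB hLV (by simpa [e2] using hcap)).seq ?_
  rintro s3 hb3 hs3 ⟨p9, p0, p8, pok, pg⟩
  simp only [State.arr_setReg, State.reg_setReg, show (2 = 9) = False by decide, if_false, a0, e2]
    at pok
  have hc3 := hc2.of_same hs3 (by decide)
  have k23' : s3.reg 23 = 2 * B := (hs3.1 23 (by decide)).trans (by simpa using k23)
  -- The frozen set in array `1` is no longer needed and gives way to the side information: first
  -- the seed, then the bits of the last header.
  refine (Wp.for (2 * B) 1 (fun y s' => ∀ x, x < y → s'.arr 1 x = r x) hV hb3 k23' (by decide)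
    (by decide) (by decide) (by simp) ?_).seq ?_
  · intro y hy s4 hb4 hs4 h12 hinv
    have e3 : s4.arr 3 = r := (hs4.2 3 (by decide)).trans hc3.hr
    refine Wp.store hV hb4 (by decide) (by decide) (hb4.2 _ _) ?_
    intro x hx
    simp only [State.arr_setReg, State.arr_setArr, if_true, Function.update_apply, Expr.val_reg,
      Expr.val_read, h12, e3]
    split_ifs with hxy
    · rw [hxy]
    · exact hinv x (by omega)
  intro s4 hb4 hs4 hcopy
  refine Wp.assign_seq hV hb4 (by decide) (hb4.1 8) fun hb5 => ?_
  have q8 : s4.reg 8 = s3.reg 8 := hs4.1 8 (by decide)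
  have q21 : s4.reg 21 = L := (hs4.1 21 (by decide)).trans hc3.h21
  have q23 : s4.reg 23 = 2 * B := (hs4.1 23 (by decide)).trans k23'
  have q9 : s4.reg 9 = s3.reg 9 := hs4.1 9 (by decide)
  have q0 : s4.arr 0 = s3.arr 0 := hs4.2 0 (by decide)
  refine (Wp.for L (1 + 1) (fun y s' => s'.reg 16 = s3.reg 8 / 2 ^ y ∧
    (∀ x, x < 2 * B → s'.arr 1 x = r x) ∧
    ∀ i, i < y → s'.arr 1 (2 * B + i) = s3.reg 8 / 2 ^ i % 2) hV hb5 (by simpa using q21)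
    (by decide) (by decide) (by decide) ⟨by simp [q8], hcopy, by simp⟩ ?_).seq ?_
  · rintro y hy s5 hb5 hs5 h12 ⟨i16, i1, i2⟩
    have e23 : s5.reg 23 = 2 * B := (hs5.1 23 (by decide)).trans (by simpa using q23)
    refine Wp.store_seq hV hb5 (by decide) (by decide) ((hmod _).trans (by omega)) fun hb6 => ?_
    refine Wp.assign hV hb6 (by decide) ((Nat.div_le_self _ _).trans (hb6.1 16)) ⟨?_, ?_, ?_⟩
    · simp [i16, Nat.div_div_eq_div_mul, pow_succ]
    · intro x hx
      simp only [State.arr_setReg, State.arr_setArr, if_true, Function.update_apply, Expr.val_reg,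
        Expr.val_add, h12, e23]
      rw [if_neg (by omega), i1 x hx]
    · intro i hi
      simp only [State.arr_setReg, State.arr_setArr, if_true, Function.update_apply, Expr.val_reg,
        Expr.val_add, Expr.val_mod, Expr.val_two, h12, e23, i16]
      split_ifs with hiy
      · rw [show i = y by omega]
      · exact i2 i (by omega)
  rintro s6 hb6 hs6 ⟨-, i1, i2⟩
  have r9 : s6.reg 9 = s3.reg 9 := (hs6.1 9 (by decide)).trans (by simpa using q9)
  have r21 : s6.reg 21 = L := (hs6.1 21 (by decide)).trans (by simpa using q21)
  have r23 : s6.reg 23 = 2 * B := (hs6.1 23 (by decide)).trans (by simpa using q23)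
  have r0 : s6.arr 0 = s3.arr 0 := (hs6.2 0 (by decide)).trans (by simpa using q0)
  refine Wp.assign_seq hV hb6 (by decide) (by simp [r21, r23]; omega) fun hb7 => ?_
  refine Wp.assign hV hb7 (by decide) (hb7.1 9) ?_
  simp only [State.reg_setReg, State.arr_setReg, if_true, show (1 = 0) = False by decide,
    show (9 = 1) = False by decide, if_false, Expr.val_reg, Expr.val_add, r9, r21, r23, r0]
  exact ⟨p9, trivial, p0, s3.reg 8, p8, i1, i2, pok, pg⟩

/-! ### The decoder -/

theorem sum_bits_lt (f : ℕ → ℕ) (hf : IsBits f) (y : ℕ) : ∑ i ∈ range y, 2 ^ i * f i < 2 ^ y := by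
  induction y with
  | zero => simp
  | succ y ih =>
    rw [sum_range_succ, pow_succ]
    have : 2 ^ y * f y ≤ 2 ^ y * 1 := Nat.mul_le_mul_left _ (hf y)
    omega

theorem synd_bits (B : ℕ) (r w : ℕ → ℕ) (base : ℕ) : IsBits (synd B r w base) := fun i => by
  unfold synd; omega

/-- Read the numbers in array `5` as a list of length `reg 9`. -/
def Out (s : State) (l : List ℕ) : Prop :=
  s.reg 9 = l.length ∧ ∀ p, p < l.length → s.arr 5 p = l.getD p 0

theorem Out.congr {s s' : State} {l : List ℕ} (h : Out s l) (h9 : s'.reg 9 = s.reg 9)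
    (h5 : s'.arr 5 = s.arr 5) : Out s' l := ⟨h9.trans h.1, by rw [h5]; exact h.2⟩

/-- Memory of the decoder. -/
structure DecCtx (B L : ℕ) (w u : ℕ → ℕ) (s : State) : Prop where
  h5 : s.reg 5 = B
  h21 : s.reg 21 = L
  h22 : s.reg 22 = B + 1
  hw : s.arr 0 = w
  hu : s.arr 1 = u

theorem DecCtx.of_same {B L : ℕ} {w u : ℕ → ℕ} {s s' : State} {p : Cmd}
    (h : DecCtx B L w u s) (hs : Same p s s')
    (hp : (5 ∉ p.wregs ∧ 21 ∉ p.wregs ∧ 22 ∉ p.wregs) ∧ 0 ∉ p.warrs ∧ 1 ∉ p.warrs) :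
    DecCtx B L w u s' where
  h5 := (hs.1 _ hp.1.1).trans h.h5
  h21 := (hs.1 _ hp.1.2.1).trans h.h21
  h22 := (hs.1 _ hp.1.2.2).trans h.h22
  hw := (hs.2 _ hp.2.1).trans h.hw
  hu := (hs.2 _ hp.2.2).trans h.hu

theorem DecCtx.setReg {B L : ℕ} {w u : ℕ → ℕ} {s : State} (h : DecCtx B L w u s) {x n : ℕ}
    (hx : x ≠ 5 ∧ x ≠ 21 ∧ x ≠ 22) : DecCtx B L w u (s.setReg x n) := by
  refine ⟨?_, ?_, ?_, h.hw, h.hu⟩ <;> rw [State.reg_setReg, if_neg (by omega)]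
  exacts [h.h5, h.h21, h.h22]

/-- Compute bit `reg 15` of the syndrome. -/
def syndBit : Cmd :=
  .assign 20 0 ;;
  .for 12 5 (.assign 20 (R 20 + .read 1 (R 15 + R 12) * .read 0 (R 10 + R 12))) ;;
  .assign 20 (R 20 % 2)

theorem syndBit_spec {V B L i base : ℕ} {w u : ℕ → ℕ} {s : State} (hV : 20 ≤ V) (hb : Bdd V s)
    (hc : DecCtx B L w u s) (hw : IsBits w) (hu : IsBits u) (h15 : s.reg 15 = i)
    (h10 : s.reg 10 = base) :
    Wp V syndBit (B * 3 + 4) s fun s' => s'.reg 20 = synd B u w base i := by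
  have hBV : B ≤ V := hc.h5 ▸ hb.1 5
  refine Wp.time (T := 1 + ((B * (1 + 2) + 2) + 1)) ?_ (by ring_nf; omega)
  refine Wp.assign_seq hV hb (by decide) (by simp) fun hb1 => ?_
  refine (Wp.for B 1 (fun y s' => s'.reg 20 = ∑ x ∈ range y, u (i + x) * w (base + x)) hV hb1
    (by simpa using hc.h5) (by decide) (by decide) (by decide) (by simp) ?_).seq ?_
  · intro y hy s1 hb1 hs1 h12 h20
    have hc1 := (hc.setReg (x := 20) (by decide)).of_same hs1 (by decide)
    have e15 : s1.reg 15 = i := (hs1.1 15 (by decide)).trans (by simpa using h15)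
    have e10 : s1.reg 10 = base := (hs1.1 10 (by decide)).trans (by simpa using h10)
    have hv : (R 20 + .read 1 (R 15 + R 12) * .read 0 (R 10 + R 12)).val s1 =
        ∑ x ∈ range (y + 1), u (i + x) * w (base + x) := by
      simp [h20, hc1.hu, hc1.hw, e15, e10, h12, sum_range_succ]
    refine Wp.assign hV hb1 (by decide) ?_ (by simpa using hv)
    rw [hv]
    calc _ ≤ ∑ x ∈ range (y + 1), 1 := sum_le_sum fun x _ => Nat.mul_le_mul (hu _) (hw _)
      _ ≤ V := by simp; omega
  · intro s2 hb2 hs2 h20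
    refine Wp.assign hV hb2 (by decide) ((Nat.mod_le _ _).trans (hb2.1 20)) ?_
    simp [h20, synd]

/-- Read block number `reg 7`. -/
def readBlock : Cmd :=
  .assign 10 ((R 7 - 1) * R 5) ;; .assign 14 (R 8 % R 22) ;; .assign 8 0 ;; .assign 16 1 ;;
  .for 15 14 (syndBit ;;
    .cond (.op .lt (R 15) (R 21))
      (.assign 8 (R 8 + R 16 * R 20) ;; .assign 16 (R 16 * 2))
      (.store 5 (R 9) (R 20) ;; .assign 9 (R 9 + 1)))

/-- The header `q` may come from a corrupt input and announce fewer than `L` bits; the minimum and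
the truncated subtraction describe what the program does then. The hypothesis on `out.length` keeps
the output counter within `V`. -/
theorem readBlock_spec {V B L j q : ℕ} {w u : ℕ → ℕ} {s : State} {out : List ℕ} (hV : 20 ≤ V)
    (hb : Bdd V s) (hc : DecCtx B L w u s) (hw : IsBits w) (hu : IsBits u) (h7 : s.reg 7 = j + 1)
    (h8 : s.reg 8 = q) (hout : Out s out) (hjV : j * B ≤ V) (hLV : 2 ^ L ≤ V)
    (hoV : out.length + B ≤ V) :
    Wp V readBlock (B * (B * 3 + 9) + 6) s fun s' =>
      s'.reg 8 = ∑ i ∈ range (min (q % (B + 1)) L), 2 ^ i * synd B u w (j * B) i ∧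
      Out s' (out ++ (List.range (q % (B + 1) - L)).map fun e => synd B u w (j * B) (L + e)) := by
  set k := q % (B + 1) with hk
  have hkB : k ≤ B := Nat.lt_succ_iff.1 (Nat.mod_lt _ (Nat.succ_pos B))
  have hBV : B ≤ V := hc.h5 ▸ hb.1 5
  have hsb := synd_bits B u w (j * B)
  refine Wp.time (T := 1 + (1 + (1 + (1 + (k * ((B * 3 + 4) + (1 + (1 + 1)) + 2) + 2))))) ?_ ?_
  swap
  · have : k * ((B * 3 + 4) + (1 + (1 + 1)) + 2) ≤ B * (B * 3 + 9) := Nat.mul_le_mul hkB (by omega)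
    omega
  have v10 : ((R 7 - 1) * R 5).val s = j * B := by simp [h7, hc.h5]
  refine Wp.assign_seq hV hb (by decide) (by rwa [v10]) fun hb1 => ?_
  rw [v10] at hb1 ⊢
  have v14 : (R 8 % R 22).val (s.setReg 10 (j * B)) = k := by simp [h8, hc.h22, hk]
  refine Wp.assign_seq hV hb1 (by decide) (by rw [v14]; omega) fun hb2 => ?_
  rw [v14] at hb2 ⊢
  refine Wp.assign_seq hV hb2 (by decide) (by simp) fun hb3 => ?_
  refine Wp.assign_seq hV hb3 (by decide) (by simp; omega) fun hb4 => ?_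
  have hc4 := (((hc.setReg (x := 10) (n := j * B) (by decide)).setReg (x := 14) (n := k)
    (by decide)).setReg (x := 8) (n := 0) (by decide)).setReg (x := 16) (n := 1) (by decide)
  refine (Wp.for k ((B * 3 + 4) + (1 + (1 + 1))) (fun y s' =>
      s'.reg 8 = ∑ i ∈ range (min y L), 2 ^ i * synd B u w (j * B) i ∧
      s'.reg 16 = 2 ^ min y L ∧
      Out s' (out ++ (List.range (y - L)).map fun e => synd B u w (j * B) (L + e))) hV hb4
    (by simp) (by decide) (by decide) (by decide)
    ⟨by simp, by simp, by simpa using hout.congr (by simp) (by simp)⟩ ?_).weaken le_rfl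
    fun _ _ _ h => ⟨h.1, h.2.2⟩
  rintro y hy s1 hb1 hs1 h15 ⟨i8, i16, iout⟩
  have hc1 := hc4.of_same hs1 (by decide)
  have e10 : s1.reg 10 = j * B := (hs1.1 10 (by decide)).trans (by simp)
  refine (syndBit_spec hV hb1 hc1 hw hu h15 e10).seq fun s2 hb2 hs2 h20 => ?_
  have hc2 := hc1.of_same hs2 (by decide)
  have f8 := (hs2.1 8 (by decide)).trans i8
  have f15 := (hs2.1 15 (by decide)).trans h15
  have f16 := (hs2.1 16 (by decide)).trans i16
  have fout := iout.congr (hs2.1 9 (by decide)) (hs2.2 5 (by decide))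
  refine Wp.cond hV hb2 (by decide) (fun hlt => ?_) (fun hge => ?_)
  · have hyL : y < L := by
      by_contra hcon
      refine hlt ?_
      rw [Expr.val_lt, if_neg]
      simpa [f15, hc2.h21] using hcon
    rw [min_eq_left hyL.le] at f8 f16
    have hpow : 2 ^ (y + 1) ≤ V := (Nat.pow_le_pow_right two_pos hyL).trans hLV
    have hv : (R 8 + R 16 * R 20).val s2 =
        ∑ i ∈ range (y + 1), 2 ^ i * synd B u w (j * B) i := by
      simp [f8, f16, h20, sum_range_succ]
    refine Wp.assign_seq hV hb2 (by decide)
      (by rw [hv]; exact (sum_bits_lt _ hsb _).le.trans hpow) fun hb3 => ?_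
    rw [hv] at hb3 ⊢
    refine Wp.assign hV hb3 (by decide) (by simpa [f16, ← pow_succ] using hpow) ⟨?_, ?_, ?_⟩
    · simp [min_eq_left (Nat.succ_le_of_lt hyL)]
    · simp [min_eq_left (Nat.succ_le_of_lt hyL), f16, pow_succ]
    · rw [show y + 1 - L = y - L by omega]
      exact fout.congr (by simp) (by simp)
  · have hyL : L ≤ y := by
      by_contra! hcon
      rw [Expr.val_lt, if_pos (by simpa [f15, hc2.h21] using hcon)] at hge
      exact one_ne_zero hge
    rw [min_eq_right hyL] at f8 f16
    obtain ⟨o9, o5⟩ := fout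
    rw [List.length_append, List.length_map, List.length_range] at o9
    refine Wp.store_seq hV hb2 (by decide) (by decide) (hb2.1 20) fun hb3 => ?_
    refine Wp.assign hV hb3 (by decide) (by simp [o9]; omega) ⟨?_, ?_, ?_⟩
    · simp [min_eq_right (hyL.trans (Nat.le_succ y)), f8]
    · simp [min_eq_right (hyL.trans (Nat.le_succ y)), f16]
    · rw [show y + 1 - L = (y - L) + 1 by omega, List.range_succ, List.map_append, ← List.append_assoc]
      have hlen : (out ++ (List.range (y - L)).map
        fun e => synd B u w (j * B) (L + e)).length = s2.reg 9 := by simp [o9]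
      refine ⟨by simp [o9, add_assoc], fun p hp => ?_⟩
      rw [List.length_append, hlen] at hp
      simp only [State.arr_setReg, State.arr_setArr, if_true, Function.update_apply, Expr.val_reg,
        h20]
      by_cases hpe : p = s2.reg 9
      · rw [if_pos hpe, List.getD_append_right _ _ _ _ (by omega), hlen, hpe, Nat.sub_self]
        simp [Nat.add_sub_cancel' hyL]
      · rw [if_neg hpe]
        have hp' : p < s2.reg 9 := by simp at hp; omega
        rw [List.getD_append _ _ _ _ (by omega)]
        exact o5 p (by omega)

/-- The loop of the decoder over the blocks, from the last one to the first. -/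
def decLoop : Cmd :=
  .loop (R 7) (.cond (.op .eq (R 8 / R 22) (R 7)) readBlock .skip ;; .assign 7 (R 7 - 1))

/-- Nothing is assumed about `q`, since the decoder has to halt in time on every input. The
invariant contains `Same decLoop` because the rule for general loops, unlike `Wp.for`, gives no link
to the initial state. -/
theorem decLoop_spec {V B L M q : ℕ} {w u : ℕ → ℕ} {s : State} (hV : 20 ≤ V) (hb : Bdd V s)
    (hc : DecCtx B L w u s) (hw : IsBits w) (hu : IsBits u) (h7 : s.reg 7 = M) (h8 : s.reg 8 = q)
    (h9 : s.reg 9 = 0) (hMB : M * B ≤ V) (hLV : 2 ^ L ≤ V) :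
    Wp V decLoop (M * (B * (B * 3 + 9) + 9) + 1) s fun s' =>
      Out s' (decList B L u w M q) := by
  refine ((Wp.loop M ((1 + (B * (B * 3 + 9) + 6)) + 1) (fun i s' => Same decLoop s s' ∧ i ≤ M ∧
      s'.reg 7 = M - i ∧
      ∃ out, Out s' out ∧ out.length ≤ i * B ∧
        decList B L u w M q = out ++ decList B L u w (M - i) (s'.reg 8)) hV (by decide) hb
        ⟨Same.refl _ _, Nat.zero_le _, h7, [], ⟨h9, by simp⟩, by simp, by simp [h8]⟩ ?_ ?_).time
        (by ring_nf; omega)).weaken le_rfl ?_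
  · rintro i hi s1 hb1 ⟨hs1, -, i7, out, iout, ilen, idec⟩
    have hc1 := hc.of_same hs1 (by decide)
    obtain ⟨j, hj⟩ : ∃ j, M - i = j + 1 := ⟨M - i - 1, by omega⟩
    rw [hj] at i7 idec
    refine ⟨by simp [i7], ?_⟩
    have hMB' : i * B + B + j * B = M * B := by rw [show M = i + 1 + j by omega]; ring
    refine (Wp.cond (T := B * (B * 3 + 9) + 6) (Q := fun s' => ∃ out', Out s' out' ∧
      out'.length ≤ (i + 1) * B ∧
      decList B L u w M q = out' ++ decList B L u w j (s'.reg 8)) hV hb1 (by decide)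
      (fun heq => ?_) (fun hne => ?_)).seq ?_
    · have heq' : s1.reg 8 / (B + 1) = j + 1 := by
        by_contra hcon
        refine heq ?_
        rw [Expr.val_eq, if_neg]
        simpa [i7, hc1.h22] using hcon
      refine (readBlock_spec hV hb1 hc1 hw hu i7 rfl iout (by omega) hLV (by omega)).weaken le_rfl ?_
      rintro s2 - - ⟨k8, kout⟩
      refine ⟨_, kout, ?_, ?_⟩
      · have : s1.reg 8 % (B + 1) < B + 1 := Nat.mod_lt _ (Nat.succ_pos B)
        rw [List.length_append, List.length_map, List.length_range, Nat.succ_mul]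
        omega
      · rw [idec, decList, if_pos heq', k8, List.append_assoc]
    · have hne' : s1.reg 8 / (B + 1) ≠ j + 1 := by
        intro hcon
        rw [Expr.val_eq, if_pos (by simpa [i7, hc1.h22] using hcon)] at hne
        exact one_ne_zero hne
      refine (Wp.skip hb1 ⟨out, iout, ?_, ?_⟩).time (by omega)
      · rw [Nat.succ_mul]
        omega
      · rw [idec, decList, if_neg hne']
    · rintro s2 hb2 hs2 ⟨out', oout, olen, odec⟩
      have k7 : s2.reg 7 = j + 1 := (hs2.1 7 (by decide)).trans i7
      refine Wp.assign hV hb2 (by decide) ?_ ⟨?_, hi, ?_, out', oout.congr (by simp) (by simp),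
        olen, ?_⟩
      · exact (Nat.sub_le _ _).trans (hb2.1 7)
      · refine (hs1.trans (hs2.mono (by simp +contextual [decLoop, Cmd.wregs])
          (by simp +contextual [decLoop, Cmd.warrs]))).trans
          ⟨fun x hx => ?_, fun _ _ => rfl⟩
        rw [State.reg_setReg, if_neg]
        rintro rfl
        exact hx (by decide)
      · simp [k7]; omega
      · rw [odec, show M - (i + 1) = j by omega]
        simp
  · rintro s1 ⟨-, -, i7, -⟩
    simpa using i7
  · rintro s1 - - ⟨-, -, -, out, iout, -, idec⟩
    rw [idec, Nat.sub_self, decList, List.append_nil]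
    exact iout

/-- The decoder. -/
def decMain : Cmd :=
  params ;; .assign 16 1 ;;
  .for 12 21 (.assign 8 (R 8 + R 16 * .read 1 (R 23 + R 12)) ;; .assign 16 (R 16 * 2)) ;;
  .assign 7 (R 6) ;; decLoop ;;
  .for 12 9 (.store 0 (R 12) (.read 5 (R 12))) ;;
  .assign 0 (R 9)

theorem decList_length_le (B L : ℕ) (r w : ℕ → ℕ) (j q : ℕ) :
    (decList B L r w j q).length ≤ j * B := by
  induction j generalizing q with
  | zero => simp [decList]
  | succ j ih =>
    have : q % (B + 1) < B + 1 := Nat.mod_lt _ (Nat.succ_pos B)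
    rw [decList, Nat.succ_mul]
    split_ifs
    · rw [List.length_append, List.length_map, List.length_range]
      have := ih (∑ i ∈ range (min (q % (B + 1)) L), 2 ^ i * synd B r w (j * B) i)
      omega
    · exact (ih q).trans (by omega)

theorem decMain_spec {V N c n B L M : ℕ} {w u : ℕ → ℕ} {s : State} (hV : 20 ≤ V) (hb : Bdd V s)
    (h0 : s.reg 0 = N) (h1 : s.reg 1 = c) (h8 : s.reg 8 = 0) (h9 : s.reg 9 = 0)
    (hn : n = Nat.size N) (hB : B = 8 * c * n) (hL : L = 2 * n) (hM : M = N / B)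
    (hBV : 2 * B + L + 1 ≤ V) (hLV : 2 ^ L ≤ V) (hsw : s.arr 0 = w) (hsu : s.arr 1 = u)
    (hw : IsBits w) (hu : IsBits u) :
    Wp V decMain (M * (B * (B * 3 + 12) + 9) + n * 11 + 17) s fun s' =>
      Out s' (decList B L u w M (∑ i ∈ range L, 2 ^ i * u (2 * B + i))) ∧
      s'.reg 0 = s'.reg 9 ∧ ∀ p, p < s'.reg 9 → s'.arr 0 p = s'.arr 5 p := by
  set l := decList B L u w M (∑ i ∈ range L, 2 ^ i * u (2 * B + i)) with hl
  have hll : l.length ≤ M * B := decList_length_le _ _ _ _ _ _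
  refine Wp.time (T := (n * 3 + 8) + (1 + ((L * ((1 + 1) + 2) + 2) + (1 +
    ((M * (B * (B * 3 + 9) + 9) + 1) + ((l.length * (1 + 2) + 2) + 1)))))) ?_ ?_
  swap
  · have : M * (B * (B * 3 + 12) + 9) = M * (B * (B * 3 + 9) + 9) + 3 * (M * B) := by ring
    omega
  have hNV : N ≤ V := h0 ▸ hb.1 0
  have hMN : M * B ≤ N := hM ▸ Nat.div_mul_le_self N B
  have hnV : 2 ^ n ≤ V := (Nat.pow_le_pow_right two_pos (by omega)).trans hLV
  refine (params_spec hV hb h0 h1 hn hnV (by rw [hB, hL] at hBV; linarith)).seq ?_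
  rintro s1 hb1 hs1 ⟨k21, k5, k6, k22, k23⟩
  rw [← hL] at k21
  rw [← hB] at k5 k6 k22 k23
  rw [← hM] at k6
  refine Wp.assign_seq hV hb1 (by decide) (by simp; omega) fun hb2 => ?_
  have e8 : s1.reg 8 = 0 := (hs1.1 8 (by decide)).trans h8
  have e9 : s1.reg 9 = 0 := (hs1.1 9 (by decide)).trans h9
  have hc1 : DecCtx B L w u s1 := ⟨k5, k21, k22, (hs1.2 0 (by decide)).trans hsw,
    (hs1.2 1 (by decide)).trans hsu⟩
  have hc2 := hc1.setReg (x := 16) (n := (1 : Expr).val s1) (by decide)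
  refine (Wp.for L (1 + 1) (fun y s' => s'.reg 8 = ∑ i ∈ range y, 2 ^ i * u (2 * B + i) ∧
    s'.reg 16 = 2 ^ y) hV hb2 hc2.h21 (by decide) (by decide) (by decide) (by simp [e8]) ?_).seq ?_
  · rintro y hy s3 hb3 hs3 h12 ⟨i8, i16⟩
    have hc3 := hc2.of_same hs3 (by decide)
    have k23' : s3.reg 23 = 2 * B := (hs3.1 23 (by decide)).trans (by simpa using k23)
    have hpow : 2 ^ (y + 1) ≤ V := (Nat.pow_le_pow_right two_pos hy).trans hLV
    have hv : (R 8 + R 16 * .read 1 (R 23 + R 12)).val s3 =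
        ∑ i ∈ range (y + 1), 2 ^ i * u (2 * B + i) := by
      simp [i8, i16, k23', h12, hc3.hu, sum_range_succ]
    refine Wp.assign_seq hV hb3 (by decide)
      (by rw [hv]; exact (sum_bits_lt (fun i => u (2 * B + i)) (fun i => hu _) _).le.trans hpow)
      fun hb4 => ?_
    rw [hv] at hb4 ⊢
    refine Wp.assign hV hb4 (by decide) (by simpa [i16, ← pow_succ] using hpow) ⟨?_, ?_⟩
    · simp
    · simp [i16, pow_succ]
  rintro s3 hb3 hs3 ⟨i8, -⟩
  have hc3 := hc2.of_same hs3 (by decide)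
  have f6 : s3.reg 6 = M := (hs3.1 6 (by decide)).trans (by simpa using k6)
  have f9 : s3.reg 9 = 0 := (hs3.1 9 (by decide)).trans (by simpa using e9)
  refine Wp.assign_seq hV hb3 (by decide) (hb3.1 6) fun hb4 => ?_
  refine (decLoop_spec hV hb4 (hc3.setReg (by decide)) hw hu (M := M) (by simp [f6])
    (by simpa using i8) (by simpa using f9) (by omega) hLV).seq fun s5 hb5 hs5 hout => ?_
  rw [← hl] at hout
  -- The message was collected in array `5`, as the vector in array `0` had to remain readable; now
  -- it can be overwritten.
  refine (Wp.for l.length 1 (fun y s' => ∀ p, p < y → s'.arr 0 p = s5.arr 5 p) hV hb5 hout.1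
    (by decide) (by decide) (by decide) (by simp) ?_).seq fun s6 hb6 hs6 hcopy => ?_
  · intro y hy s6 hb6 hs6 h12 hinv
    have g5 : s6.arr 5 = s5.arr 5 := hs6.2 5 (by decide)
    refine Wp.store hV hb6 (by decide) (by decide) (hb6.2 _ _) fun p hp => ?_
    simp only [State.arr_setReg, State.arr_setArr, if_true, Function.update_apply, Expr.val_reg,
      Expr.val_read, h12, g5]
    split_ifs with hpy
    · rw [hpy]
    · exact hinv p (by omega)
  have g5 : s6.arr 5 = s5.arr 5 := hs6.2 5 (by decide)
  have g9 : s6.reg 9 = s5.reg 9 := hs6.1 9 (by decide)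
  refine Wp.assign hV hb6 (by decide) (hb6.1 9) ⟨hout.congr (by simp [g9]) (by simp [g5]),
    by simp, fun p hp => ?_⟩
  simp only [State.reg_setReg, show (9 = 0) = False by decide, if_false, g9, hout.1] at hp
  simp [hcopy p hp, g5]

/-! ### Random seeds -/

theorem bits_ofFn {t : ℕ} (f : Fin t → Bool) (j : ℕ) :
    bits (List.ofFn f) j = if h : j < t then (f ⟨j, h⟩).toNat else 0 := by
  unfold bits
  split_ifs with h
  · rw [List.getD_eq_getElem _ _ (by simpa using h), List.getElem_ofFn]
  · rw [List.getD_eq_default _ _ (by simpa using h)]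
    rfl

theorem bits_isBits (x : List Bool) : IsBits (bits x) := fun _ => Bool.toNat_le _

/-- Let `i` be the largest index with `y i ≠ 0`. The equation for column `x` determines bit `i + x`
of the seed from bits at smaller positions. So such a seed is determined by its bits outside the
translate `P` of `S` by `i`. -/
theorem card_orthogonal_le {B K : ℕ} {S : Finset ℕ} (hS : S ⊆ range B) (hK : K ≤ B)
    (y : ℕ → ZMod 2) {a : ℕ} (ha : a < K) (hy : y a ≠ 0) :
    #{r : Fin (2 * B) → Bool | ∀ x ∈ S,
      ∑ a ∈ range K, y a * (bits (List.ofFn r) (a + x) : ZMod 2) = 0} * 2 ^ #S ≤ 2 ^ (2 * B) := by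
  have hne : ((range K).filter (y · ≠ 0)).Nonempty := ⟨a, by simp [ha, hy]⟩
  obtain ⟨i, hi, himax⟩ := exists_max_image _ id hne
  simp only [mem_filter, mem_range, id, and_imp] at hi himax
  let P : Finset (Fin (2 * B)) := univ.filter fun z => ∃ x ∈ S, z.val = i + x
  have hP : #P = #S := by
    symm
    refine card_bij (fun x hx => ⟨i + x, ?_⟩) ?_ ?_ ?_
    · have := mem_range.1 (hS hx); omega
    · intro x hx
      simp only [P, mem_filter, mem_univ, true_and]
      exact ⟨x, hx, rfl⟩
    · intro x _ x' _ h
      simpa using h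
    · intro z hz
      simp only [P, mem_filter, mem_univ, true_and] at hz
      obtain ⟨x, hx, hz⟩ := hz
      exact ⟨x, hx, Fin.ext hz.symm⟩
  have hcard : #(univ : Finset ({z // z ∉ P} → Bool)) * 2 ^ #S = 2 ^ (2 * B) := by
    have hle : #P ≤ 2 * B := (card_le_univ P).trans (by simp)
    rw [card_univ, Fintype.card_fun, Fintype.card_bool, Fintype.card_subtype_compl,
      Fintype.card_fin, Fintype.card_coe, ← hP, ← pow_add, Nat.sub_add_cancel hle]
  rw [← hcard]
  refine Nat.mul_le_mul_right _ (card_le_card_of_injOn (fun r z => r z.1) (by simp) ?_)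
  intro r hr r' hr' hrr
  simp only [coe_filter, mem_univ, true_and, Set.mem_ofPred_eq] at hr hr'
  -- Strong induction on the position: subtracting the equations of both seeds for column `x`, all
  -- terms below `i` cancel and `y i` times the difference at `i + x` is left.
  suffices H : ∀ n (z : Fin (2 * B)), z.val = n → r z = r' z from funext fun z => H _ z rfl
  intro n
  induction n using Nat.strong_induction_on with
  | _ n ih =>
    intro z hz
    by_cases hzP : z ∈ P
    · have hzP' := hzP
      simp only [P, mem_filter, mem_univ, true_and] at hzP'
      obtain ⟨x, hx, hzx⟩ := hzP'
      have hsum : ∑ a ∈ range K, y a * ((bits (List.ofFn r) (a + x) : ZMod 2) -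
          bits (List.ofFn r') (a + x)) = 0 := by
        simp only [mul_sub, sum_sub_distrib, hr x hx, hr' x hx, sub_zero]
      rw [sum_eq_single i] at hsum
      · rcases mul_eq_zero.1 hsum with h | h
        · exact absurd h hi.2
        · rw [bits_ofFn, bits_ofFn, dif_pos (hzx ▸ z.2), dif_pos (hzx ▸ z.2)] at h
          have hz' : (⟨i + x, hzx ▸ z.2⟩ : Fin (2 * B)) = z := Fin.ext hzx.symm
          rw [hz'] at h
          revert h
          cases r z <;> cases r' z <;> simp
      · intro a haK hai
        by_cases hya : y a = 0
        · rw [hya, zero_mul]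
        · have hlt : a < i := lt_of_le_of_ne (himax a (mem_range.1 haK) hya) hai
          have h2 : a + x < 2 * B := by have := z.2; omega
          rw [bits_ofFn, bits_ofFn, dif_pos h2, dif_pos h2,
            ih (a + x) (by omega) ⟨a + x, h2⟩ rfl, sub_self, mul_zero]
      · intro h
        exact absurd (mem_range.2 hi.1) h
    · exact congrFun hrr ⟨z, hzP⟩

open Classical in
-- A union bound over the fewer than `2 ^ K` nonzero coefficient vectors `y`.
theorem card_not_fullRank_le {B K : ℕ} {S : Finset ℕ} (hS : S ⊆ range B) (hK : K ≤ B) :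
    #{r : Fin (2 * B) → Bool | ¬ FullRank K B (· ∈ S) fun a x => bits (List.ofFn r) (a + x)} *
      2 ^ #S ≤ 2 ^ K * 2 ^ (2 * B) := by
  let ext : (Fin K → ZMod 2) → ℕ → ZMod 2 := fun y a => if h : a < K then y ⟨a, h⟩ else 0
  let bad : (Fin K → ZMod 2) → Finset (Fin (2 * B) → Bool) := fun y =>
    {r | ∀ x ∈ S, ∑ a ∈ range K, ext y a * (bits (List.ofFn r) (a + x) : ZMod 2) = 0}
  have hsub : ({r : Fin (2 * B) → Bool | ¬ FullRank K B (· ∈ S) fun a x =>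
      bits (List.ofFn r) (a + x)} : Finset _) ⊆ (univ.filter (· ≠ 0)).biUnion bad := by
    intro r hr
    simp only [mem_filter, mem_univ, true_and, FullRank, not_forall] at hr
    obtain ⟨y, hy, a, ha, hya⟩ := hr
    have hext : ∀ a, a < K → ext (fun a => y a) a = y a := fun a ha => by simp [ext, ha]
    refine mem_biUnion.2 ⟨fun a => y a, ?_, ?_⟩
    · simp only [mem_filter, mem_univ, true_and]
      exact fun h => hya (congrFun h ⟨a, ha⟩)
    · simp only [bad, mem_filter, mem_univ, true_and]
      intro x hx
      rw [sum_congr rfl fun a ha => by rw [hext a (mem_range.1 ha)]]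
      exact hy x (mem_range.1 (hS hx)) hx
  calc _ ≤ #((univ.filter (· ≠ 0)).biUnion bad) * 2 ^ #S :=
        Nat.mul_le_mul_right _ (card_le_card hsub)
    _ ≤ (∑ y ∈ univ.filter (· ≠ 0), #(bad y)) * 2 ^ #S :=
        Nat.mul_le_mul_right _ card_biUnion_le
    _ = ∑ y ∈ univ.filter (· ≠ 0), #(bad y) * 2 ^ #S := sum_mul _ _ _
    _ ≤ ∑ y ∈ univ.filter (fun y : Fin K → ZMod 2 => y ≠ 0), 2 ^ (2 * B) := sum_le_sum fun y hy => by
        obtain ⟨a, ha⟩ := Function.ne_iff.1 (mem_filter.1 hy).2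
        exact card_orthogonal_le hS hK (ext y) a.2 (by simpa [ext] using ha)
    _ = #(univ.filter (fun y : Fin K → ZMod 2 => y ≠ 0)) * 2 ^ (2 * B) := by
        rw [sum_const, smul_eq_mul]
    _ ≤ 2 ^ K * 2 ^ (2 * B) := Nat.mul_le_mul_right _ ((card_le_univ _).trans (by
        simp [ZMod.card]))

open Classical in
-- With f free columns and f - L rows the previous bound gives the fraction 2^(f - L) / 2^f of bad
-- seeds; `L` equations are given up for this.
theorem card_not_goodBlock_le {B L : ℕ} {F : ℕ → ℕ} (hF : IsBits F) (base : ℕ) :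
    #{r : Fin (2 * B) → Bool | ¬ GoodBlock B L F (bits (List.ofFn r)) base} * 2 ^ L ≤
      2 ^ (2 * B) := by
  set f := freeCount F base B with hf
  by_cases hL : 2 * L ≤ f
  swap
  · have : ({r : Fin (2 * B) → Bool | ¬ GoodBlock B L F (bits (List.ofFn r)) base} : Finset _) =
        ∅ := filter_false_of_mem fun r _ h => h fun h' => absurd h' hL
    simp [this]
  let S := (range B).filter fun x => F (base + x) = 0
  have hS : #S = f := by
    rw [card_filter, hf, freeCount]
    refine sum_congr rfl fun x _ => ?_
    have := hF (base + x)
    split_ifs <;> omega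
  have hfB : f ≤ B := freeCount_le _ _ _
  have h := card_not_fullRank_le (S := S) (filter_subset _ _) (K := f - L) (B := B) (by omega)
  rw [hS] at h
  have hpow : 2 ^ f = 2 ^ (f - L) * 2 ^ L := by rw [← pow_add, Nat.sub_add_cancel (by omega)]
  rw [hpow, mul_left_comm] at h
  refine le_trans (Nat.mul_le_mul_right _ (card_le_card fun r hr => ?_))
    (Nat.le_of_mul_le_mul_left h (by positivity))
  simp only [mem_filter, mem_univ, true_and] at hr ⊢
  refine fun hfull => hr fun _ y hy => hfull y fun x hx hxS => hy x hx ?_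
  exact (mem_filter.1 hxS).2

open Classical in
theorem card_exists_not_goodBlock_le {B L : ℕ} {F : ℕ → ℕ} (hF : IsBits F) (M : ℕ) :
    #{r : Fin (2 * B) → Bool | ¬ ∀ j < M, GoodBlock B L F (bits (List.ofFn r)) (j * B)} * 2 ^ L ≤
      M * 2 ^ (2 * B) := by
  have hsub : ({r : Fin (2 * B) → Bool | ¬ ∀ j < M, GoodBlock B L F (bits (List.ofFn r))
      (j * B)} : Finset _) ⊆ (range M).biUnion fun j =>
      {r | ¬ GoodBlock B L F (bits (List.ofFn r)) (j * B)} := by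
    intro r hr
    simp only [mem_filter, mem_univ, true_and, not_forall] at hr
    obtain ⟨j, hj, hr⟩ := hr
    exact mem_biUnion.2 ⟨j, mem_range.2 hj, by simpa using hr⟩
  calc _ ≤ _ := Nat.mul_le_mul_right _ ((card_le_card hsub).trans card_biUnion_le)
    _ = _ := sum_mul _ _ _
    _ ≤ ∑ j ∈ range M, 2 ^ (2 * B) := sum_le_sum fun j _ => card_not_goodBlock_le hF _
    _ = M * 2 ^ (2 * B) := by simp

/-! ### The capacity of the blocks -/

theorem sum_freeCount (F : ℕ → ℕ) (B M : ℕ) :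
    ∑ j ∈ range M, freeCount F (j * B) B = ∑ y ∈ range (M * B), (1 - F y) := by
  induction M with
  | zero => simp
  | succ M ih => rw [sum_range_succ, ih, Nat.succ_mul, sum_range_add, freeCount]

theorem sum_free_add_card {N : ℕ} (F : Finset (Fin N)) :
    ∑ y ∈ range N, (1 - bits (List.ofFn fun j => decide (j ∈ F)) y) + #F = N := by
  have h : #F = ∑ j : Fin N, if j ∈ F then 1 else 0 := by simp
  rw [← Fin.sum_univ_eq_sum_range (fun y => 1 - bits (List.ofFn fun j => decide (j ∈ F)) y) N, h,
    ← sum_add_distrib]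
  rw [sum_congr rfl (g := fun _ => 1)]
  · simp
  · intro j _
    rw [bits_ofFn, dif_pos j.2]
    by_cases hj : j ∈ F <;> simp [hj]

/-- Each block wastes at most `2 * L` free positions, and those beyond the last full block are not
used at all. -/
theorem capacity {N B L : ℕ} (F : Finset (Fin N)) :
    N - #F - N % B - N / B * (2 * L) ≤ ∑ j ∈ range (N / B),
      (freeCount (bits (List.ofFn fun j => decide (j ∈ F))) (j * B) B - 2 * L) := by
  set G := bits (List.ofFn fun j => decide (j ∈ F)) with hG
  have h1 : ∑ j ∈ range (N / B), freeCount G (j * B) B ≤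
      ∑ j ∈ range (N / B), (freeCount G (j * B) B - 2 * L) + N / B * (2 * L) := by
    have : N / B * (2 * L) = ∑ j ∈ range (N / B), 2 * L := by simp
    rw [this, ← sum_add_distrib]
    exact sum_le_sum fun j _ => by omega
  rw [sum_freeCount] at h1
  have h2 : ∑ y ∈ range N, (1 - G y) + #F = N := sum_free_add_card F
  have hN : N = N / B * B + N % B := (Nat.div_add_mod' N B).symm
  have h3 : ∑ y ∈ range N, (1 - G y) ≤ ∑ y ∈ range (N / B * B), (1 - G y) + N % B := by
    conv_lhs => rw [hN, sum_range_add]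
    refine Nat.add_le_add_left ?_ _
    calc _ ≤ ∑ y ∈ range (N % B), 1 := sum_le_sum fun y _ => by omega
      _ = N % B := by simp
  omega

/-! ### The code -/

/-- All binary strings of length `k`. -/
def strings (k : ℕ) : Finset (List Bool) := univ.image (List.ofFn : (Fin k → Bool) → List Bool)

theorem mem_strings {k : ℕ} {m : List Bool} : m ∈ strings k ↔ m.length = k := by
  simp only [strings, mem_image, mem_univ, true_and]
  constructor
  · rintro ⟨f, rfl⟩
    exact List.length_ofFn
  · rintro rfl
    exact ⟨m.get, List.ofFn_get m⟩

theorem card_strings (k : ℕ) : #(strings k) = 2 ^ k := by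
  rw [strings, card_image_of_injective _ List.ofFn_injective]
  simp

theorem logb_card_strings (k : ℕ) : Real.logb 2 (#(strings k) : ℝ) = k := by
  rw [card_strings]
  push_cast
  rw [Real.logb_pow, Real.logb_self_eq_one one_lt_two, mul_one]

/-- The program for the encoder; there is nothing to do if `reg 1` is at most `1`. -/
def encProg : Cmd := .cond (.op .lt 1 (R 1)) encMain (.assign 0 1 ;; .assign 1 0)

/-- The program for the decoder. -/
def decProg : Cmd := .cond (.op .lt 1 (R 1)) decMain (.assign 0 0)

/-- Row and column indices stay below `B`, so no bit beyond `2 * B` is read. The decoder can thus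
use the whole side information as the seed, although the header follows it. -/
theorem decList_congr_seed {B L : ℕ} {r r' w : ℕ → ℕ} (h : ∀ x, x < 2 * B → r' x = r x) (j q : ℕ) :
    decList B L r' w j q = decList B L r w j q := by
  induction j generalizing q with
  | zero => rfl
  | succ j ih =>
    have hs : ∀ i, i < B → synd B r' w (j * B) i = synd B r w (j * B) i := fun i hi => by
      unfold synd
      rw [sum_congr rfl fun x hx => by rw [h _ (by have := mem_range.1 hx; omega)]]
    have hk : q % (B + 1) < B + 1 := Nat.mod_lt _ (Nat.succ_pos B)
    rw [decList, decList]
    split_ifs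
    · rw [ih]
      congr 1
      · refine List.map_congr_left fun e he => hs _ ?_
        rw [List.mem_range] at he
        omega
      · congr 1
        refine sum_congr rfl fun i hi => ?_
        rw [hs i (by have := mem_range.1 hi; omega)]
    · exact ih q

theorem decList_bits (B L : ℕ) (r w : ℕ → ℕ) (j q : ℕ) : ∀ b ∈ decList B L r w j q, b ≤ 1 := by
  induction j generalizing q with
  | zero => simp [decList]
  | succ j ih =>
    intro b hb
    rw [decList] at hb
    split_ifs at hb
    · rcases List.mem_append.1 hb with hb | hb
      · obtain ⟨e, -, rfl⟩ := List.mem_map.1 hb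
        exact synd_bits _ _ _ _ _
      · exact ih _ b hb
    · exact ih _ b hb

theorem map_bits (m : List Bool) :
    ((List.range m.length).map (bits m)).map (fun b => decide (b = 1)) = m := by
  refine List.ext_getElem (by simp) fun i h1 h2 => ?_
  simp [bits, h2]

/-- The decoder as a function, for blocks of length `B`, headers of length `L` and `M` blocks. -/
def decode (N B L M : ℕ) (w : Fin N → Bool) (u : Fin (2 * B + L) → Bool) : List Bool :=
  (decList B L (bits (List.ofFn u)) (bits (List.ofFn w)) M
    (∑ i ∈ range L, 2 ^ i * bits (List.ofFn u) (2 * B + i))).map fun b => decide (b = 1)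

/-! ### Admissible parameters and their codes -/

/-- Conditions on the length `N`, the parameter `c`, the number `n` of bits of `N`, the length `B`
of the blocks, the length `L` of the headers and the number `M` of blocks. -/
structure Admissible (N c n B L M : ℕ) : Prop where
  hc : 2 ≤ c
  hn : n = Nat.size N
  hB : B = 8 * c * n
  hL : L = 2 * n
  hM : M = N / B
  hN : 2 * B * c ≤ N
  hn1 : 1 ≤ n

namespace Admissible

variable {N c n B L M : ℕ} (h : Admissible N c n B L M)
include h

theorem four_mul_le : 4 * B ≤ N := by
  have := h.hN
  have := Nat.mul_le_mul_left (2 * B) h.hc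
  omega

theorem sixteen_mul_le : 16 * n ≤ B := by
  rw [h.hB]
  exact Nat.mul_le_mul_right n (by have := h.hc; omega)

theorem lt_two_pow : N < 2 ^ n := h.hn ▸ Nat.lt_size_self N

theorem two_pow_sq : 2 ^ L = 2 ^ n * 2 ^ n := by rw [h.hL, two_mul, pow_add]

theorem two_pow_le : 2 ^ n * 64 ≤ 2 ^ L := by
  have h1 := h.four_mul_le
  have h2 := h.sixteen_mul_le
  have h3 := h.lt_two_pow
  have h4 := h.hn1
  rw [h.two_pow_sq]
  exact Nat.mul_le_mul_left _ (by omega)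

theorem mul_le : M * B ≤ N := h.hM ▸ Nat.div_mul_le_self N B

theorem le_length : M ≤ N := h.hM ▸ Nat.div_le_self N B

theorem succ_mul_succ_le : (M + 1) * (B + 1) ≤ 2 ^ L := by
  have h1 := h.mul_le
  have h2 := h.le_length
  have h3 := h.four_mul_le
  have h4 := h.two_pow_le
  have h5 := h.lt_two_pow
  have : (M + 1) * (B + 1) = M * B + M + B + 1 := by ring
  omega

/-- These inequalities let `2 ^ L`, a number of only 2n + 1 bits, serve as the bound `V` for the
memory. -/
theorem bounds : 20 ≤ 2 ^ L ∧ 2 * B + L + 1 ≤ 2 ^ L ∧ N ≤ 2 ^ L ∧ c ≤ 2 ^ L := by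
  have h1 := h.four_mul_le
  have h2 := h.sixteen_mul_le
  have h3 := h.two_pow_le
  have h4 := h.lt_two_pow
  have h5 := h.hL
  have h6 := h.hn1
  have h7 : c ≤ B := by
    rw [h.hB]
    have := Nat.le_mul_of_pos_right (8 * c) h6
    omega
  omega

/-- Elimination dominates with O(B³) steps per block, and `M * B ≤ N`. -/
theorem encMain_time_le : 1 + (M * (22 + B * (B * 10 + 24 + B * (B * 3 + 8))) + B * 6 + n * 11 + 18) ≤
    110 * N * B ^ 2 := by
  have h1 := h.four_mul_le
  have h2 := h.sixteen_mul_le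
  have h3 := h.hn1
  have hB1 : 1 ≤ B := by omega
  have e1 : 22 + B * (B * 10 + 24 + B * (B * 3 + 8)) ≤ 67 * B ^ 3 := by
    have q1 : 1 ≤ B ^ 3 := Nat.one_le_pow _ _ hB1
    have q2 : B ≤ B ^ 3 := Nat.le_self_pow (by omega) B
    have q3 : B ^ 2 ≤ B ^ 3 := Nat.pow_le_pow_right hB1 (by omega)
    have : B * (B * 10 + 24 + B * (B * 3 + 8)) = 18 * B ^ 2 + 24 * B + 3 * B ^ 3 := by ring
    omega
  have e2 : M * (22 + B * (B * 10 + 24 + B * (B * 3 + 8))) ≤ 67 * (N * B ^ 2) := by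
    calc _ ≤ M * (67 * B ^ 3) := Nat.mul_le_mul_left _ e1
      _ = 67 * (M * B * B ^ 2) := by ring
      _ ≤ 67 * (N * B ^ 2) := by gcongr; exact h.mul_le
  have e3 : N ≤ N * B ^ 2 := Nat.le_mul_of_pos_right _ (by positivity)
  have e4 : 110 * N * B ^ 2 = 110 * (N * B ^ 2) := by ring
  omega

theorem decMain_time_le : 1 + (M * (B * (B * 3 + 12) + 9) + n * 11 + 17) ≤ 110 * N * B ^ 2 := by
  refine le_trans ?_ h.encMain_time_le
  have : M * (B * (B * 3 + 12) + 9) ≤ M * (22 + B * (B * 10 + 24 + B * (B * 3 + 8))) := by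
    refine Nat.mul_le_mul_left _ ?_
    have : B * (B * 3 + 12) ≤ B * (B * 10 + 24 + B * (B * 3 + 8)) :=
      Nat.mul_le_mul_left _ (by omega)
    omega
  omega

theorem unit_le : unit (2 ^ L) ≤ 6800 * n := by
  have := h.hn1
  have := h.hL
  simp only [unit, len, Nat.size_pow]
  omega

/-- The output of the encoder is read off the final memory of the program, so that computability is
automatic and only correctness and success have to be shown. -/
theorem exists_encoding (v : Fin N → Bool) (F : Finset (Fin N)) (m : List Bool)
    (r : Fin (2 * B) → Bool) (hm : m.length = N - #F - N % B - M * (2 * L)) :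
    ∃ out : Option ((Fin N → Bool) × (Fin (2 * B + L) → Bool)),
      (∃ s τ, Run encProg (encInput c v F m r) s τ ∧ τ ≤ 110 * N * B ^ 2 * (6800 * n) ∧
        IsEncOutput s out) ∧
      (∀ w u, out = some (w, u) → (∀ j ∈ F, w j = v j) ∧ decode N B L M w u = m) ∧
      ((∀ j < M, GoodBlock B L (bits (List.ofFn fun j => decide (j ∈ F))) (bits (List.ofFn r))
        (j * B)) → out.isSome) := by
  obtain ⟨hV, hBV, hNV, hcV⟩ := h.bounds
  set s := encInput c v F m r with hs
  set G := bits (List.ofFn fun j => decide (j ∈ F)) with hG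
  have hmN : m.length ≤ N := by omega
  have hb : Bdd (2 ^ L) s := by
    constructor
    · intro x
      simp only [hs, encInput]
      split_ifs <;> omega
    · intro k i
      have hbb : ∀ x, bits x i ≤ 2 ^ L := fun x => (bits_isBits x i).trans (by omega)
      simp only [hs, encInput]
      split_ifs
      exacts [hbb _, hbb _, hbb _, hbb _, Nat.zero_le _]
  have hcap : s.reg 2 ≤ ∑ j ∈ range M, (freeCount G (j * B) B - 2 * L) := by
    change m.length ≤ _
    rw [hm, h.hM]
    exact capacity F
  have hspec := encMain_spec (F := G) (m := bits m) (r := bits (List.ofFn r)) hV hb (N := N)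
    (c := c) rfl rfl rfl h.hn h.hB h.hL h.hM hBV h.succ_mul_succ_le le_rfl (bits_isBits _)
    (fun _ => Nat.zero_le _) rfl rfl rfl (bits_isBits _) (bits_isBits _) (bits_isBits _) hcap
  have hprog : Wp (2 ^ L) encProg (1 + _) s _ :=
    Wp.cond hV hb (by decide) (fun _ => hspec) (fun h0 => by
      rw [Expr.val_lt, if_pos] at h0
      · exact absurd h0 one_ne_zero
      · change 1 < c
        exact h.hc)
  obtain ⟨s', τ, hrun, hτ, -, p0, p1, pb, q, hq, pr, pq, pok, pg⟩ := hprog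
  have hτ' : τ ≤ 110 * N * B ^ 2 * (6800 * n) :=
    hτ.trans (Nat.mul_le_mul h.encMain_time_le h.unit_le)
  rcases Nat.le_one_iff_eq_zero_or_eq_one.1 p0 with p0 | p0
  · exact ⟨none, ⟨s', τ, hrun, hτ', p0⟩, by simp, fun hg => by simp [pg hg] at p0⟩
  obtain ⟨pF, pdec⟩ := pok p0
  have hu1 : ∀ j, j < 2 * B + L → s'.arr 1 j ≤ 1 := fun j hj => by
    by_cases hjB : j < 2 * B
    · rw [pr j hjB]
      exact bits_isBits _ _
    · have := pq (j - 2 * B) (by omega)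
      rw [Nat.add_sub_cancel' (by omega)] at this
      omega
  have htoNat : ∀ b, b ≤ 1 → b = (decide (b = 1)).toNat := fun b hb => by
    rcases Nat.le_one_iff_eq_zero_or_eq_one.1 hb with rfl | rfl <;> rfl
  refine ⟨some (fun j => decide (s'.arr 0 j = 1), fun j => decide (s'.arr 1 j = 1)),
    ⟨s', τ, hrun, hτ', p0, p1, fun j => htoNat _ (pb _), fun j => htoNat _ (hu1 _ j.2)⟩, ?_,
    fun _ => rfl⟩
  rintro w u hwu
  obtain ⟨rfl, rfl⟩ := Prod.mk.inj (Option.some.inj hwu)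
  have hw : ∀ x, x < N → bits (List.ofFn fun j : Fin N => decide (s'.arr 0 j = 1)) x =
      s'.arr 0 x := fun x hx => by rw [bits_ofFn, dif_pos hx, ← htoNat _ (pb x)]
  have hu : ∀ x, x < 2 * B + L → bits (List.ofFn fun j : Fin (2 * B + L) =>
      decide (s'.arr 1 j = 1)) x = s'.arr 1 x := fun x hx => by
    rw [bits_ofFn, dif_pos hx, ← htoNat _ (hu1 x hx)]
  constructor
  · intro j hj
    have h1 : s'.arr 0 j = (v j).toNat := by
      have h2 : s'.arr 0 j = s.arr 0 j := by
        by_contra hne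
        have := pF j hne
        rw [hG, bits_ofFn, dif_pos j.2] at this
        simp [hj] at this
      rw [h2]
      change bits (List.ofFn v) j = _
      rw [bits_ofFn, dif_pos j.2]
    change decide (s'.arr 0 j = 1) = v j
    rw [h1]
    cases v j <;> rfl
  · have hM := h.mul_le
    have hsum : ∑ i ∈ range L, 2 ^ i * bits (List.ofFn fun j : Fin (2 * B + L) =>
        decide (s'.arr 1 j = 1)) (2 * B + i) = q := by
      rw [sum_congr rfl fun i hi => by
        rw [hu _ (by have := mem_range.1 hi; omega), pq i (mem_range.1 hi)], sum_bits,
        Nat.mod_eq_of_lt hq]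
    -- The vector agrees with array `0` on the `M * B ≤ N` positions in blocks, and the side
    -- information agrees with the seed on its first `2 * B` bits.
    rw [decode, hsum, decList_congr M q (w := s'.arr 0) fun x hx => hw x (by omega),
      decList_congr_seed (r := bits (List.ofFn r)) fun x hx => by rw [hu x (by omega), pr x hx],
      pdec]
    exact map_bits m

theorem exists_decoding (w : Fin N → Bool) (u : Fin (2 * B + L) → Bool) :
    ∃ s τ, Run decProg (decInput c w u) s τ ∧ τ ≤ 110 * N * B ^ 2 * (6800 * n) ∧
      IsDecOutput s (decode N B L M w u) := by
  obtain ⟨hV, hBV, hNV, hcV⟩ := h.bounds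
  set s := decInput c w u with hs
  have hb : Bdd (2 ^ L) s := by
    constructor
    · intro x
      simp only [hs, decInput]
      split_ifs <;> omega
    · intro k i
      have hbb : ∀ x, bits x i ≤ 2 ^ L := fun x => (bits_isBits x i).trans (by omega)
      simp only [hs, decInput]
      split_ifs
      exacts [hbb _, hbb _, Nat.zero_le _]
  have hspec := decMain_spec hV hb (N := N) (c := c) rfl rfl rfl rfl h.hn h.hB h.hL h.hM hBV le_rfl
    (w := bits (List.ofFn w)) (u := bits (List.ofFn u)) rfl rfl (bits_isBits _) (bits_isBits _)
  have hprog : Wp (2 ^ L) decProg (1 + _) s _ :=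
    Wp.cond hV hb (by decide) (fun _ => hspec) (fun h0 => by
      rw [Expr.val_lt, if_pos] at h0
      · exact absurd h0 one_ne_zero
      · change 1 < c
        exact h.hc)
  obtain ⟨s', τ, hrun, hτ, -, ⟨o9, o5⟩, p0, pc⟩ := hprog
  refine ⟨s', τ, hrun, hτ.trans (Nat.mul_le_mul h.decMain_time_le h.unit_le), ?_, ?_⟩
  · rw [p0, o9, decode, List.length_map]
  · intro j hj
    rw [decode, List.length_map] at hj
    rw [pc j (o9 ▸ hj), o5 j hj, List.getD_eq_getElem _ _ hj, bits, decode,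
      List.getD_eq_getElem _ _ (by rwa [List.length_map]), List.getElem_map]
    have := decList_bits _ _ _ _ _ _ _ (List.getElem_mem hj)
    rcases Nat.le_one_iff_eq_zero_or_eq_one.1 this with h | h <;> rw [h] <;> rfl

end Admissible

namespace Admissible

variable {N c n B L M : ℕ} (h : Admissible N c n B L M)
include h

/-- The number of message bits for `i` frozen positions is at least `N - i` up to lower terms. -/
theorem gap_le {ε : ℝ} (hcε : 1 ≤ c * ε) (i : ℕ) :
    (N : ℝ) - i - ε * N ≤ (N - i - N % B - M * (2 * L) : ℕ) := by
  have h1 : N ≤ (N - i - N % B - M * (2 * L)) + i + N % B + M * (2 * L) := by omega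
  have hB0 : 0 < B := by have := h.sixteen_mul_le; have := h.hn1; omega
  have h2 : N % B < B := Nat.mod_lt _ hB0
  -- Since 2L · 2c = 8cn = B, the 2L positions lost per block are the fraction 1/(2c) ≤ ε/2 of its
  -- length; this dictates the factor 8 in the block length.
  have h3 : M * (2 * L) * (2 * c) ≤ N := by
    calc M * (2 * L) * (2 * c) = M * B := by rw [h.hL, h.hB]; ring
      _ ≤ N := h.mul_le
  have h4 : (2 * B * c : ℝ) ≤ N := by exact_mod_cast h.hN
  have h5 : ((M * (2 * L) : ℕ) : ℝ) * (2 * c) ≤ N := by exact_mod_cast h3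
  have h1' : (N : ℝ) ≤ (N - i - N % B - M * (2 * L) : ℕ) + i + B + (M * (2 * L) : ℕ) := by
    exact_mod_cast h1.trans (by omega)
  have hε : 0 < ε := by
    by_contra! hcon
    have : (c : ℝ) * ε ≤ 0 := mul_nonpos_of_nonneg_of_nonpos (Nat.cast_nonneg _) hcon
    linarith
  have h6 : (2 * B : ℝ) ≤ N * ε := by
    have : (2 * B : ℝ) * 1 ≤ 2 * B * (c * ε) := by gcongr
    nlinarith
  have h7 : 2 * ((M * (2 * L) : ℕ) : ℝ) ≤ N * ε := by
    have : (2 * ((M * (2 * L) : ℕ) : ℝ)) * 1 ≤ 2 * ((M * (2 * L) : ℕ) : ℝ) * (c * ε) := by gcongr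
    nlinarith
  linarith

/-- The number of seeds for which the encoder may fail is small. -/
theorem successful_seeds (F : Finset (Fin N)) (S : Finset (Fin (2 * B) → Bool))
    (hS : ∀ r, (∀ j < M, GoodBlock B L (bits (List.ofFn fun j => decide (j ∈ F)))
      (bits (List.ofFn r)) (j * B)) → r ∈ S) : 1 - 1 / (N : ℝ) ≤ (#S : ℝ) / 2 ^ (2 * B) := by
  classical
  have hN0 : 0 < N := by have := h.four_mul_le; have := h.sixteen_mul_le; have := h.hn1; omega
  have h1 := card_exists_not_goodBlock_le (B := B) (L := L)
    (bits_isBits (List.ofFn fun j => decide (j ∈ F))) M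
  have h2 : #(univ \ S) * 2 ^ L ≤ M * 2 ^ (2 * B) := by
    refine le_trans (Nat.mul_le_mul_right _ (card_le_card fun r hr => ?_)) h1
    simp only [mem_sdiff, mem_univ, true_and] at hr
    simp only [mem_filter, mem_univ, true_and]
    exact fun hg => hr (hS r hg)
  have h3 : #(univ \ S) + #S = 2 ^ (2 * B) := by
    rw [card_sdiff_add_card_eq_card (subset_univ S)]
    simp
  -- One factor `N` pays for the union over at most `N` blocks, the other one is the final failure
  -- bound 1/N.
  have h4 : N * N ≤ 2 ^ L := by
    rw [h.two_pow_sq]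
    exact Nat.mul_le_mul h.lt_two_pow.le h.lt_two_pow.le
  have h5 : #(univ \ S) * N ≤ 2 ^ (2 * B) := by
    refine Nat.le_of_mul_le_mul_left (?_ : N * _ ≤ N * _) hN0
    calc N * (#(univ \ S) * N) = #(univ \ S) * (N * N) := by ring
      _ ≤ #(univ \ S) * 2 ^ L := Nat.mul_le_mul_left _ h4
      _ ≤ M * 2 ^ (2 * B) := h2
      _ ≤ N * 2 ^ (2 * B) := Nat.mul_le_mul_right _ h.le_length
  have h3' : (#(univ \ S) : ℝ) + #S = 2 ^ (2 * B) := by exact_mod_cast h3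
  have h5' : (#(univ \ S) : ℝ) * N ≤ 2 ^ (2 * B) := by exact_mod_cast h5
  have hN' : (0 : ℝ) < N := by exact_mod_cast hN0
  rw [le_div_iff₀ (by positivity), sub_mul, one_mul]
  have : (#(univ \ S) : ℝ) ≤ 1 / N * 2 ^ (2 * B) := by
    rw [one_div, inv_mul_eq_div, le_div_iff₀ hN']
    exact h5'
  linarith

theorem exists_code : ∃ C : RandomizedCode N (2 * B) (2 * B + L),
    (∀ i, C.msg i = strings (N - i - N % B - M * (2 * L))) ∧
    (∀ (v : Fin N → Bool) (F : Finset (Fin N)) (m : List Bool), m ∈ C.msg #F →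
      1 - 1 / (N : ℝ) ≤ C.successProb v F m) ∧
    EncodesInTime encProg c C (110 * N * B ^ 2 * (6800 * n) : ℕ) ∧
    DecodesInTime decProg c C (110 * N * B ^ 2 * (6800 * n) : ℕ) := by
  have key : ∀ (v : Fin N → Bool) (F : Finset (Fin N)) (m : List Bool) (r : Fin (2 * B) → Bool),
      ∃ out, m ∈ strings (N - #F - N % B - M * (2 * L)) →
      (∃ s τ, Run encProg (encInput c v F m r) s τ ∧ τ ≤ 110 * N * B ^ 2 * (6800 * n) ∧
        IsEncOutput s out) ∧
      (∀ w u, out = some (w, u) → (∀ j ∈ F, w j = v j) ∧ decode N B L M w u = m) ∧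
      ((∀ j < M, GoodBlock B L (bits (List.ofFn fun j => decide (j ∈ F))) (bits (List.ofFn r))
        (j * B)) → out.isSome) := by
    intro v F m r
    by_cases hm : m ∈ strings (N - #F - N % B - M * (2 * L))
    · obtain ⟨out, hout⟩ := h.exists_encoding v F m r (mem_strings.1 hm)
      exact ⟨out, fun _ => hout⟩
    · exact ⟨none, fun hm' => absurd hm' hm⟩
  choose enc henc using key
  refine ⟨⟨fun i => strings (N - i - N % B - M * (2 * L)), enc, decode N B L M,
    fun v F m r w u _ hm ho => ((henc v F m r hm).2.1 w u ho).1,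
    fun v F m r w u _ hm ho => ((henc v F m r hm).2.1 w u ho).2⟩, fun _ => rfl, ?_, ?_, ?_⟩
  · intro v F m hm
    refine h.successful_seeds F _ fun r hr => ?_
    simp only [mem_filter, mem_univ, true_and]
    exact (henc v F m r hm).2.2 hr
  · intro v F m r _ hm
    obtain ⟨s, τ, hrun, hτ, hout⟩ := (henc v F m r hm).1
    exact ⟨s, τ, hrun, by exact_mod_cast hτ, hout⟩
  · intro w u
    obtain ⟨s, τ, hrun, hτ, hout⟩ := h.exists_decoding w u
    exact ⟨s, τ, hrun, by exact_mod_cast hτ, hout⟩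

end Admissible

/-- For `c = 1` the only message is the empty string. -/
theorem exists_trivial_code (N : ℕ) : ∃ C : RandomizedCode N 0 0,
    (∀ i, C.msg i = strings 0) ∧ (∀ v F m, C.successProb v F m = 1) ∧
    EncodesInTime encProg 1 C 100 ∧ DecodesInTime decProg 1 C 100 := by
  refine ⟨⟨fun _ => strings 0, fun v _ _ _ => some (v, Fin.elim0), fun _ _ => [], ?_, ?_⟩,
    fun _ => rfl, ?_, ?_, ?_⟩
  · rintro v F m r w u - - ho j -
    obtain ⟨rfl, -⟩ := Prod.mk.inj (Option.some.inj ho)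
    rfl
  · rintro v F m r w u - hm -
    exact (List.length_eq_zero_iff.1 (mem_strings.1 hm)).symm
  · intro v F m
    simp [RandomizedCode.successProb]
  · intro v F m r _ _
    refine ⟨_, _, .cond_false rfl (.seq (.assign _ _ _) (.assign _ _ _)), ?_, rfl, rfl, ?_,
      fun j => j.elim0⟩
    · norm_cast
      change 1 + (len 1 + len 1 + len 1 + len 1) + (1 + len 1 + len 1 + (1 + len 0 + len 0)) ≤ 100
      simp [len]
    · intro j
      change bits (List.ofFn v) j = _
      rw [bits_ofFn, dif_pos j.2]
  · intro w u
    refine ⟨_, _, .cond_false rfl (.assign _ _ _), ?_, rfl, fun j hj => absurd hj (by simp)⟩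
    norm_cast
    change 1 + (len 1 + len 1 + len 1 + len 1) + (1 + len 0 + len 0) ≤ 100
    simp [len]

/-! ### Asymptotics -/

theorem size_le_two_mul_logb {N : ℕ} (hN : 2 ≤ N) : (Nat.size N : ℝ) ≤ 2 * Real.logb 2 N := by
  have h1 : Nat.size N - 1 < Nat.size N := by
    have : 0 < Nat.size N := Nat.size_pos.2 (by omega)
    omega
  have h2 : 2 ^ (Nat.size N - 1) ≤ N := Nat.lt_size.1 h1
  have h3 : ((Nat.size N - 1 : ℕ) : ℝ) ≤ Real.logb 2 N := by
    rw [Real.le_logb_iff_rpow_le one_lt_two (by positivity), Real.rpow_natCast]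
    exact_mod_cast h2
  have h4 : (1 : ℝ) ≤ Real.logb 2 N := by
    rw [Real.le_logb_iff_rpow_le one_lt_two (by positivity), Real.rpow_one]
    exact_mod_cast hN
  rw [Nat.cast_sub (by omega)] at h3
  push_cast at h3
  linarith

/-- A power of two p with p² ≤ N < 4p² satisfies n ≤ 2p, and 16A² ≤ N gives 2A < p; hence An ≤ p² ≤
N. -/
theorem mul_size_le {A N : ℕ} (hN : 16 * A ^ 2 ≤ N) : A * Nat.size N ≤ N := by
  rcases Nat.eq_zero_or_pos N with rfl | hN0
  · simp
  set n := Nat.size N with hn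
  have hn0 : 0 < n := Nat.size_pos.2 hN0
  have h1 : 2 ^ (n - 1) ≤ N := Nat.lt_size.1 (by omega)
  have h2 : N < 2 ^ n := Nat.lt_size_self N
  set p := 2 ^ ((n - 1) / 2) with hp
  have h3 : (n - 1) / 2 < p := Nat.lt_two_pow_self
  have h4 : p * p ≤ N := by
    rw [hp, ← pow_add]
    exact (Nat.pow_le_pow_right two_pos (by omega)).trans h1
  have h5 : N < 4 * (p * p) := by
    rw [hp, ← pow_add, show 4 = 2 ^ 2 by rfl, ← pow_add]
    exact h2.trans_le (Nat.pow_le_pow_right two_pos (by omega))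
  have h6 : 2 * A < p := by
    by_contra! hcon
    have := Nat.mul_le_mul hcon hcon
    nlinarith
  have h7 : n ≤ 2 * p := by omega
  calc A * n ≤ A * (2 * p) := Nat.mul_le_mul_left _ h7
    _ = 2 * A * p := by ring
    _ ≤ p * p := Nat.mul_le_mul_right _ h6.le
    _ ≤ N := h4

theorem isGapped_of_msg {N t l : ℕ} {C : RandomizedCode N t l} {ε : ℝ} {k : ℕ → ℕ}
    (hmsg : ∀ i, C.msg i = strings (k i))
    (hk : ∀ i : ℕ, 1 ≤ i → i ≤ N → (i : ℝ) / N < 1 - ε → (N : ℝ) - i - ε * N ≤ k i) :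
    C.IsGapped ε := by
  intro i hi hiN hlt
  have hN : (0 : ℝ) < N := by exact_mod_cast (by omega : 0 < N)
  rw [RandomizedCode.rate, hmsg, logb_card_strings, le_div_iff₀ hN, sub_mul, sub_mul, one_mul,
    div_mul_cancel₀ _ hN.ne']
  exact hk i hi hiN hlt

theorem exists_length_of_msg {N t l : ℕ} {C : RandomizedCode N t l} {k : ℕ → ℕ}
    (hmsg : ∀ i, C.msg i = strings (k i)) (i : ℕ) :
    ∃ k : ℕ, ∀ m : List Bool, m ∈ C.msg i ↔ m.length = k :=
  ⟨k i, fun m => by rw [hmsg, mem_strings]⟩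

theorem EncodesInTime.mono {N t l c : ℕ} {P : Cmd} {C : RandomizedCode N t l} {T T' : ℝ}
    (h : EncodesInTime P c C T) (hT : T ≤ T') : EncodesInTime P c C T' := fun v F m r h1 h2 =>
  let ⟨s, τ, hr, hτ, ho⟩ := h v F m r h1 h2
  ⟨s, τ, hr, hτ.trans hT, ho⟩

theorem DecodesInTime.mono {N t l c : ℕ} {P : Cmd} {C : RandomizedCode N t l} {T T' : ℝ}
    (h : DecodesInTime P c C T) (hT : T ≤ T') : DecodesInTime P c C T' := fun w u =>
  let ⟨s, τ, hr, hτ, ho⟩ := h w u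
  ⟨s, τ, hr, hτ.trans hT, ho⟩

/-- The threshold comes from `mul_size_le` with A = 16c², because the condition 2Bc ≤ N reads 16c²n
≤ N. -/
theorem exists_code_of_lt_one {ε : ℝ} (hε : 0 < ε) (hε1 : ε < 1) {N : ℕ}
    (hN : 16 * (16 * ⌈1 / ε⌉₊ ^ 2) ^ 2 ≤ N) :
    ∃ (t l : ℕ) (C : RandomizedCode N t l),
      C.IsGapped ε ∧
      (∀ i : ℕ, 1 ≤ i → i ≤ N → ∃ k : ℕ, ∀ m : List Bool, m ∈ C.msg i ↔ m.length = k) ∧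
      (t : ℝ) ≤ 2 * 10 ^ 9 * (1 / ε) * Real.logb 2 N ∧
      (l : ℝ) ≤ 2 * 10 ^ 9 * (1 / ε) * Real.logb 2 N ∧
      (∀ (v : Fin N → Bool) (F : Finset (Fin N)) (m : List Bool),
        1 ≤ F.card → m ∈ C.msg F.card →
          1 - 2 * 10 ^ 9 / Real.logb 2 N ≤ C.successProb v F m) ∧
      EncodesInTime encProg ⌈1 / ε⌉₊ C
        (2 * 10 ^ 9 * N * Real.logb 2 N ^ 3 * (1 / ε) ^ 2) ∧
      DecodesInTime decProg ⌈1 / ε⌉₊ C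
        (2 * 10 ^ 9 * N * Real.logb 2 N ^ 3 * (1 / ε) ^ 2) := by
  set c := ⌈1 / ε⌉₊ with hc
  have hε' : 1 < 1 / ε := by rwa [lt_div_iff₀ hε, one_mul]
  have hc2 : 2 ≤ c := Nat.lt_ceil.2 (by exact_mod_cast hε')
  have hcε : 1 ≤ c * ε := by
    have := Nat.le_ceil (1 / ε)
    rwa [div_le_iff₀ hε] at this
  have hc_le : (c : ℝ) ≤ 2 * (1 / ε) := by
    have := Nat.ceil_lt_add_one (a := 1 / ε) (by positivity)
    linarith
  have hN2 : 2 ≤ N := by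
    have : 1 ≤ (16 * c ^ 2) ^ 2 := Nat.one_le_pow _ _ (by positivity)
    omega
  have hsize := mul_size_le hN
  have hadm : Admissible N c (Nat.size N) (8 * c * Nat.size N) (2 * Nat.size N)
      (N / (8 * c * Nat.size N)) :=
    ⟨hc2, rfl, rfl, rfl, rfl, le_trans (le_of_eq (by ring)) hsize, Nat.size_pos.2 (by omega)⟩
  obtain ⟨C, hmsg, hprob, henc, hdec⟩ := hadm.exists_code
  have hlog := size_le_two_mul_logb hN2
  have hn1 : (1 : ℝ) ≤ Nat.size N := by exact_mod_cast hadm.hn1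
  have hlog0 : 0 < Real.logb 2 N := by linarith
  have hB : ((8 * c * Nat.size N : ℕ) : ℝ) ≤ 32 * (1 / ε) * Real.logb 2 N := by
    push_cast
    calc (8 * c * Nat.size N : ℝ) ≤ 8 * (2 * (1 / ε)) * (2 * Real.logb 2 N) := by gcongr
      _ = _ := by ring
  have htime : ((110 * N * (8 * c * Nat.size N) ^ 2 * (6800 * Nat.size N) : ℕ) : ℝ) ≤
      2 * 10 ^ 9 * N * Real.logb 2 N ^ 3 * (1 / ε) ^ 2 := by
    have e : ((110 * N * (8 * c * Nat.size N) ^ 2 * (6800 * Nat.size N) : ℕ) : ℝ) =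
        110 * N * ((8 * c * Nat.size N : ℕ) : ℝ) ^ 2 * (6800 * (Nat.size N : ℝ)) := by push_cast; ring
    rw [e]
    calc _ ≤ 110 * N * (32 * (1 / ε) * Real.logb 2 N) ^ 2 * (6800 * (2 * Real.logb 2 N)) := by
          gcongr
      _ = 1531904000 * (N * Real.logb 2 N ^ 3 * (1 / ε) ^ 2) := by ring
      _ ≤ 2 * 10 ^ 9 * (N * Real.logb 2 N ^ 3 * (1 / ε) ^ 2) := by gcongr; norm_num
      _ = _ := by ring
  have hx : 0 < 1 / ε * Real.logb 2 N := by positivity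
  refine ⟨_, _, C, isGapped_of_msg hmsg fun i _ _ _ => hadm.gap_le hcε i,
    fun i _ _ => exists_length_of_msg hmsg i, ?_, ?_, ?_, henc.mono htime, hdec.mono htime⟩
  · rw [Nat.cast_mul, Nat.cast_ofNat]
    nlinarith
  · have e : ((2 * (8 * c * Nat.size N) + 2 * Nat.size N : ℕ) : ℝ) =
        2 * ((8 * c * Nat.size N : ℕ) : ℝ) + 2 * Nat.size N := by push_cast; ring
    rw [e]
    have : Real.logb 2 N ≤ 1 / ε * Real.logb 2 N := le_mul_of_one_le_left hlog0.le hε'.le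
    nlinarith
  · intro v F m _ hm
    refine le_trans ?_ (hprob v F m hm)
    have hNpos : (0 : ℝ) < N := by exact_mod_cast (by omega : 0 < N)
    have hlogN : Real.logb 2 N ≤ N := by
      rw [Real.logb_le_iff_le_rpow one_lt_two hNpos, Real.rpow_natCast]
      exact_mod_cast Nat.lt_two_pow_self.le
    have : 1 / (N : ℝ) ≤ 2 * 10 ^ 9 / Real.logb 2 N :=
      div_le_div₀ (by norm_num) (by norm_num) hlog0 hlogN
    linarith

/-- No defect fraction lies below 1 - ε ≤ 0. The condition `N ≥ ε ^ 2` outweighs the factor `(1 / ε)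
^ 2`, so the time bound exceeds the constant 100. -/
theorem exists_code_of_one_le {ε : ℝ} (hε : 1 ≤ ε) {N : ℕ} (hN : max 2 ⌈ε ^ 2⌉₊ ≤ N) :
    ∃ (t l : ℕ) (C : RandomizedCode N t l),
      C.IsGapped ε ∧
      (∀ i : ℕ, 1 ≤ i → i ≤ N → ∃ k : ℕ, ∀ m : List Bool, m ∈ C.msg i ↔ m.length = k) ∧
      (t : ℝ) ≤ 2 * 10 ^ 9 * (1 / ε) * Real.logb 2 N ∧
      (l : ℝ) ≤ 2 * 10 ^ 9 * (1 / ε) * Real.logb 2 N ∧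
      (∀ (v : Fin N → Bool) (F : Finset (Fin N)) (m : List Bool),
        1 ≤ F.card → m ∈ C.msg F.card →
          1 - 2 * 10 ^ 9 / Real.logb 2 N ≤ C.successProb v F m) ∧
      EncodesInTime encProg ⌈1 / ε⌉₊ C
        (2 * 10 ^ 9 * N * Real.logb 2 N ^ 3 * (1 / ε) ^ 2) ∧
      DecodesInTime decProg ⌈1 / ε⌉₊ C
        (2 * 10 ^ 9 * N * Real.logb 2 N ^ 3 * (1 / ε) ^ 2) := by
  have hε0 : 0 < ε := by linarith
  have hN2 : 2 ≤ N := (le_max_left _ _).trans hN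
  have hc : ⌈1 / ε⌉₊ = 1 := by
    refine le_antisymm (Nat.ceil_le.2 ?_) (Nat.ceil_pos.2 (by positivity))
    rw [Nat.cast_one, div_le_iff₀ hε0, one_mul]
    exact hε
  have hlog : (1 : ℝ) ≤ Real.logb 2 N := by
    rw [Real.le_logb_iff_rpow_le one_lt_two (by positivity), Real.rpow_one]
    exact_mod_cast hN2
  have hNε : ε ^ 2 ≤ N := (Nat.le_ceil _).trans (by exact_mod_cast (le_max_right _ _).trans hN)
  have htime : (100 : ℝ) ≤ 2 * 10 ^ 9 * N * Real.logb 2 N ^ 3 * (1 / ε) ^ 2 := by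
    have h1 : (1 : ℝ) ≤ N * (1 / ε) ^ 2 := by
      rw [one_div, inv_pow, ← div_eq_mul_inv, le_div_iff₀ (by positivity), one_mul]
      exact hNε
    have h2 : (1 : ℝ) ≤ Real.logb 2 N ^ 3 := one_le_pow₀ hlog
    calc (100 : ℝ) ≤ 2 * 10 ^ 9 * (1 * 1) := by norm_num
      _ ≤ 2 * 10 ^ 9 * ((N * (1 / ε) ^ 2) * Real.logb 2 N ^ 3) := by gcongr
      _ = _ := by ring
  obtain ⟨C, hmsg, hprob, henc, hdec⟩ := exists_trivial_code N
  have hx : 0 ≤ 2 * 10 ^ 9 * (1 / ε) * Real.logb 2 N := by positivity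
  refine ⟨0, 0, C, isGapped_of_msg hmsg fun i hi _ hlt => ?_,
    fun i _ _ => exists_length_of_msg hmsg i, by simpa using hx, by simpa using hx, ?_,
    by rw [hc]; exact henc.mono htime, by rw [hc]; exact hdec.mono htime⟩
  · have : (0 : ℝ) ≤ (i : ℝ) / N := by positivity
    linarith
  · intro v F m _ _
    rw [hprob]
    have : 0 ≤ 2 * 10 ^ 9 / Real.logb 2 N := by positivity
    linarith

end StuckAt

theorem theorem4 :
    ∃ (PE PD : StuckAt.Cmd) (K : ℝ) (a b : ℕ), ∀ ε : ℝ, 0 < ε →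
      ∃ N₀ : ℕ, ∀ N : ℕ, N₀ < N →
        ∃ (t l : ℕ) (C : StuckAt.RandomizedCode N t l),
          C.IsGapped ε ∧
          (∀ i : ℕ, 1 ≤ i → i ≤ N → ∃ k : ℕ, ∀ m : List Bool, m ∈ C.msg i ↔ m.length = k) ∧
          (t : ℝ) ≤ K * (1 / ε) * Real.logb 2 N ∧
          (l : ℝ) ≤ K * (1 / ε) * Real.logb 2 N ∧
          (∀ (v : Fin N → Bool) (F : Finset (Fin N)) (m : List Bool),
            1 ≤ F.card → m ∈ C.msg F.card →
              1 - K / Real.logb 2 N ≤ C.successProb v F m) ∧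
          StuckAt.EncodesInTime PE ⌈1 / ε⌉₊ C (K * N * Real.logb 2 N ^ a * (1 / ε) ^ b) ∧
          StuckAt.DecodesInTime PD ⌈1 / ε⌉₊ C (K * N * Real.logb 2 N ^ a * (1 / ε) ^ b) := by
  -- The time is 110 N B² · 6800 n with B ≤ 32 (1/ε) log N and n ≤ 2 log N; this gives the exponents
  -- 3 and 2 and a constant 1531904000, rounded up.
  refine ⟨StuckAt.encProg, StuckAt.decProg, 2 * 10 ^ 9, 3, 2, fun ε hε => ?_⟩
  rcases lt_or_ge ε 1 with hε1 | hε1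
  · exact ⟨_, fun N hN => StuckAt.exists_code_of_lt_one hε hε1 hN.le⟩
  · exact ⟨_, fun N hN => StuckAt.exists_code_of_one_le hε1 hN.le⟩
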